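/- Let $d\ge 1$, let $v:\mathbb{R}^d\to\mathbb{R}^d$ be Lipschitz and bounded, with flow $\Phi^v_t$, $t\in\mathbb{R}$, and let $\omega\subset\mathbb{R}^d$ be a bounded open connected set. An admissible control is a localized field $(x,t)\mapsto \mathbf 1_\omega(x)u(x,t)$ that is bounded, measurable in $t$ for every $x$, and Lipschitz in $x$ with a constant that does not depend on $t$ (the bound and the Lipschitz constant may depend on the control). Let $\mu^0,\mu^1$ be compactly supported probability measures on $\mathbb{R}^d$ that are absolutely continuous with respect to the Lebesgue measure and satisfy the geometric condition: for each $x\in\operatorname{supp}\mu^0$ there is $t>0$ with $\Phi^v_t(x)\in\omega$, and for each $x\in\operatorname{supp}\mu^1$ there is $t>0$ with $\Phi^v_{-t}(x)\in\omega$. Put $t^0(x):=\inf\{t\ge 0:\Phi^v_t(x)\in\omega\}$ and $t^1(x):=\inf\{t\ge 0:\Phi^v_{-t}(x)\in\omega\}$, and for $t\ge 0$ and $m\in[0,1]$ $$\mathcal F(t):=\mu^0(\{x\in\operatorname{supp}\mu^0: t^0(x)\le t\}),\qquad \mathcal B(t):=\mu^1(\{x\in\operatorname{supp}\mu^1: t^1(x)\le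 t\}),$$ $$\mathcal F^{-1}(m):=\inf\{t\ge0:\mathcal F(t)\ge m\},\qquad \mathcal B^{-1}(m):=\inf\{t\ge0:\mathcal B(t)\ge m\},$$ $$S:=\sup_{m\in[0,1]}\{\mathcal F^{-1}(m)+\mathcal B^{-1}(1-m)\},\qquad S^*:=\sup\{t^l(x):x\in\operatorname{supp}\mu^l,\ l\in\{0,1\}\}.$$ The system $\partial_t\mu+\nabla\cdot((v+\mathbf 1_\omega u)\mu)=0$, $\mu(0)=\mu^0$, is called approximately controllable from $\mu^0$ to $\mu^1$ at time $T$ if there is a sequence of admissible controls $\mathbf 1_\omega u_k$ whose weak solutions $\mu_k\in C^0([0,T];\mathcal P_c(\mathbb{R}^d))$ (weakly continuous curves of compactly supported probability measures) are such that $\mu_k(T)$ converges weakly to $\mu^1$. Then $S$ is the infimum time for approximate control from $\mu^0$ to $\mu^1$ in the following sense. (i) If there is $\alpha>0$ such that $\{x\in\mathbb{R}^d: d(x,\omega^c)>\varepsilon\}$ is connected for every $\varepsilon\in(0,\alpha)$, then for every $T>S$ the system is approximately controllable from $\mu^0$ to $\mu^1$ at time $T$. (ii) If for every $t>0$ the boundary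 of the evolved set $\omega^t:=\bigcup_{\tau\in(0,t)}\Phi^v_\tau(\omega)$ has zero Lebesgue measure, then for every $T\in(S^*,S)$ the system is not approximately controllable from $\mu^0$ to $\mu^1$ at time $T$. -/

import Mathlib

open Set Filter Topology MeasureTheory

noncomputable section

namespace CrowdControl

/-- The state space `ℝ^d` with its Euclidean norm. -/
abbrev E (d : ℕ) : Type := EuclideanSpace ℝ (Fin d)

variable {d : ℕ}

/-- The natural velocity is admissible: Lipschitz and bounded. -/
def IsVelocity (v : E d → E d) : Prop :=
  (∃ L : NNReal, LipschitzWith L v) ∧ ∃ M : ℝ, ∀ x, ‖v x‖ ≤ M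

/-- The localized control `(t, x) ↦ 1_ω(x) u(x, t)`. -/
def localized (ω : Set (E d)) (u : ℝ → E d → E d) : ℝ → E d → E d :=
  fun t => ω.indicator (u t)

/-- The Carathéodory condition on the localized control `1_ω u`: Lipschitz in `x` (with a constant
valid at all times), measurable in `t`, bounded. The constants may depend on the control. -/
structure IsAdmissibleControl (ω : Set (E d)) (u : ℝ → E d → E d) : Prop where
  lipschitz : ∃ L : NNReal, ∀ t, LipschitzWith L (localized ω u t)
  measurable : ∀ x, Measurable fun t => localized ω u t x
  bounded : ∃ M : ℝ, ∀ t x, ‖localized ω u t x‖ ≤ M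

open Classical in
/-- The flow `Φ^v_t(x)`, `t ∈ ℝ`: the value at time `t` of the solution of `γ' = v(γ)`, `γ 0 = x`,
on the whole real line. For Lipschitz `v` this solution exists and is unique. -/
def flow (v : E d → E d) (t : ℝ) (x : E d) : E d :=
  if h : ∃ γ : ℝ → E d, γ 0 = x ∧ ∀ s, HasDerivAt γ (v (γ s)) s then h.choose t else x

/-- The geometric condition: every point of the support of `μ⁰` enters `ω` forward in time,
every point of the support of `μ¹` enters `ω` backward in time. -/
structure GeometricCondition (v : E d → E d) (ω : Set (E d))
    (μ0 μ1 : ProbabilityMeasure (E d)) : Prop where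
  forward : ∀ x ∈ (μ0 : Measure (E d)).support, ∃ t : ℝ, 0 < t ∧ flow v t x ∈ ω
  backward : ∀ x ∈ (μ1 : Measure (E d)).support, ∃ t : ℝ, 0 < t ∧ flow v (-t) x ∈ ω

/-- `t⁰(x)`: infimum time at which `x` enters `ω` forward in time. -/
def entryTime (v : E d → E d) (ω : Set (E d)) (x : E d) : ℝ :=
  sInf {t : ℝ | 0 ≤ t ∧ flow v t x ∈ ω}

/-- `t¹(x)`: infimum time at which `x` enters `ω` backward in time. -/
def backwardEntryTime (v : E d → E d) (ω : Set (E d)) (x : E d) : ℝ :=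
  sInf {t : ℝ | 0 ≤ t ∧ flow v (-t) x ∈ ω}

/-- `F_{μ⁰}(t)`: the mass of `μ⁰` that has entered `ω` forward in time by time `t`. -/
def forwardMass (v : E d → E d) (ω : Set (E d)) (μ0 : ProbabilityMeasure (E d)) (t : ℝ) : ℝ :=
  (μ0 : Measure (E d)).real {x | x ∈ (μ0 : Measure (E d)).support ∧ entryTime v ω x ≤ t}

/-- `B_{μ¹}(t)`: the mass of `μ¹` that has entered `ω` backward in time by time `t`. -/
def backwardMass (v : E d → E d) (ω : Set (E d)) (μ1 : ProbabilityMeasure (E d)) (t : ℝ) : ℝ :=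
  (μ1 : Measure (E d)).real {x | x ∈ (μ1 : Measure (E d)).support ∧ backwardEntryTime v ω x ≤ t}

/-- The generalised inverse `m ↦ inf {t ≥ 0 : G(t) ≥ m}` of a function `G` on `[0, ∞)`. -/
def genInverse (G : ℝ → ℝ) (m : ℝ) : ℝ :=
  sInf {t : ℝ | 0 ≤ t ∧ m ≤ G t}

/-- `S(μ⁰, μ¹) = sup_{m ∈ [0,1]} (F_{μ⁰}⁻¹(m) + B_{μ¹}⁻¹(1 - m))`. When `ω` is open, the supports
are compact and the geometric condition holds, the entry times are bounded on the supports, so that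
all infima and suprema here are those of nonempty bounded sets. -/
def infimumTime (v : E d → E d) (ω : Set (E d)) (μ0 μ1 : ProbabilityMeasure (E d)) : ℝ :=
  sSup ((fun m : ℝ => genInverse (forwardMass v ω μ0) m +
    genInverse (backwardMass v ω μ1) (1 - m)) '' Icc (0 : ℝ) 1)

/-- `S*(μ⁰, μ¹)`: the supremum of `t⁰` over the support of `μ⁰` and of `t¹` over the support
of `μ¹`. -/
def infimumTimeStar (v : E d → E d) (ω : Set (E d)) (μ0 μ1 : ProbabilityMeasure (E d)) : ℝ :=
  sSup (entryTime v ω '' (μ0 : Measure (E d)).support ∪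
    backwardEntryTime v ω '' (μ1 : Measure (E d)).support)

/-- `μ ∈ C⁰([0,T]; P_c(ℝ^d))` (weak topology) is a weak solution of the continuity equation
`∂ₜμ + ∇·(w μ) = 0` on `[0, T]` with initial datum `μ⁰`: for every test function `φ`,
`∫ φ dμ_t - ∫ φ dμ⁰ = ∫₀ᵗ ∫ ∇φ(x)·w(s, x) dμ_s(x) ds`. -/
structure IsSolution (w : ℝ → E d → E d) (T : ℝ) (μ0 : ProbabilityMeasure (E d))
    (μ : ℝ → ProbabilityMeasure (E d)) : Prop where
  continuousOn : ContinuousOn μ (Icc 0 T)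
  isCompact_support : ∀ t ∈ Icc 0 T, IsCompact (μ t : Measure (E d)).support
  initial : μ 0 = μ0
  integrable : ∀ φ : E d → ℝ, ContDiff ℝ (⊤ : ℕ∞) φ → HasCompactSupport φ →
    IntervalIntegrable (fun s => ∫ x, fderiv ℝ φ x (w s x) ∂(μ s : Measure (E d))) volume 0 T
  weak : ∀ φ : E d → ℝ, ContDiff ℝ (⊤ : ℕ∞) φ → HasCompactSupport φ → ∀ t ∈ Icc 0 T,
    ∫ x, φ x ∂(μ t : Measure (E d)) - ∫ x, φ x ∂(μ0 : Measure (E d)) =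
      ∫ s in (0 : ℝ)..t, ∫ x, fderiv ℝ φ x (w s x) ∂(μ s : Measure (E d))

/-- Approximate controllability of `∂ₜμ + ∇·((v + 1_ω u) μ) = 0` from `μ⁰` to `μ¹` at time `T`:
there are admissible controls `u_k` whose solutions `μ_k` starting at `μ⁰` are such that `μ_k(T)`
converges weakly to `μ¹`. -/
def ApproxControllable (v : E d → E d) (ω : Set (E d)) (μ0 μ1 : ProbabilityMeasure (E d))
    (T : ℝ) : Prop :=
  ∃ (u : ℕ → ℝ → E d → E d) (μ : ℕ → ℝ → ProbabilityMeasure (E d)),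
    (∀ k, IsAdmissibleControl ω (u k)) ∧
    (∀ k, IsSolution (fun t x => v x + localized ω (u k) t x) T μ0 (μ k)) ∧
    Tendsto (fun k => μ k T) atTop (𝓝 μ1)

/-- The evolved set `ω^t = ⋃_{τ ∈ (0,t)} Φ^v_τ(ω)`. -/
def evolvedSet (v : E d → E d) (ω : Set (E d)) (t : ℝ) : Set (E d) :=
  ⋃ τ ∈ Ioo (0 : ℝ) t, flow v τ '' ω

end CrowdControl

end

namespace CrowdControl

variable {d : ℕ}

/-! Part (i). A control of size `1/s` acting inside `ω` during a time `s → 0` composes the motion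
with the time-one flow of any chosen Lipschitz bounded field vanishing off `ω`; in the limit this
costs no time (`approxSteers_impulse`). Compositions of such flows, the sweeps, carry prescribed
shares of an absolutely continuous measure on a connected open set near prescribed distinct points,
with arbitrarily small loss (`Sweep.exists_sort`). As only weak convergence at time `T` is wanted,
it suffices to bring the right masses close to finitely many points.

Fix a time grid of `N` steps of length `h = T/N` and a core `U = {d(x, ωᶜ) > e}`. The support of
`μ1` is cut into small cells, also according to the first backward grid step at which a point lies
in `U`. Tracing a representative `y` of a cell back to that step gives a release point `z` in `U`:
whatever is released near `z` at the corresponding instant flows freely, is in `U` at no later grid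
instant, and arrives near `y` at time `T`. At each instant the newly captured mass and the waiting
mass are swept together: the shares now due go to their release points, the rest into a parking ball
that one step of drift keeps in `U` (`Plan.Feasible.state_impulse`). The supply suffices because
`F(s) + B(T' - s) ≥ 1` for every `s` and every `T' > S` (`one_le_add_of_sSup_lt`): the mass that has
entered by time `s` covers the mass that must have left by then. The slack `T - S` pays for the
delay of the grid, and the mass that the grid misses tends to zero.

Part (ii). A control acts only in `ω`, so mass whose free trajectory avoids `ω` must follow that
trajectory. Let `t = T - s`. The mass of `μ0` that has not entered by time `s` moves freely up to
`s`; the mass found at time `T` outside the closure of `ω^t` has moved freely since `s`. As `T >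
S*`, no point of the support belongs to both families, so the second mass is at most `F(s)` for
every control (`IsSolution.measureReal_le_forwardMass`). In the limit, with null boundary, `1 - B(T
- s) ≤ F(s)`, which fails for a suitable `s` when `T < S`.

Part (ii) concerns arbitrary weak solutions. Free transport of mass is derived directly from the
weak formulation (`IsWeakCurve.measureReal_le_flow`), by testing with mollified bumps around the
moving compact set whose slope decays fast enough to be almost nondecreasing along Euler steps of
the controlled field. -/

/-! ### The flow of a Lipschitz bounded field -/

theorem IsVelocity.exists_curve_Icc {b : E d → E d} (hb : IsVelocity b) (x : E d) (n : ℝ)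
    (hn : 0 ≤ n) : ∃ γ : ℝ → E d, γ 0 = x ∧ ∀ t ∈ Ioo (-n) n, HasDerivAt γ (b (γ t)) t := by
  obtain ⟨⟨L, hL⟩, M, hM⟩ := hb
  have hM0 : 0 ≤ M := (norm_nonneg _).trans (hM x)
  have h0 : (0 : ℝ) ∈ Icc (-n) n := ⟨by linarith, hn⟩
  -- At speed at most `M` the radius `M * n` is not exceeded in time `n`, so the interval of
  -- existence can have any length.
  have hpl : IsPicardLindelof (fun _ => b) (⟨0, h0⟩ : Icc (-n) n) x
      (NNReal.mk (M * n) (by positivity)) 0 (NNReal.mk M hM0) L := by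
    refine IsPicardLindelof.of_time_independent (fun y _ => hM y) hL.lipschitzOnWith ?_
    simp
  obtain ⟨γ, hγ0, hγ⟩ := hpl.exists_eq_forall_mem_Icc_hasDerivWithinAt₀
  refine ⟨γ, hγ0, fun t ht => ?_⟩
  exact (hγ t (Ioo_subset_Icc_self ht)).hasDerivAt (Icc_mem_nhds ht.1 ht.2)

theorem IsVelocity.exists_curve {b : E d → E d} (hb : IsVelocity b) (x : E d) :
    ∃ γ : ℝ → E d, γ 0 = x ∧ ∀ s, HasDerivAt γ (b (γ s)) s := by
  have h := fun n : ℕ => hb.exists_curve_Icc x (n + 1) (by positivity)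
  choose γ h0 hγ using h
  obtain ⟨⟨L, hL⟩, -⟩ := id hb
  have agree : ∀ n m : ℕ, n ≤ m → EqOn (γ n) (γ m) (Ioo (-((n : ℝ) + 1)) (n + 1)) := by
    intro n m hnm
    have hnm' : (n : ℝ) ≤ m := by exact_mod_cast hnm
    have hn : (0 : ℝ) ≤ n := by positivity
    refine ODE_solution_unique_of_mem_Ioo (v := fun _ => b) (s := fun _ => univ) (K := L)
      (t₀ := 0) (fun t _ => hL.lipschitzOnWith) ⟨by linarith, by linarith⟩
      (fun t ht => ⟨hγ n t ht, mem_univ _⟩)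
      (fun t ht => ⟨hγ m t ⟨by linarith [ht.1], by linarith [ht.2]⟩, mem_univ _⟩) ?_
    rw [h0, h0]
  -- At time `t` any curve of large enough index gives the same value. The `+ 1` in the intervals
  -- keeps `t` strictly inside.
  refine ⟨fun t => γ ⌈|t|⌉₊ t, by simp [h0], fun s => ?_⟩
  set N := ⌈|s|⌉₊ + 1 with hN
  have hsN : |s| < (N : ℝ) := by
    rw [hN]; push_cast; linarith [Nat.le_ceil |s|]
  have hmem : Ioo (-(N : ℝ)) N ∈ 𝓝 s := Ioo_mem_nhds (abs_lt.1 hsN).1 (abs_lt.1 hsN).2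
  have heq : (fun t => γ ⌈|t|⌉₊ t) =ᶠ[𝓝 s] γ N := by
    filter_upwards [hmem] with t ht
    have hle : ⌈|t|⌉₊ ≤ N := Nat.ceil_le.2 (abs_lt.2 ht).le
    refine agree _ _ hle ?_
    have := abs_le.1 (Nat.le_ceil |t|)
    exact ⟨by linarith, by linarith⟩
  have := hγ N s ⟨by linarith [(abs_lt.1 hsN).1], by linarith [(abs_lt.1 hsN).2]⟩
  have h2 := this.congr_of_eventuallyEq heq
  rwa [← heq.eq_of_nhds] at h2

theorem IsVelocity.flow_spec {b : E d → E d} (hb : IsVelocity b) (x : E d) :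
    flow b 0 x = x ∧ ∀ s, HasDerivAt (fun t => flow b t x) (b (flow b s x)) s := by
  have h := hb.exists_curve x
  have : (fun t => flow b t x) = h.choose := by
    ext1 t; simp only [flow, dif_pos h]
  have h' := h.choose_spec
  rw [← this] at h'
  exact h'

@[simp] theorem IsVelocity.flow_zero {b : E d → E d} (hb : IsVelocity b) (x : E d) :
    flow b 0 x = x := (hb.flow_spec x).1

theorem IsVelocity.hasDerivAt_flow {b : E d → E d} (hb : IsVelocity b) (x : E d) (s : ℝ) :
    HasDerivAt (fun t => flow b t x) (b (flow b s x)) s := (hb.flow_spec x).2 s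

theorem IsVelocity.eq_flow {b : E d → E d} (hb : IsVelocity b) {γ : ℝ → E d}
    (hγ : ∀ s, HasDerivAt γ (b (γ s)) s) (t : ℝ) : γ t = flow b t (γ 0) := by
  obtain ⟨⟨L, hL⟩, -⟩ := id hb
  have := ODE_solution_unique_univ (v := fun _ => b) (s := fun _ => univ) (K := L) (t₀ := 0)
    (f := γ) (g := fun t => flow b t (γ 0)) (fun _ => hL.lipschitzOnWith)
    (fun t => ⟨hγ t, mem_univ _⟩) (fun t => ⟨hb.hasDerivAt_flow _ t, mem_univ _⟩)
    (by simp [hb])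
  exact congrFun this t

theorem IsVelocity.flow_add {b : E d → E d} (hb : IsVelocity b) (s t : ℝ) (x : E d) :
    flow b (s + t) x = flow b s (flow b t x) := by
  have := hb.eq_flow (γ := fun r => flow b (r + t) x)
    (fun r => by simpa using (hb.hasDerivAt_flow x (r + t)).comp_add_const r t) s
  simpa using this

theorem IsVelocity.flow_neg_flow {b : E d → E d} (hb : IsVelocity b) (t : ℝ) (x : E d) :
    flow b (-t) (flow b t x) = x := by
  rw [← hb.flow_add]; simp [hb]

theorem IsVelocity.flow_flow_neg {b : E d → E d} (hb : IsVelocity b) (t : ℝ) (x : E d) :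
    flow b t (flow b (-t) x) = x := by
  rw [← hb.flow_add]; simp [hb]

theorem IsVelocity.const_smul {b : E d → E d} (hb : IsVelocity b) (c : ℝ) :
    IsVelocity (c • b) := by
  obtain ⟨⟨L, hL⟩, M, hM⟩ := hb
  refine ⟨⟨‖c‖₊ * L, LipschitzWith.of_dist_le_mul fun x y => ?_⟩, |c| * M, fun x => ?_⟩
  · simp only [Pi.smul_apply, dist_smul₀, NNReal.coe_mul, coe_nnnorm, mul_assoc]
    exact mul_le_mul_of_nonneg_left (hL.dist_le_mul x y) (norm_nonneg _)
  · simp only [Pi.smul_apply, norm_smul, Real.norm_eq_abs]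
    exact mul_le_mul_of_nonneg_left (hM x) (abs_nonneg _)

theorem IsVelocity.add {b c : E d → E d} (hb : IsVelocity b) (hc : IsVelocity c) :
    IsVelocity (b + c) := by
  obtain ⟨⟨L, hL⟩, M, hM⟩ := hb
  obtain ⟨⟨L', hL'⟩, M', hM'⟩ := hc
  exact ⟨⟨L + L', hL.add hL'⟩, M + M', fun x => (norm_add_le _ _).trans (add_le_add (hM x) (hM' x))⟩

theorem IsVelocity.continuous {b : E d → E d} (hb : IsVelocity b) : Continuous b := by
  obtain ⟨⟨L, hL⟩, -⟩ := hb
  exact hL.continuous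

theorem IsVelocity.flow_smul {b : E d → E d} (hb : IsVelocity b) (c t : ℝ) (x : E d) :
    flow (c • b) t x = flow b (c * t) x := by
  have := (hb.const_smul c).eq_flow (γ := fun r => flow b (c * r) x) (fun r => by
    have h1 : HasDerivAt (fun r : ℝ => c * r) c r := by
      simpa using (hasDerivAt_id r).const_mul c
    exact (hb.hasDerivAt_flow x (c * r)).scomp r h1) t
  simpa [hb] using this.symm

theorem IsVelocity.flow_eq_self {b : E d → E d} (hb : IsVelocity b) {x : E d} (hx : b x = 0)
    (t : ℝ) : flow b t x = x := by
  have := hb.eq_flow (γ := fun _ => x) (fun s => by simpa [hx] using hasDerivAt_const s x) t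
  exact this.symm

theorem IsVelocity.continuous_flow_left {b : E d → E d} (hb : IsVelocity b) (x : E d) :
    Continuous fun t => flow b t x :=
  continuous_iff_continuousAt.2 fun t => (hb.hasDerivAt_flow x t).continuousAt

theorem IsVelocity.dist_flow_time_le {b : E d → E d} (hb : IsVelocity b) {M : ℝ}
    (hM : ∀ x, ‖b x‖ ≤ M) (x : E d) (s t : ℝ) :
    dist (flow b s x) (flow b t x) ≤ M * |s - t| := by
  have := Convex.norm_image_sub_le_of_norm_hasDerivWithin_le (f := fun t => flow b t x)
    (f' := fun t => b (flow b t x)) (s := univ) (C := M) (x := t) (y := s)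
    (fun r _ => (hb.hasDerivAt_flow x r).hasDerivWithinAt) (fun r _ => hM _) convex_univ
    (mem_univ _) (mem_univ _)
  simpa [dist_eq_norm] using this

theorem IsVelocity.dist_flow_le_of_nonneg {b : E d → E d} (hb : IsVelocity b) {L : NNReal}
    (hL : LipschitzWith L b) {t : ℝ} (ht : 0 ≤ t) (x y : E d) :
    dist (flow b t x) (flow b t y) ≤ dist x y * Real.exp (L * t) := by
  have := dist_le_of_trajectories_ODE (v := fun _ => b) (K := L) (f := fun t => flow b t x)
    (g := fun t => flow b t y) (a := 0) (b := t) (δ := dist x y) (fun _ => hL)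
    (hb.continuous_flow_left x).continuousOn
    (fun s _ => (hb.hasDerivAt_flow x s).hasDerivWithinAt)
    (hb.continuous_flow_left y).continuousOn
    (fun s _ => (hb.hasDerivAt_flow y s).hasDerivWithinAt) (by simp [hb]) t ⟨ht, le_rfl⟩
  simpa using this

theorem IsVelocity.flow_neg {b : E d → E d} (hb : IsVelocity b) (t : ℝ) (x : E d) :
    flow (-b) t x = flow b (-t) x := by
  have := hb.flow_smul (-1) t x
  simpa using this

theorem IsVelocity.neg {b : E d → E d} (hb : IsVelocity b) : IsVelocity (-b) := by
  simpa using hb.const_smul (-1)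

theorem IsVelocity.lipschitzWith_flow {b : E d → E d} (hb : IsVelocity b) (t : ℝ) :
    ∃ K : NNReal, LipschitzWith K (flow b t) := by
  obtain ⟨⟨L, hL⟩, -⟩ := id hb
  refine ⟨NNReal.mk (Real.exp (L * |t|)) (Real.exp_pos _).le, LipschitzWith.of_dist_le_mul fun x y => ?_⟩
  rw [NNReal.coe_mk, mul_comm]
  rcases le_total 0 t with h | h
  · simpa [abs_of_nonneg h] using hb.dist_flow_le_of_nonneg hL h x y
  · have := hb.neg.dist_flow_le_of_nonneg (L := L) hL.neg (neg_nonneg.2 h) x y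
    rwa [hb.flow_neg, hb.flow_neg, neg_neg, ← abs_of_nonpos h] at this

theorem IsVelocity.continuous_flow {b : E d → E d} (hb : IsVelocity b) :
    Continuous fun p : ℝ × E d => flow b p.1 p.2 := by
  obtain ⟨-, M, hM⟩ := id hb
  have hM0 : 0 ≤ M := (norm_nonneg _).trans (hM 0)
  refine (continuous_prod_of_continuous_lipschitzWith' (fun p : E d × ℝ => flow b p.2 p.1)
    (NNReal.mk M hM0) (fun x => LipschitzWith.of_dist_le_mul fun s t => ?_) fun t => ?_).comp
    continuous_swap
  · simpa [Real.dist_eq] using hb.dist_flow_time_le hM x s t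
  · obtain ⟨K, hK⟩ := hb.lipschitzWith_flow t
    exact hK.continuous

theorem IsVelocity.dist_flow_flow_le {b c : E d → E d} (hb : IsVelocity b) (hc : IsVelocity c)
    {L : NNReal} (hL : LipschitzWith L b) {ε : ℝ} (h : ∀ x, dist (c x) (b x) ≤ ε) {t : ℝ}
    (ht : 0 ≤ t) (x : E d) :
    dist (flow c t x) (flow b t x) ≤ gronwallBound 0 L ε t := by
  have := dist_le_of_approx_trajectories_ODE (v := fun _ => b) (K := L) (f := fun t => flow c t x)
    (g := fun t => flow b t x) (a := 0) (b := t) (δ := 0) (εf := ε) (εg := 0)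
    (f' := fun t => c (flow c t x)) (g' := fun t => b (flow b t x)) (fun _ => hL)
    (hc.continuous_flow_left x).continuousOn
    (fun s _ => (hc.hasDerivAt_flow x s).hasDerivWithinAt) (fun s _ => h _)
    (hb.continuous_flow_left x).continuousOn
    (fun s _ => (hb.hasDerivAt_flow x s).hasDerivWithinAt) (fun s _ => by simp)
    (by simp [hb, hc]) t ⟨ht, le_rfl⟩
  simpa using this

/-! ### Controlled flows and the weak solutions they carry -/

/-- The Carathéodory conditions on a time dependent field. -/
structure IsCaratheodory (w : ℝ → E d → E d) : Prop where
  lipschitz : ∃ L : NNReal, ∀ t, LipschitzWith L (w t)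
  measurable : Measurable (Function.uncurry w)
  bounded : ∃ M : ℝ, ∀ t x, ‖w t x‖ ≤ M

/-- Continuity in `x` upgrades measurability in `t` to joint measurability, which Fubini needs. -/
theorem IsAdmissibleControl.isCaratheodory {v : E d → E d} (hv : IsVelocity v) {ω : Set (E d)}
    {u : ℝ → E d → E d} (hu : IsAdmissibleControl ω u) :
    IsCaratheodory fun t x => v x + localized ω u t x := by
  obtain ⟨⟨L, hL⟩, M, hM⟩ := id hv
  obtain ⟨⟨L', hL'⟩, hm, M', hM'⟩ := hu
  refine ⟨⟨L + L', fun t => hL.add (hL' t)⟩, ?_, M + M', fun t x =>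
    (norm_add_le _ _).trans (add_le_add (hM x) (hM' t x))⟩
  have h : Measurable (Function.uncurry fun (x : E d) (t : ℝ) => localized ω u t x) :=
    measurable_uncurry_of_continuous_of_measurable (fun t => (hL' t).continuous) hm
  exact (hv.continuous.measurable.comp measurable_snd).add (h.comp measurable_swap)

theorem norm_fderiv_le_of_hasCompactSupport {φ : E d → ℝ} (hφ : ContDiff ℝ (⊤ : ℕ∞) φ)
    (hc : HasCompactSupport φ) : ∃ C : ℝ, 0 ≤ C ∧ ∀ x, ‖fderiv ℝ φ x‖ ≤ C := by
  obtain ⟨C, hC⟩ := (hc.fderiv (𝕜 := ℝ)).exists_bound_of_continuous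
    (hφ.continuous_fderiv (by simp))
  exact ⟨C, (norm_nonneg _).trans (hC 0), hC⟩

theorem IsCaratheodory.measurable_fderiv_apply {w : ℝ → E d → E d} (hw : IsCaratheodory w)
    {φ : E d → ℝ} (hφ : ContDiff ℝ (⊤ : ℕ∞) φ) :
    Measurable fun p : ℝ × E d => fderiv ℝ φ p.2 (w p.1 p.2) := by
  have h1 : Continuous fun p : (E d →L[ℝ] ℝ) × E d => p.1 p.2 := by fun_prop
  exact h1.measurable.comp
    (((hφ.continuous_fderiv (by simp)).measurable.comp measurable_snd).prodMk hw.measurable)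

/-- `X` is the flow, from time `0` on, of the field `v + 1_ω u` with `u` admissible. -/
structure IsControlledFlow (v : E d → E d) (ω : Set (E d)) (u : ℝ → E d → E d)
    (X : ℝ → E d → E d) : Prop where
  admissible : IsAdmissibleControl ω u
  continuous : Continuous fun p : ℝ × E d => X p.1 p.2
  init : ∀ x, X 0 x = x
  deriv : ∀ x t, 0 ≤ t →
    HasDerivWithinAt (fun s => X s x) (v (X t x) + localized ω u t (X t x)) (Ici t) t

/-- The chain rule for `φ (X s x)` is integrated along each trajectory and averaged against `μ0` by
Fubini. Right derivatives suffice for this, so trajectories may have corners where two controls are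
concatenated. -/
theorem IsControlledFlow.isSolution {v : E d → E d} (hv : IsVelocity v) {ω : Set (E d)}
    {u X : ℝ → E d → E d} (h : IsControlledFlow v ω u X) (T : ℝ)
    (μ0 : ProbabilityMeasure (E d)) (hμ0 : IsCompact (μ0 : Measure (E d)).support) :
    IsSolution (fun t x => v x + localized ω u t x) T μ0 fun t =>
      μ0.map (f := X t) ((h.continuous.comp (Continuous.prodMk_right t)).aemeasurable) := by
  have hw := h.admissible.isCaratheodory hv
  set w : ℝ → E d → E d := fun t x => v x + localized ω u t x with hwdef
  obtain ⟨M, hM⟩ := hw.bounded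
  have hXt : ∀ t, Continuous (X t) := fun t => h.continuous.comp (Continuous.prodMk_right t)
  have hXx : ∀ x, Continuous fun t => X t x := fun x =>
    h.continuous.comp (Continuous.prodMk_left x)
  have hG : ∀ φ : E d → ℝ, ContDiff ℝ (⊤ : ℕ∞) φ →
      Measurable fun p : ℝ × E d => fderiv ℝ φ (X p.1 p.2) (w p.1 (X p.1 p.2)) := fun φ hφ =>
    (hw.measurable_fderiv_apply hφ).comp (measurable_fst.prodMk h.continuous.measurable)
  have hGb : ∀ φ : E d → ℝ, ContDiff ℝ (⊤ : ℕ∞) φ → HasCompactSupport φ → ∃ C : ℝ,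
      ∀ s x, ‖fderiv ℝ φ (X s x) (w s (X s x))‖ ≤ C := by
    intro φ hφ hc
    obtain ⟨C, hC0, hC⟩ := norm_fderiv_le_of_hasCompactSupport hφ hc
    exact ⟨C * M, fun s x => (ContinuousLinearMap.le_opNorm _ _).trans
      (mul_le_mul (hC _) (hM _ _) (norm_nonneg _) hC0)⟩
  have hpush : ∀ φ : E d → ℝ, ContDiff ℝ (⊤ : ℕ∞) φ → ∀ s,
      ∫ x, fderiv ℝ φ x (w s x) ∂(μ0 : Measure (E d)).map (X s) =
        ∫ x, fderiv ℝ φ (X s x) (w s (X s x)) ∂(μ0 : Measure (E d)) := by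
    intro φ hφ s
    rw [integral_map (hXt s).aemeasurable]
    exact ((hw.measurable_fderiv_apply hφ).comp measurable_prodMk_left).aestronglyMeasurable
  have hGint : ∀ φ : E d → ℝ, ContDiff ℝ (⊤ : ℕ∞) φ → HasCompactSupport φ → ∀ a b : ℝ,
      Integrable (Function.uncurry fun (s : ℝ) (x : E d) => fderiv ℝ φ (X s x) (w s (X s x)))
        ((volume.restrict (Ioc a b)).prod (μ0 : Measure (E d))) := by
    intro φ hφ hc a b
    obtain ⟨C, hC⟩ := hGb φ hφ hc
    exact Integrable.of_bound (hG φ hφ).aestronglyMeasurable C (ae_of_all _ fun p => hC p.1 p.2)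
  refine ⟨?_, ?_, ?_, ?_, ?_⟩
  · refine Continuous.continuousOn (continuous_iff_continuousAt.2 fun t => ?_)
    rw [ContinuousAt, ProbabilityMeasure.tendsto_iff_forall_integral_tendsto]
    intro f
    simp only [ProbabilityMeasure.toMeasure_map]
    have : Continuous fun t => ∫ x, f (X t x) ∂(μ0 : Measure (E d)) := by
      refine continuous_of_dominated (bound := fun _ => ‖f‖)
        (fun t => (f.continuous.comp (hXt t)).aestronglyMeasurable)
        (fun t => ae_of_all _ fun x => f.norm_coe_le_norm _) (integrable_const _)
        (ae_of_all _ fun x => f.continuous.comp (hXx x))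
    have h2 := this.tendsto t
    refine Tendsto.congr (fun s => ?_) (h2.trans (le_of_eq ?_))
    · rw [integral_map (hXt s).aemeasurable f.continuous.aestronglyMeasurable]
    · rw [integral_map (hXt t).aemeasurable f.continuous.aestronglyMeasurable]
  · intro t _
    have hK := hμ0.image (hXt t)
    refine hK.of_isClosed_subset Measure.isClosed_support
      (Measure.support_subset_of_isClosed hK.isClosed ?_)
    simp only [ProbabilityMeasure.toMeasure_map]
    rw [mem_ae_map_iff (hXt t).aemeasurable hK.measurableSet]
    exact mem_of_superset Measure.support_mem_ae (subset_preimage_image _ _)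
  · apply ProbabilityMeasure.toMeasure_injective
    have : X 0 = id := funext h.init
    simp [this]
  · intro φ hφ hc
    simp only [ProbabilityMeasure.toMeasure_map, hpush φ hφ]
    rw [intervalIntegrable_iff]
    exact (hGint φ hφ hc _ _).integral_prod_left
  · intro φ hφ hc t ht
    simp only [ProbabilityMeasure.toMeasure_map, hpush φ hφ]
    rw [integral_map (hXt t).aemeasurable hφ.continuous.aestronglyMeasurable,
      intervalIntegral.integral_of_le ht.1, integral_integral_swap (hGint φ hφ hc 0 t),
      ← integral_sub]
    · refine integral_congr_ae (ae_of_all _ fun x => ?_)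
      simp only
      rw [← intervalIntegral.integral_of_le ht.1,
        intervalIntegral.integral_eq_sub_of_hasDeriv_right (f := fun s => φ (X s x)), h.init]
      · exact (hφ.continuous.comp (hXx x)).continuousOn
      · intro s hs
        rw [min_eq_left ht.1] at hs
        have h1 := ((hφ.differentiable (by simp)) (X s x)).hasFDerivAt.comp_hasDerivWithinAt s
          (h.deriv x s hs.1.le)
        exact h1.mono Ioi_subset_Ici_self
      · obtain ⟨C, hC⟩ := hGb φ hφ hc
        rw [intervalIntegrable_iff]
        exact Measure.integrableOn_of_bounded (M := C) (by simp)
          ((hG φ hφ).comp measurable_prodMk_right).aestronglyMeasurable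
          (ae_of_all _ fun s => hC s x)
    · obtain ⟨C, hC⟩ := hc.exists_bound_of_continuous hφ.continuous
      exact Integrable.of_bound (hφ.continuous.comp (hXt t)).aestronglyMeasurable C
        (ae_of_all _ fun x => hC _)
    · obtain ⟨C, hC⟩ := hc.exists_bound_of_continuous hφ.continuous
      exact Integrable.of_bound hφ.continuous.aestronglyMeasurable C
        (ae_of_all _ fun x => hC _)

/-- `R` is the time `T` map of the flow of `v + 1_ω u` for some admissible `u`. -/
def Steers (v : E d → E d) (ω : Set (E d)) (T : ℝ) (R : E d → E d) : Prop :=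
  ∃ u X, IsControlledFlow v ω u X ∧ X T = R

theorem localized_eq_self {ω : Set (E d)} {u : ℝ → E d → E d} (hu : ∀ t, ∀ x ∉ ω, u t x = 0)
    (t : ℝ) : localized ω u t = u t := by
  ext1 x
  by_cases hx : x ∈ ω
  · simp [localized, hx]
  · simp [localized, hx, hu t x hx]

theorem steers_flow {v b : E d → E d} (hv : IsVelocity v) (hb : IsVelocity b) {ω : Set (E d)}
    (hbω : ∀ x ∉ ω, b x = 0) (T : ℝ) : Steers v ω T (flow (v + b) T) := by
  have hl := localized_eq_self (u := fun _ => b) (fun _ => hbω)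
  refine ⟨fun _ => b, flow (v + b), ⟨⟨?_, ?_, ?_⟩, (hv.add hb).continuous_flow,
    (hv.add hb).flow_zero, fun x t _ => ?_⟩, rfl⟩
  · obtain ⟨⟨L, hL⟩, -⟩ := hb
    exact ⟨L, fun t => by rwa [hl]⟩
  · intro x
    simp only [hl]
    exact measurable_const
  · obtain ⟨-, M, hM⟩ := hb
    exact ⟨M, fun t x => by simpa only [hl] using hM x⟩
  · simp only [hl]
    exact ((hv.add hb).hasDerivAt_flow x t).hasDerivWithinAt

theorem Steers.comp {v : E d → E d} {ω : Set (E d)} {T₁ T₂ : ℝ} {R₁ R₂ : E d → E d}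
    (h₁ : Steers v ω T₁ R₁) (h₂ : Steers v ω T₂ R₂) (hT₁ : 0 ≤ T₁) (hT₂ : 0 < T₂) :
    Steers v ω (T₁ + T₂) (R₂ ∘ R₁) := by
  obtain ⟨u₁, X₁, h₁, rfl⟩ := h₁
  obtain ⟨u₂, X₂, h₂, rfl⟩ := h₂
  set u : ℝ → E d → E d := fun t => if t < T₁ then u₁ t else u₂ (t - T₁) with hu
  have hlt : ∀ t, t < T₁ → localized ω u t = localized ω u₁ t := fun t ht => by
    simp [localized, hu, ht]
  have hge : ∀ t, ¬ t < T₁ → localized ω u t = localized ω u₂ (t - T₁) := fun t ht => by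
    simp [localized, hu, ht]
  refine ⟨u, fun t x => if t ≤ T₁ then X₁ t x else X₂ (t - T₁) (X₁ T₁ x),
    ⟨⟨?_, ?_, ?_⟩, ?_, ?_, ?_⟩, ?_⟩
  · obtain ⟨L₁, hL₁⟩ := h₁.admissible.lipschitz
    obtain ⟨L₂, hL₂⟩ := h₂.admissible.lipschitz
    refine ⟨max L₁ L₂, fun t => ?_⟩
    by_cases ht : t < T₁
    · rw [hlt t ht]; exact (hL₁ t).weaken (le_max_left _ _)
    · rw [hge t ht]; exact (hL₂ _).weaken (le_max_right _ _)
  · intro x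
    have : (fun t => localized ω u t x) = fun t =>
        if t < T₁ then localized ω u₁ t x else localized ω u₂ (t - T₁) x := by
      ext1 t
      by_cases ht : t < T₁
      · rw [hlt t ht, if_pos ht]
      · rw [hge t ht, if_neg ht]
    rw [this]
    exact Measurable.ite measurableSet_Iio (h₁.admissible.measurable x)
      ((h₂.admissible.measurable x).comp (measurable_id.sub_const T₁))
  · obtain ⟨M₁, hM₁⟩ := h₁.admissible.bounded
    obtain ⟨M₂, hM₂⟩ := h₂.admissible.bounded
    refine ⟨max M₁ M₂, fun t x => ?_⟩
    by_cases ht : t < T₁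
    · rw [hlt t ht]; exact (hM₁ t x).trans (le_max_left _ _)
    · rw [hge t ht]; exact (hM₂ _ x).trans (le_max_right _ _)
  · refine Continuous.if_le h₁.continuous ?_ continuous_fst continuous_const ?_
    · exact h₂.continuous.comp ((continuous_fst.sub continuous_const).prodMk
        (h₁.continuous.comp (continuous_const.prodMk continuous_snd)))
    · rintro ⟨t, x⟩ ht
      simp only at ht
      simp [ht, h₂.init]
  · intro x
    simp [hT₁, h₁.init]
  · intro x t ht
    rcases lt_or_ge t T₁ with htT | htT
    · simp only [htT.le, if_true]
      rw [hlt t htT]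
      refine (h₁.deriv x t ht).congr_of_eventuallyEq ?_ (by simp [htT.le])
      filter_upwards [mem_nhdsWithin_of_mem_nhds (Iio_mem_nhds htT)] with s hs
      simp [le_of_lt (mem_Iio.1 hs)]
    · have hval : ∀ s, T₁ ≤ s → (if s ≤ T₁ then X₁ s x else X₂ (s - T₁) (X₁ T₁ x)) =
          X₂ (s - T₁) (X₁ T₁ x) := by
        intro s hs
        rcases hs.eq_or_lt with rfl | hs'
        · simp [h₂.init]
        · simp [not_le.2 hs']
      rw [hge t (not_lt.2 htT), hval t htT]
      have h2 := h₂.deriv (X₁ T₁ x) (t - T₁) (sub_nonneg.2 htT)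
      have h3 : HasDerivWithinAt (fun s : ℝ => s - T₁) 1 (Ici t) t :=
        ((hasDerivAt_id t).sub_const T₁).hasDerivWithinAt
      have h4 := h2.scomp t h3 (fun s hs => by simpa using hs)
      rw [one_smul] at h4
      exact h4.congr (fun s hs => hval s (htT.trans hs)) (hval t htT)
  · ext1 x
    simp [not_le.2 (lt_add_of_pos_right T₁ hT₂)]

/-! ### Absolute continuity under Lipschitz maps, and sweeps -/

/-- Lebesgue and `d`-dimensional Hausdorff measure are multiples of each other, and a Lipschitz map
enlarges the latter by at most a constant factor. -/
theorem volume_image_eq_zero_of_lipschitzWith {f : E d → E d} {K : NNReal} (hf : LipschitzWith K f)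
    {N : Set (E d)} (hN : volume N = 0) : volume (f '' N) = 0 := by
  have h1 : (volume : Measure (E d)) = Measure.addHaarScalarFactor volume
      (μH[Module.finrank ℝ (E d)] : Measure (E d)) • μH[Module.finrank ℝ (E d)] :=
    Measure.isAddLeftInvariant_eq_smul _ _
  have h2 : (μH[Module.finrank ℝ (E d)] : Measure (E d)) = Measure.addHaarScalarFactor
      (μH[Module.finrank ℝ (E d)] : Measure (E d)) volume • volume :=
    Measure.isAddLeftInvariant_eq_smul _ _
  have h3 : (μH[Module.finrank ℝ (E d)] : Measure (E d)) N = 0 := by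
    rw [h2]; simp [hN]
  have h4 := hf.hausdorffMeasure_image_le (d := (Module.finrank ℝ (E d) : ℝ)) (by positivity) N
  rw [h3, mul_zero] at h4
  rw [h1]
  simp only [Measure.smul_apply, nonpos_iff_eq_zero.1 h4, smul_zero]

theorem map_absolutelyContinuous {R R' : E d → E d} (hR : Measurable R) {K : NNReal}
    (hR' : LipschitzWith K R') (hinv : Function.LeftInverse R' R) {ν : Measure (E d)}
    (hν : ν ≪ volume) : ν.map R ≪ volume := by
  refine Measure.AbsolutelyContinuous.mk fun N hNm hN => ?_
  rw [Measure.map_apply hR hNm]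
  refine hν (measure_mono_null ?_ (volume_image_eq_zero_of_lipschitzWith hR' hN))
  intro x hx
  exact ⟨R x, hx, hinv x⟩

/-- Compositions of time-one flows of Lipschitz bounded fields that vanish off `U`. -/
inductive Sweep (U : Set (E d)) : (E d → E d) → Prop
  | id : Sweep U id
  | step {b R : E d → E d} (hb : IsVelocity b) (hbU : ∀ x ∉ U, b x = 0) (hR : Sweep U R) :
      Sweep U (flow b 1 ∘ R)

namespace Sweep

variable {U V : Set (E d)} {R R' : E d → E d}

theorem flow {b : E d → E d} (hb : IsVelocity b) (hbU : ∀ x ∉ U, b x = 0) (t : ℝ) :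
    Sweep U (flow b t) := by
  have h := Sweep.step (hb.const_smul t) (fun x hx => by simp [hbU x hx]) (Sweep.id (U := U))
  have h2 : CrowdControl.flow (t • b) 1 ∘ _root_.id = CrowdControl.flow b t := by
    ext1 x; simp [hb.flow_smul]
  rwa [h2] at h

theorem comp (h' : Sweep U R') (h : Sweep U R) : Sweep U (R' ∘ R) := by
  induction h' with
  | id => simpa using h
  | step hb hbU _ ih => exact Sweep.step hb hbU ih

theorem mono (hUV : U ⊆ V) (h : Sweep U R) : Sweep V R := by
  induction h with
  | id => exact Sweep.id
  | step hb hbU _ ih => exact Sweep.step hb (fun x hx => hbU x fun h => hx (hUV h)) ih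

theorem exists_inverse (h : Sweep U R) :
    ∃ R', Sweep U R' ∧ Function.LeftInverse R' R ∧ Function.RightInverse R' R := by
  induction h with
  | id => exact ⟨_root_.id, Sweep.id, fun _ => rfl, fun _ => rfl⟩
  | @step b R hb hbU _ ih =>
    obtain ⟨R', hR', hl, hr⟩ := ih
    refine ⟨R' ∘ CrowdControl.flow b (-1), hR'.comp (Sweep.flow hb hbU _), fun x => ?_, fun x => ?_⟩
    · simp only [Function.comp_apply]
      rw [hb.flow_neg_flow, hl]
    · simp only [Function.comp_apply]
      rw [hr, hb.flow_flow_neg]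

theorem lipschitz (h : Sweep U R) : ∃ K : NNReal, LipschitzWith K R := by
  induction h with
  | id => exact ⟨1, LipschitzWith.id⟩
  | step hb _ _ ih =>
    obtain ⟨K, hK⟩ := ih
    obtain ⟨K', hK'⟩ := hb.lipschitzWith_flow 1
    exact ⟨K' * K, hK'.comp hK⟩

theorem continuous (h : Sweep U R) : Continuous R := by
  obtain ⟨K, hK⟩ := h.lipschitz
  exact hK.continuous

/-- This is what lets sweeps of disjoint regions coexist, and lets released mass flow on undisturbed
outside `U`. -/
theorem eq_self (h : Sweep U R) {x : E d} (hx : x ∉ U) : R x = x := by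
  induction h with
  | id => rfl
  | step hb hbU _ ih => rw [Function.comp_apply, ih, hb.flow_eq_self (hbU x hx)]

theorem mem_iff (h : Sweep U R) {x : E d} : R x ∈ U ↔ x ∈ U := by
  constructor
  · intro hx
    by_contra hxU
    exact hxU (h.eq_self hxU ▸ hx)
  · intro hx
    by_contra hRx
    obtain ⟨R', hR', hl, -⟩ := h.exists_inverse
    have := hR'.eq_self hRx
    rw [hl] at this
    exact hRx (this ▸ hx)

theorem absolutelyContinuous (h : Sweep U R) {ν : Measure (E d)} (hν : ν ≪ volume) :
    ν.map R ≪ volume := by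
  obtain ⟨R', hR', hl, -⟩ := h.exists_inverse
  obtain ⟨K, hK⟩ := hR'.lipschitz
  exact map_absolutelyContinuous h.continuous.measurable hK hl hν

end Sweep

/-! ### Gathering mass inside a connected open set -/

/-- A field supported in `D` pointing to `z`. -/
noncomputable def pull (D : Set (E d)) (z x : E d) : E d :=
  min 1 (Metric.infDist x Dᶜ) • (z - x)

theorem pull_eq_zero {D : Set (E d)} (z : E d) {x : E d} (hx : x ∉ D) : pull D z x = 0 := by
  simp [pull, Metric.infDist_zero_of_mem (mem_compl hx)]

theorem isVelocity_pull {D : Set (E d)} (hD : Bornology.IsBounded D) {z : E d} (hz : z ∈ D) :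
    IsVelocity (pull D z) := by
  obtain ⟨C, hC⟩ := Metric.isBounded_iff.1 hD
  have hC0 : 0 ≤ C := dist_nonneg.trans (hC hz hz)
  have hχ0 : ∀ x, 0 ≤ min 1 (Metric.infDist x Dᶜ) := fun x => le_min zero_le_one Metric.infDist_nonneg
  have hχ : LipschitzWith 1 fun x => min 1 (Metric.infDist x Dᶜ) :=
    (Metric.lipschitz_infDist_pt _).const_min 1
  have hzx : ∀ x ∈ D, ‖z - x‖ ≤ C := fun x hx => by rw [← dist_eq_norm]; exact hC hz hx
  -- `z - x` is bounded only on `D`, so the variation of the cutoff is paired with the point that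
  -- lies in `D`; if both points are outside, both values vanish.
  have key : ∀ x ∈ D, ∀ y, dist (pull D z x) (pull D z y) ≤ (C + 1) * dist x y := by
    intro x hx y
    have e : pull D z x - pull D z y =
        (min 1 (Metric.infDist x Dᶜ) - min 1 (Metric.infDist y Dᶜ)) • (z - x) +
          min 1 (Metric.infDist y Dᶜ) • (y - x) := by
      simp only [pull, sub_smul, smul_sub]; abel
    rw [dist_eq_norm, e]
    refine (norm_add_le _ _).trans ?_
    rw [norm_smul, norm_smul, add_mul]
    have h1 : ‖min 1 (Metric.infDist x Dᶜ) - min 1 (Metric.infDist y Dᶜ)‖ ≤ dist x y := by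
      have := hχ.dist_le_mul x y
      simpa [dist_eq_norm] using this
    have h2 : ‖min 1 (Metric.infDist y Dᶜ)‖ ≤ 1 := by
      rw [Real.norm_of_nonneg (hχ0 y)]; exact min_le_left _ _
    have h3 : ‖y - x‖ = dist x y := by rw [dist_comm, dist_eq_norm]
    have h4 := mul_le_mul h1 (hzx x hx) (norm_nonneg _) dist_nonneg
    have h5 := mul_le_mul_of_nonneg_right h2 (norm_nonneg (y - x))
    rw [h3] at h5 ⊢
    linarith
  refine ⟨⟨NNReal.mk (C + 1) (by linarith), LipschitzWith.of_dist_le_mul fun x y => ?_⟩, C, fun x => ?_⟩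
  · by_cases hx : x ∈ D
    · exact key x hx y
    by_cases hy : y ∈ D
    · rw [dist_comm, dist_comm x]; exact key y hy x
    · rw [pull_eq_zero z hx, pull_eq_zero z hy, dist_self]
      exact mul_nonneg (NNReal.coe_nonneg _) dist_nonneg
  · by_cases hx : x ∈ D
    · rw [pull, norm_smul, Real.norm_of_nonneg (hχ0 x)]
      exact (mul_le_of_le_one_left (norm_nonneg _) (min_le_left _ _)).trans (hzx x hx)
    · rw [pull_eq_zero z hx]; simpa using hC0

/-- Trajectories of `pull D z` issued from the convex open set `D` converge to `z`. -/
theorem tendsto_flow_pull {D : Set (E d)} (hDo : IsOpen D) (hDc : Convex ℝ D)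
    (hD : Bornology.IsBounded D) (hne : Dᶜ.Nonempty) {z : E d} (hz : z ∈ D) {x : E d} (hx : x ∈ D) :
    Tendsto (fun t => flow (pull D z) t x) atTop (𝓝 z) := by
  have hb := isVelocity_pull hD hz
  set y := fun t => flow (pull D z) t x with hy
  set χ : E d → ℝ := fun x => min 1 (Metric.infDist x Dᶜ) with hχd
  have hχc : Continuous χ := continuous_const.min (Metric.continuous_infDist_pt _)
  have hχ0 : ∀ x, 0 ≤ χ x := fun x => le_min zero_le_one Metric.infDist_nonneg
  have hyc : Continuous y := hb.continuous_flow_left x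
  have hac : Continuous fun t => χ (y t) := hχc.comp hyc
  set I : ℝ → ℝ := fun t => ∫ s in (0 : ℝ)..t, χ (y s) with hI
  have hI' : ∀ t, HasDerivAt I (χ (y t)) t := fun t => hac.integral_hasStrictDerivAt 0 t |>.hasDerivAt
  -- The integral `I` of the cutoff gives an integrating factor. The trajectory therefore stays on
  -- the segment from `z` to `x`, where the cutoff has a positive minimum by compactness, so that
  -- `I` grows at least linearly.
  have hder : ∀ t, HasDerivAt (fun t => Real.exp (I t) • (y t - z)) 0 t := by
    intro t
    have h1 := (hI' t).exp.smul ((hb.hasDerivAt_flow x t).sub_const z)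
    refine h1.congr_deriv ?_
    simp only [pull, hy, hχd]
    rw [smul_smul, ← smul_add]
    simp
  have hconst : ∀ t, Real.exp (I t) • (y t - z) = x - z := by
    intro t
    have := is_const_of_deriv_eq_zero (fun t => (hder t).differentiableAt)
      (fun t => (hder t).deriv) t 0
    simp only [hI, hy, intervalIntegral.integral_same, Real.exp_zero, one_smul, hb.flow_zero] at this
    exact this
  have hyf : ∀ t, y t = z + Real.exp (-I t) • (x - z) := by
    intro t
    rw [← hconst t, smul_smul, ← Real.exp_add]; simp
  have hIn : ∀ t, 0 ≤ t → 0 ≤ I t := fun t ht =>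
    intervalIntegral.integral_nonneg ht fun s _ => hχ0 _
  have hseg : ∀ t, 0 ≤ t → y t ∈ segment ℝ z x := by
    intro t ht
    rw [segment_eq_image']
    exact ⟨Real.exp (-I t), ⟨(Real.exp_pos _).le, by simpa using hIn t ht⟩, (hyf t).symm⟩
  have hsegD : segment ℝ z x ⊆ D := hDc.segment_subset hz hx
  have hχpos : ∀ p ∈ D, 0 < χ p := fun p hp => lt_min one_pos
    ((hDo.isClosed_compl.notMem_iff_infDist_pos hne).1 (by simpa using hp))
  have hsegK : IsCompact (segment ℝ z x) := by
    rw [segment_eq_image']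
    exact isCompact_Icc.image (by fun_prop)
  obtain ⟨p, hp, hpmin⟩ := hsegK.exists_isMinOn ⟨z, left_mem_segment ℝ z x⟩ hχc.continuousOn
  have hc := hχpos p (hsegD hp)
  have hIlow : ∀ t, 0 ≤ t → χ p * t ≤ I t := by
    intro t ht
    have := intervalIntegral.integral_mono_on (μ := volume) ht (f := fun _ => χ p)
      (g := fun s => χ (y s)) (by simp) (hac.intervalIntegrable _ _)
      (fun s hs => hpmin (hseg s hs.1))
    simpa [mul_comm] using this
  have hItop : Tendsto I atTop atTop := by
    refine tendsto_atTop_mono' _ ?_ (tendsto_id.const_mul_atTop hc)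
    filter_upwards [eventually_ge_atTop 0] with t ht using hIlow t ht
  have h0 : Tendsto (fun t => Real.exp (-I t)) atTop (𝓝 0) :=
    Real.tendsto_exp_neg_atTop_nhds_zero.comp hItop
  have := (h0.smul_const (x - z)).const_add z
  rw [zero_smul, add_zero] at this
  exact this.congr fun t => (hyf t).symm

/-- Dominated convergence for indicators; the sets need not be monotone. -/
theorem tendsto_measure_zero_of_eventually_notMem {α : Type*} [MeasurableSpace α] {ν : Measure α}
    [IsFiniteMeasure ν] {s : ℕ → Set α} (hs : ∀ n, MeasurableSet (s n))
    (h : ∀ᵐ x ∂ν, ∀ᶠ n in atTop, x ∉ s n) : Tendsto (fun n => ν (s n)) atTop (𝓝 0) := by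
  have := tendsto_measure_of_ae_tendsto_indicator_of_isFiniteMeasure (μ := ν) (L := atTop)
    (A := ∅) MeasurableSet.empty hs (by simpa using h)
  simpa using this

theorem tendsto_measure_diff_flow_pull {D : Set (E d)} (hDo : IsOpen D) (hDc : Convex ℝ D)
    (hD : Bornology.IsBounded D) (hne : Dᶜ.Nonempty) {z : E d} (hz : z ∈ D) {W : Set (E d)}
    (hW : IsOpen W) (hzW : z ∈ W) (ν : Measure (E d)) [IsFiniteMeasure ν] :
    Tendsto (fun n : ℕ => ν (D \ flow (pull D z) n ⁻¹' W)) atTop (𝓝 0) := by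
  have hb := isVelocity_pull hD hz
  refine tendsto_measure_zero_of_eventually_notMem (fun n => ?_) (ae_of_all _ fun x => ?_)
  · obtain ⟨K, hK⟩ := hb.lipschitzWith_flow (n : ℝ)
    exact hDo.measurableSet.diff (hK.continuous.measurable hW.measurableSet)
  · by_cases hx : x ∈ D
    · have := (tendsto_flow_pull hDo hDc hD hne hz hx).comp tendsto_natCast_atTop_atTop
      filter_upwards [this.eventually (hW.mem_nhds hzW)] with n hn h
      exact h.2 hn
    · exact Eventually.of_forall fun n h => hx h.1

/-- Up to an arbitrarily small mass, all the mass in `V` can be swept into `B`. -/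
def Gatherable (U B V : Set (E d)) : Prop :=
  IsOpen V ∧ ∀ (ν : Measure (E d)) [IsFiniteMeasure ν] (ε : ENNReal), 0 < ε →
    ∃ R, Sweep U R ∧ ν (V \ R ⁻¹' B) ≤ ε

/-- Pull `D` towards a point of `D ∩ V` until nearly all its mass is in `V`, then gather the image
measure. That gatherability is asked for every finite measure is what permits this second
application; points of `V` outside `D` do not move in the first stage. -/
theorem Gatherable.union {U B V D : Set (E d)} (hB : IsOpen B) (h : Gatherable U B V)
    (hDo : IsOpen D)
    (hDc : Convex ℝ D) (hD : Bornology.IsBounded D) (hne : Dᶜ.Nonempty) (hDU : D ⊆ U)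
    (hDV : (D ∩ V).Nonempty) : Gatherable U B (V ∪ D) := by
  obtain ⟨z, hzD, hzV⟩ := hDV
  refine ⟨h.1.union hDo, fun ν _ ε hε => ?_⟩
  have hε2 : 0 < ε / 2 := ENNReal.half_pos hε.ne'
  obtain ⟨n, hn⟩ := ((tendsto_measure_diff_flow_pull hDo hDc hD hne hzD h.1 hzV ν).eventually
    (ge_mem_nhds hε2)).exists
  have hP : Sweep D (flow (pull D z) n) :=
    Sweep.flow (isVelocity_pull hD hzD) (fun x hx => pull_eq_zero z hx) _
  set P := flow (pull D z) n with hPdef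
  obtain ⟨R, hR, hRν⟩ := h.2 (ν.map P) (ε / 2) hε2
  refine ⟨R ∘ P, hR.comp (hP.mono hDU), ?_⟩
  have hsub : (V ∪ D) \ (R ∘ P) ⁻¹' B ⊆ (D \ P ⁻¹' V) ∪ P ⁻¹' (V \ R ⁻¹' B) := by
    rintro x ⟨hx, hxB⟩
    by_cases hPx : P x ∈ V
    · exact Or.inr ⟨hPx, hxB⟩
    · refine Or.inl ⟨?_, hPx⟩
      rcases hx with hx | hx
      · by_contra hxD
        rw [hP.eq_self hxD] at hPx
        exact hPx hx
      · exact hx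
  have hmeas : MeasurableSet (V \ R ⁻¹' B) :=
    h.1.measurableSet.diff (hR.continuous.measurable hB.measurableSet)
  rw [Measure.map_apply hP.continuous.measurable hmeas] at hRν
  calc ν ((V ∪ D) \ (R ∘ P) ⁻¹' B) ≤ _ := measure_mono hsub
    _ ≤ _ := measure_union_le _ _
    _ ≤ ε / 2 + ε / 2 := add_le_add hn hRν
    _ = ε := ENNReal.add_halves ε

/-- Connectedness: the points reachable by enlarging `V` form an open set, closed relative to `U`
because a ball around a limit point meets a reachable set and can be attached to it. -/
theorem Gatherable.exists_superset_mem {U B V : Set (E d)} (hB : IsOpen B) (hUo : IsOpen U)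
    (hUc : IsPreconnected U) (hUn : Uᶜ.Nonempty) (h : Gatherable U B V)
    (hVU : (U ∩ V).Nonempty) {q : E d} (hq : q ∈ U) :
    ∃ V', V ⊆ V' ∧ q ∈ V' ∧ Gatherable U B V' := by
  set W : Set (E d) := {q | ∃ V', V ⊆ V' ∧ q ∈ V' ∧ Gatherable U B V'} with hW
  have hWo : IsOpen W := by
    rw [isOpen_iff_mem_nhds]
    rintro x ⟨V', hVV', hx, hV'⟩
    exact mem_of_superset (hV'.1.mem_nhds hx) fun y hy => ⟨V', hVV', hy, hV'⟩
  refine hUc.subset_of_closure_inter_subset hWo ?_ ?_ hq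
  · obtain ⟨x, hxU, hxV⟩ := hVU
    exact ⟨x, hxU, V, Subset.rfl, hxV, h⟩
  · rintro x ⟨hxW, hxU⟩
    obtain ⟨r, hr, hrU⟩ := Metric.isOpen_iff.1 hUo x hxU
    obtain ⟨w, ⟨V', hVV', hwV', hV'⟩, hw⟩ := Metric.mem_closure_iff.1 hxW r hr
    rw [dist_comm] at hw
    exact ⟨V' ∪ Metric.ball x r, hVV'.trans subset_union_left,
      Or.inr (Metric.mem_ball_self hr), hV'.union hB Metric.isOpen_ball (convex_ball x r)
      Metric.isBounded_ball (hUn.mono (compl_subset_compl.2 hrU)) hrU ⟨w, hw, hwV'⟩⟩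

/-- Inner regularity reduces the mass of `U` to a compact set, which finitely many balls attached
one after another to `B` cover. -/
theorem Sweep.exists_gather {U : Set (E d)} (hUo : IsOpen U) (hUc : IsPreconnected U)
    (hUn : Uᶜ.Nonempty) {B : Set (E d)} (hB : IsOpen B) (hBU : (U ∩ B).Nonempty)
    (ν : Measure (E d)) [IsFiniteMeasure ν] {ε : ENNReal} (hε : 0 < ε) :
    ∃ R, Sweep U R ∧ ν (U \ R ⁻¹' B) ≤ ε := by
  have hcov : ∀ K, IsCompact K → K ⊆ U → ∀ V, Gatherable U B V → (U ∩ V).Nonempty →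
      ∃ V', V ⊆ V' ∧ K ⊆ V' ∧ Gatherable U B V' := by
    intro K hK hKU
    refine hK.induction_on (p := fun K => ∀ V, Gatherable U B V → (U ∩ V).Nonempty →
      ∃ V', V ⊆ V' ∧ K ⊆ V' ∧ Gatherable U B V') ?_ ?_ ?_ ?_
    · intro V hV _
      exact ⟨V, Subset.rfl, empty_subset _, hV⟩
    · intro s t hst ht V hV hne
      obtain ⟨V', h1, h2, h3⟩ := ht V hV hne
      exact ⟨V', h1, hst.trans h2, h3⟩
    · intro s t hs ht V hV hne
      obtain ⟨V', h1, h2, h3⟩ := hs V hV hne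
      obtain ⟨V'', h4, h5, h6⟩ := ht V' h3 (hne.mono (inter_subset_inter_right _ h1))
      exact ⟨V'', h1.trans h4, union_subset (h2.trans h4) h5, h6⟩
    · intro x hx
      obtain ⟨r, hr, hrU⟩ := Metric.isOpen_iff.1 hUo x (hKU hx)
      refine ⟨Metric.ball x r, mem_nhdsWithin_of_mem_nhds (Metric.ball_mem_nhds x hr), ?_⟩
      intro V hV hne
      obtain ⟨V', h1, h2, h3⟩ := hV.exists_superset_mem hB hUo hUc hUn hne (hKU hx)
      exact ⟨V' ∪ Metric.ball x r, h1.trans subset_union_left, subset_union_right,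
        h3.union hB Metric.isOpen_ball (convex_ball x r) Metric.isBounded_ball
        (hUn.mono (compl_subset_compl.2 hrU)) hrU ⟨x, Metric.mem_ball_self hr, h2⟩⟩
  have hε2 : 0 < ε / 2 := ENNReal.half_pos hε.ne'
  obtain ⟨K, hKU, hK, hνK⟩ := hUo.measurableSet.exists_isCompact_sdiff_lt (measure_ne_top ν U) hε2.ne'
  have hB0 : Gatherable U B B := ⟨hB, fun ν _ ε _ => ⟨_root_.id, Sweep.id, by simp⟩⟩
  obtain ⟨V, -, hKV, hV⟩ := hcov K hK hKU B hB0 hBU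
  obtain ⟨R, hR, hRν⟩ := hV.2 ν (ε / 2) hε2
  refine ⟨R, hR, ?_⟩
  have hsub : U \ R ⁻¹' B ⊆ (U \ K) ∪ (V \ R ⁻¹' B) := by
    rintro x ⟨hxU, hxB⟩
    by_cases hx : x ∈ K
    · exact Or.inr ⟨hKV hx, hxB⟩
    · exact Or.inl ⟨hxU, hx⟩
  calc ν (U \ R ⁻¹' B) ≤ _ := measure_mono hsub
    _ ≤ _ := measure_union_le _ _
    _ ≤ ε / 2 + ε / 2 := add_le_add hνK.le hRν
    _ = ε := ENNReal.add_halves ε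

/-! ### Sorting mass towards prescribed points -/

theorem volume_level_eq_zero {ℓ : E d →ₗ[ℝ] ℝ} (hℓ : ℓ ≠ 0) (a : ℝ) :
    volume {x | ℓ x = a} = 0 := by
  rcases eq_empty_or_nonempty {x | ℓ x = a} with h | ⟨x0, hx0⟩
  · rw [h, measure_empty]
  · have hx0' : ℓ x0 = a := hx0
    have : {x | ℓ x = a} = (fun x => x + -x0) ⁻¹' (LinearMap.ker ℓ : Set (E d)) := by
      ext x
      simp [hx0', add_neg_eq_zero]
    rw [this, measure_preimage_add_right]
    exact Measure.addHaar_submodule _ _ (by rwa [Ne, LinearMap.ker_eq_top])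

/-- Hyperplanes are null, so the mass below level `c` is continuous in `c` and the intermediate
value theorem applies. -/
theorem exists_cut {D : Set (E d)} (hD : MeasurableSet D) {ℓ : E d →ₗ[ℝ] ℝ} (hℓ : ℓ ≠ 0)
    {ν : Measure (E d)} [IsFiniteMeasure ν] (hν : ν ≪ volume) {a b m : ℝ} (hab : a ≤ b)
    (ha : ν.real (D ∩ {x | ℓ x < a}) ≤ m) (hb : m ≤ ν.real (D ∩ {x | ℓ x < b})) :
    ∃ c ∈ Icc a b, ν.real (D ∩ {x | ℓ x < c}) = m ∧
      ν.real (D ∩ {x | c < ℓ x}) = ν.real D - m := by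
  have hℓc : Continuous ℓ := ℓ.continuous_of_finiteDimensional
  have hlt : ∀ c, MeasurableSet {x | ℓ x < c} := fun c =>
    (isOpen_lt hℓc continuous_const).measurableSet
  have hcont : Continuous fun c => ν.real (D ∩ {x | ℓ x < c}) := by
    refine continuous_iff_continuousAt.2 fun c => ?_
    have := tendsto_measure_of_ae_tendsto_indicator_of_isFiniteMeasure (μ := ν) (L := 𝓝 c)
      (A := D ∩ {x | ℓ x < c}) (As := fun c => D ∩ {x | ℓ x < c})
      (hD.inter (hlt c)) (fun c => hD.inter (hlt c)) ?_
    · exact (ENNReal.tendsto_toReal (measure_ne_top _ _)).comp this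
    · have h0 : ∀ᵐ x ∂ν, ℓ x ≠ c := by
        rw [ae_iff]; simpa using hν (volume_level_eq_zero hℓ c)
      filter_upwards [h0] with x hx
      rcases lt_or_gt_of_ne hx with h | h
      · filter_upwards [lt_mem_nhds h] with c' hc'
        simp [h, hc']
      · filter_upwards [gt_mem_nhds h] with c' hc'
        simp [not_lt.2 h.le, not_lt.2 (le_of_lt hc')]
  obtain ⟨c, hc, hcm⟩ := intermediate_value_Icc hab hcont.continuousOn ⟨ha, hb⟩
  refine ⟨c, hc, hcm, ?_⟩
  have h1 := measureReal_inter_add_sdiff (μ := ν) (s := D) (hlt c)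
  simp only at hcm
  have h2 : ν.real (D \ {x | ℓ x < c}) = ν.real (D ∩ {x | c < ℓ x}) := by
    apply measureReal_congr
    have h0 : ∀ᵐ x ∂ν, ℓ x ≠ c := by
      rw [ae_iff]; simpa using hν (volume_level_eq_zero hℓ c)
    filter_upwards [h0] with x hx
    apply propext
    change (x ∈ D ∧ ¬ ℓ x < c) ↔ (x ∈ D ∧ c < ℓ x)
    rw [not_lt, hx.symm.le_iff_lt]
  linarith

/-- Induction on the number of targets, ordered by `ℓ`. Most mass is first contracted between the
levels of the two lowest targets, which forces the hyperplane cutting off the share of the lowest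
one to separate it from the others. Both sides are again open and convex: the lower one is
contracted to its target, the upper one is left to the induction. -/
theorem Sweep.exists_split {ι : Type*} (ℓ : E d →ₗ[ℝ] ℝ) (q : ι → E d) (m : ι → ℝ) {r : ℝ}
    (hr : 0 < r) (s : Finset ι) : ∀ (D : Set (E d)), IsOpen D → Convex ℝ D →
    Bornology.IsBounded D → Dᶜ.Nonempty → (∀ i ∈ s, q i ∈ D) → (∀ i ∈ s, 0 ≤ m i) →
    InjOn (fun i => ℓ (q i)) s →
    ∀ (ν : Measure (E d)) [IsFiniteMeasure ν], ν ≪ volume → ∑ i ∈ s, m i < ν.real D →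
    ∃ R, Sweep D R ∧ ∀ i ∈ s, m i ≤ ν.real (D ∩ R ⁻¹' Metric.ball (q i) r) := by
  classical
  have hℓc : Continuous ℓ := ℓ.continuous_of_finiteDimensional
  have contract : ∀ (D : Set (E d)), IsOpen D → Convex ℝ D → Bornology.IsBounded D →
      Dᶜ.Nonempty → ∀ z ∈ D, ∀ (ν : Measure (E d)) [IsFiniteMeasure ν], ∀ m' < ν.real D,
      ∀ r' > 0, ∃ R, Sweep D R ∧ m' ≤ ν.real (D ∩ R ⁻¹' Metric.ball z r') := by
    intro D hDo hDc hDb hDn z hz ν _ m' hm' r' hr'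
    have h1 := tendsto_measure_diff_flow_pull hDo hDc hDb hDn hz Metric.isOpen_ball
      (Metric.mem_ball_self hr') ν
    have h2 := (ENNReal.tendsto_toReal ENNReal.zero_ne_top).comp h1
    obtain ⟨n, hn⟩ := (h2.eventually (ge_mem_nhds (show (0 : ENNReal).toReal < ν.real D - m' by simpa using hm'))).exists
    have hP : Sweep D (CrowdControl.flow (pull D z) n) :=
      Sweep.flow (isVelocity_pull hDb hz) (fun x hx => pull_eq_zero z hx) _
    refine ⟨_, hP, ?_⟩
    have h3 := measureReal_inter_add_sdiff (μ := ν) (s := D)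
      (hP.continuous.measurable (Metric.isOpen_ball (x := z) (ε := r')).measurableSet)
    have h4 : ν.real (D \ CrowdControl.flow (pull D z) n ⁻¹' Metric.ball z r') ≤ ν.real D - m' := hn
    linarith
  induction s using Finset.strongInduction with
  | H s ih =>
  intro D hDo hDc hDb hDn hq hm hinj ν _ hν hsum
  rcases s.eq_empty_or_nonempty with rfl | hs
  · exact ⟨_, Sweep.id, by simp⟩
  obtain ⟨i0, hi0, hmin⟩ := s.exists_min_image (fun i => ℓ (q i)) hs
  set s' := s.erase i0 with hs'
  have hsum' : m i0 + ∑ i ∈ s', m i = ∑ i ∈ s, m i := Finset.add_sum_erase s m hi0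
  rcases s'.eq_empty_or_nonempty with hs'e | hs'n
  · rw [hs'e, Finset.sum_empty, add_zero] at hsum'
    obtain ⟨R, hR, hRm⟩ := contract D hDo hDc hDb hDn (q i0) (hq i0 hi0) ν (m i0)
      (by rw [hsum']; exact hsum) r hr
    refine ⟨R, hR, fun i hi => ?_⟩
    have : i = i0 := by
      by_contra h
      have : i ∈ s' := Finset.mem_erase.2 ⟨h, hi⟩
      simp [hs'e] at this
    rwa [this]
  obtain ⟨i1, hi1, hmin1⟩ := s'.exists_min_image (fun i => ℓ (q i)) hs'n
  have hi1s : i1 ∈ s := Finset.mem_of_mem_erase hi1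
  have hlt01 : ℓ (q i0) < ℓ (q i1) := by
    refine lt_of_le_of_ne (hmin i1 hi1s) fun h => ?_
    exact (Finset.ne_of_mem_erase hi1) (hinj hi1s hi0 h.symm)
  have hℓ0 : ℓ ≠ 0 := by
    rintro rfl
    simp at hlt01
  set lo := ℓ (q i0) with hlo
  set hi := ℓ (q i1) with hhi
  set z := (1 / 2 : ℝ) • q i0 + (1 / 2 : ℝ) • q i1 with hzdef
  have hzD : z ∈ D := hDc (hq i0 hi0) (hq i1 hi1s) (by norm_num) (by norm_num) (by norm_num)
  have hℓz : ℓ z = (lo + hi) / 2 := by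
    simp only [hzdef, map_add, map_smul, smul_eq_mul, hlo, hhi]; ring
  set a := lo + (hi - lo) / 4 with ha
  set b := lo + 3 * (hi - lo) / 4 with hb
  have hBo : IsOpen {x | a < ℓ x ∧ ℓ x < b} :=
    (isOpen_lt continuous_const hℓc).inter (isOpen_lt hℓc continuous_const)
  obtain ⟨r1, hr1, hr1B⟩ := Metric.isOpen_iff.1 hBo z ⟨by rw [hℓz]; linarith, by rw [hℓz]; linarith⟩
  set σ := ν.real D - ∑ i ∈ s, m i with hσ
  have hσ0 : 0 < σ := sub_pos.2 hsum
  obtain ⟨R1, hR1, hR1m⟩ := contract D hDo hDc hDb hDn z hzD ν (ν.real D - σ / 3) (by linarith)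
    r1 hr1
  set ν' := ν.map R1 with hν'
  have : IsFiniteMeasure ν' := by rw [hν']; infer_instance
  have hν'ac : ν' ≪ volume := hR1.absolutelyContinuous hν
  have hpre : ∀ S, MeasurableSet S → ν'.real S = ν.real (R1 ⁻¹' S) := fun S hS =>
    map_measureReal_apply hR1.continuous.measurable hS
  have hD1 : R1 ⁻¹' D = D := by ext x; exact hR1.mem_iff
  have hν'D : ν'.real D = ν.real D := by rw [hpre D hDo.measurableSet, hD1]
  have hlts : ∀ c, MeasurableSet {x | ℓ x < c} := fun c =>
    (isOpen_lt hℓc continuous_const).measurableSet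
  have hball : ν.real D - σ / 3 ≤ ν'.real (D ∩ Metric.ball z r1) := by
    rw [hpre _ (hDo.measurableSet.inter Metric.isOpen_ball.measurableSet), preimage_inter, hD1]
    exact hR1m
  have hlow : ν'.real (D ∩ {x | ℓ x < a}) ≤ σ / 3 := by
    have hdisj : Disjoint (D ∩ {x | ℓ x < a}) (D ∩ Metric.ball z r1) := by
      rw [Set.disjoint_left]
      rintro x ⟨_, h1⟩ ⟨_, h2⟩
      have h3 := (hr1B h2).1
      have h1' : ℓ x < a := h1
      linarith
    have h1 := measureReal_union (μ := ν') hdisj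
      (hDo.measurableSet.inter Metric.isOpen_ball.measurableSet)
    have h2 : ν'.real (D ∩ {x | ℓ x < a} ∪ D ∩ Metric.ball z r1) ≤ ν'.real D :=
      measureReal_mono (union_subset inter_subset_left inter_subset_left)
    linarith
  have hhigh : ν.real D - σ / 3 ≤ ν'.real (D ∩ {x | ℓ x < b}) :=
    hball.trans (measureReal_mono (inter_subset_inter_right _ fun x hx => (hr1B hx).2))
  have hrest : 0 ≤ ∑ i ∈ s', m i := Finset.sum_nonneg fun i hi => hm i (Finset.mem_of_mem_erase hi)
  have hm0 := hm i0 hi0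
  -- A third of the slack `σ` bounds the mass left outside the middle ball and another third is the
  -- surplus of the lower side, so both sides keep strictly more than they must deliver.
  obtain ⟨c, hc, hcm, hcM⟩ := exists_cut hDo.measurableSet hℓ0 hν'ac (m := m i0 + σ / 3)
    (by linarith : a ≤ b) (by linarith) (by linarith)
  set D1 := D ∩ {x | ℓ x < c} with hD1def
  set D2 := D ∩ {x | c < ℓ x} with hD2def
  have hD1o : IsOpen D1 := hDo.inter (isOpen_lt hℓc continuous_const)
  have hD2o : IsOpen D2 := hDo.inter (isOpen_lt continuous_const hℓc)
  have hD1c : Convex ℝ D1 := hDc.inter (convex_halfSpace_lt ℓ.isLinear c)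
  have hD2c : Convex ℝ D2 := hDc.inter (convex_halfSpace_gt ℓ.isLinear c)
  have hsub1 : D1 ⊆ D := inter_subset_left
  have hsub2 : D2 ⊆ D := inter_subset_left
  have hdisj12 : Disjoint D1 D2 := by
    rw [Set.disjoint_left]
    rintro x ⟨_, h1⟩ ⟨_, h2⟩
    exact lt_asymm (a := ℓ x) (b := c) h1 h2
  obtain ⟨R2, hR2, hR2m⟩ := contract D1 hD1o hD1c (hDb.subset hsub1)
    (hDn.mono (compl_subset_compl.2 hsub1)) (q i0)
    ⟨hq i0 hi0, by change lo < c; linarith [hc.1]⟩ ν' (m i0)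
    (by rw [hcm]; linarith) r hr
  obtain ⟨R3, hR3, hR3m⟩ := ih s' (Finset.erase_ssubset hi0) D2 hD2o hD2c (hDb.subset hsub2)
    (hDn.mono (compl_subset_compl.2 hsub2))
    (fun i hi' => ⟨hq i (Finset.mem_of_mem_erase hi'), by
      have := hmin1 i hi'
      change c < ℓ (q i)
      have h5 := hc.2
      linarith⟩)
    (fun i hi => hm i (Finset.mem_of_mem_erase hi))
    (hinj.mono (Finset.erase_subset _ _)) ν' hν'ac (by rw [hcM]; linarith)
  have hmeasb : ∀ (R : E d → E d) (y : E d), Continuous R →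
      MeasurableSet (R ⁻¹' Metric.ball y r) := fun R y hR =>
    hR.measurable Metric.isOpen_ball.measurableSet
  -- `R2` and `R3` act on disjoint half-domains, so neither disturbs the share placed by the other.
  refine ⟨R3 ∘ R2 ∘ R1, (hR3.mono hsub2).comp ((hR2.mono hsub1).comp hR1), fun i hi => ?_⟩
  by_cases hii : i = i0
  · rw [hii]
    refine hR2m.trans ?_
    rw [hpre _ (hD1o.measurableSet.inter (hmeasb R2 _ hR2.continuous))]
    refine measureReal_mono ?_
    rintro x ⟨hx1, hx2⟩
    refine ⟨hR1.mem_iff.1 (hsub1 hx1), ?_⟩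
    have h1 : R2 (R1 x) ∉ D2 := Set.disjoint_left.1 hdisj12 (hR2.mem_iff.2 hx1)
    simpa [hR3.eq_self h1] using hx2
  · have hi' : i ∈ s' := Finset.mem_erase.2 ⟨hii, hi⟩
    refine (hR3m i hi').trans ?_
    rw [hpre _ (hD2o.measurableSet.inter (hmeasb R3 _ hR3.continuous))]
    refine measureReal_mono ?_
    rintro x ⟨hx1, hx2⟩
    refine ⟨hR1.mem_iff.1 (hsub2 hx1), ?_⟩
    have h1 : R1 x ∉ D1 := Set.disjoint_right.1 hdisj12 hx1
    simpa [hR2.eq_self h1] using hx2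

theorem exists_linear_injOn {ι : Type*} (s : Finset ι) (q : ι → E d) (hq : InjOn q s) :
    ∃ ℓ : E d →ₗ[ℝ] ℝ, InjOn (fun i => ℓ (q i)) s := by
  classical
  obtain ⟨ℓ, hℓ⟩ := Module.exists_dual_forall_apply_ne_zero (K := ℝ) (M := E d)
    (ι := {p : s × s // p.1 ≠ p.2})
    (fun p => q p.1.1 - q p.1.2) (fun p h => p.2 (Subtype.ext (hq p.1.1.2 p.1.2.2 (sub_eq_zero.1 h))))
  refine ⟨ℓ, fun i hi j hj hij => ?_⟩
  by_contra hne
  refine hℓ ⟨(⟨i, hi⟩, ⟨j, hj⟩), fun h => hne (congrArg Subtype.val h)⟩ ?_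
  simpa [sub_eq_zero] using hij

/-- An absolutely continuous measure in a connected open set can be swept so as to bring
prescribed masses near prescribed distinct points. -/
theorem Sweep.exists_sort {ι : Type*} {U : Set (E d)} (hUo : IsOpen U) (hUc : IsPreconnected U)
    (hUn : Uᶜ.Nonempty) {ν : Measure (E d)} [IsFiniteMeasure ν] (hν : ν ≪ volume) (s : Finset ι)
    {q : ι → E d} (hqU : ∀ i ∈ s, q i ∈ U) (hq : InjOn q s) {m : ι → ℝ} (hm : ∀ i ∈ s, 0 ≤ m i)
    (hsum : ∑ i ∈ s, m i < ν.real U) {r : ℝ} (hr : 0 < r) :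
    ∃ R, Sweep U R ∧ ∀ i ∈ s, m i ≤ ν.real (U ∩ R ⁻¹' Metric.ball (q i) r) := by
  classical
  rcases s.eq_empty_or_nonempty with rfl | ⟨i0, hi0⟩
  · exact ⟨_, Sweep.id, by simp⟩
  obtain ⟨ρ, hρ, hρU⟩ := Metric.isOpen_iff.1 hUo (q i0) (hqU i0 hi0)
  set B := Metric.ball (q i0) ρ with hB
  set σ := ν.real U - ∑ i ∈ s, m i with hσ
  have hσ0 : 0 < σ := sub_pos.2 hsum
  -- A Dirac mass at each target makes the gathering move the targets as well: an error of at most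
  -- `1/2` cannot leave a unit atom outside `B`. All targets then lie in one convex set, where
  -- splitting applies.
  set ν1 : Measure (E d) := ν + Measure.sum (fun i : s => Measure.dirac (q i)) with hν1
  have hfin : IsFiniteMeasure ν1 := by rw [hν1]; infer_instance
  obtain ⟨R1, hR1, hR1m⟩ := Sweep.exists_gather hUo hUc hUn (B := B) Metric.isOpen_ball
    ⟨q i0, hqU i0 hi0, Metric.mem_ball_self hρ⟩ ν1 (ε := ENNReal.ofReal (min (σ / 2) (1 / 2)))
    (by rw [ENNReal.ofReal_pos]; positivity)
  have hmeasB : MeasurableSet (U \ R1 ⁻¹' B) :=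
    hUo.measurableSet.diff (hR1.continuous.measurable Metric.isOpen_ball.measurableSet)
  have hνle : ν.real (U \ R1 ⁻¹' B) ≤ σ / 2 := by
    have h1 : ν (U \ R1 ⁻¹' B) ≤ ν1 (U \ R1 ⁻¹' B) := by
      rw [hν1, Measure.add_apply]; exact le_self_add
    have h2 := ENNReal.toReal_mono ENNReal.ofReal_ne_top (h1.trans hR1m)
    rw [ENNReal.toReal_ofReal (by positivity)] at h2
    exact h2.trans (min_le_left _ _)
  have hqB : ∀ i ∈ s, R1 (q i) ∈ B := by
    intro i hi
    by_contra hcon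
    have h1 : Measure.dirac (q i) (U \ R1 ⁻¹' B) ≤ ν1 (U \ R1 ⁻¹' B) := by
      rw [hν1, Measure.add_apply, Measure.sum_apply _ hmeasB]
      exact (ENNReal.le_tsum (f := fun j : s => Measure.dirac (q j) (U \ R1 ⁻¹' B)) ⟨i, hi⟩).trans
        le_add_self
    have hmem : q i ∈ U \ R1 ⁻¹' B := ⟨hqU i hi, hcon⟩
    rw [Measure.dirac_apply' _ hmeasB, indicator_of_mem hmem, Pi.one_apply] at h1
    have h2 := ENNReal.toReal_mono ENNReal.ofReal_ne_top (h1.trans hR1m)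
    rw [ENNReal.toReal_ofReal (by positivity), ENNReal.toReal_one] at h2
    have := h2.trans (min_le_right _ _)
    norm_num at this
  obtain ⟨R1', hR1', hl, hrr⟩ := hR1.exists_inverse
  obtain ⟨K, hK⟩ := hR1'.lipschitz
  have hinj : InjOn (fun i => R1 (q i)) s := fun i hi j hj h => hq hi hj (hl.injective h)
  obtain ⟨ℓ, hℓ⟩ := exists_linear_injOn s (fun i => R1 (q i)) hinj
  have hfin' : IsFiniteMeasure (ν.map R1) := inferInstance
  have hpre : ∀ S, MeasurableSet S → (ν.map R1).real S = ν.real (R1 ⁻¹' S) := fun S hS =>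
    map_measureReal_apply hR1.continuous.measurable hS
  -- The split is made around the moved targets; undoing `R1` multiplies distances by at most `K`.
  -- The `+ 1` guards against `K = 0`.
  have hr' : 0 < r / (K + 1) := by positivity
  obtain ⟨R2, hR2, hR2m⟩ := Sweep.exists_split ℓ (fun i => R1 (q i)) m hr' s B Metric.isOpen_ball
    (convex_ball _ _) Metric.isBounded_ball (hUn.mono (compl_subset_compl.2 hρU)) hqB hm hℓ
    (ν.map R1) (hR1.absolutelyContinuous hν) (by
      rw [hpre B Metric.isOpen_ball.measurableSet]
      have h1 := measureReal_inter_add_sdiff (μ := ν) (s := U)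
        (hR1.continuous.measurable (Metric.isOpen_ball (x := q i0) (ε := ρ)).measurableSet)
      have h2 : ν.real (U ∩ R1 ⁻¹' B) ≤ ν.real (R1 ⁻¹' B) := measureReal_mono inter_subset_right
      simp only [← hB] at h1
      linarith)
  refine ⟨R1' ∘ R2 ∘ R1, hR1'.comp ((hR2.mono hρU).comp hR1), fun i hi => (hR2m i hi).trans ?_⟩
  rw [hpre _ (Metric.isOpen_ball.measurableSet.inter
    (hR2.continuous.measurable Metric.isOpen_ball.measurableSet))]
  refine measureReal_mono ?_
  rintro x ⟨hx1, hx2⟩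
  refine ⟨hR1.mem_iff.1 (hρU hx1), ?_⟩
  have h1 := hK.dist_le_mul (R2 (R1 x)) (R1 (q i))
  rw [hl] at h1
  have hx2' : dist (R2 (R1 x)) (R1 (q i)) < r / (K + 1) := hx2
  rw [lt_div_iff₀ (by positivity)] at hx2'
  change dist (R1' (R2 (R1 x))) (q i) < r
  have h3 : (0 : ℝ) ≤ dist (R2 (R1 x)) (R1 (q i)) := dist_nonneg
  rcases h3.eq_or_lt with h4 | h4
  · rw [← h4, mul_zero] at h1; linarith
  · nlinarith
-- Impulsive controls
/-- `R` is a uniform limit of maps attainable with controls in times arbitrarily close to `t`. -/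
def ApproxSteers (v : E d → E d) (ω : Set (E d)) (t : ℝ) (R : E d → E d) : Prop :=
  ∀ ε > 0, ∃ η > 0, ∀ s > 0, |s - t| < η → ∃ R', Steers v ω s R' ∧ ∀ x, dist (R' x) (R x) ≤ ε

theorem isVelocity_zero : IsVelocity (0 : E d → E d) :=
  ⟨⟨0, LipschitzWith.const _⟩, 0, fun _ => by simp⟩

theorem approxSteers_flow {v : E d → E d} (hv : IsVelocity v) (ω : Set (E d)) (h : ℝ) :
    ApproxSteers v ω h (flow v h) := by
  intro ε hε
  obtain ⟨-, M, hM⟩ := id hv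
  have hM0 : 0 ≤ M := (norm_nonneg _).trans (hM 0)
  refine ⟨ε / (M + 1), by positivity, fun s _ hs => ⟨flow v s, ?_, fun x => ?_⟩⟩
  · simpa using steers_flow hv isVelocity_zero (ω := ω) (fun _ _ => rfl) s
  · refine (hv.dist_flow_time_le hM x s h).trans ?_
    rw [lt_div_iff₀ (by positivity)] at hs
    nlinarith [abs_nonneg (s - h)]

/-- Running `v + s⁻¹ b` for a time `s` is running `s v + b` for a unit time; as `s → 0` this tends
to the flow of `b` uniformly, by Gronwall. -/
theorem approxSteers_impulse {v b : E d → E d} (hv : IsVelocity v) (hb : IsVelocity b)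
    {ω : Set (E d)} (hbω : ∀ x ∉ ω, b x = 0) : ApproxSteers v ω 0 (flow b 1) := by
  intro ε hε
  obtain ⟨-, M, hM⟩ := id hv
  have hM0 : 0 ≤ M := (norm_nonneg _).trans (hM 0)
  obtain ⟨⟨L, hL⟩, -⟩ := id hb
  have hcont : Tendsto (fun s : ℝ => gronwallBound 0 L (s * M) 1) (𝓝 0) (𝓝 0) := by
    have h1 := (gronwallBound_continuous_ε 0 L 1).comp (continuous_mul_const M)
    have h2 := h1.tendsto 0
    simpa [Function.comp_def, gronwallBound_ε0_δ0] using h2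
  obtain ⟨η, hη, hηε⟩ := Metric.eventually_nhds_iff.1 (hcont.eventually (ge_mem_nhds hε))
  refine ⟨η, hη, fun s hs hsη => ⟨flow (v + s⁻¹ • b) s,
    steers_flow hv (hb.const_smul _) (fun x hx => by simp [hbω x hx]) s, fun x => ?_⟩⟩
  have e : flow (v + s⁻¹ • b) s x = flow (s • v + b) 1 x := by
    have := (hv.add (hb.const_smul s⁻¹)).flow_smul s 1 x
    rw [mul_one] at this
    rw [← this, smul_add, smul_smul, mul_inv_cancel₀ hs.ne', one_smul]
  rw [e]
  refine (hb.dist_flow_flow_le ((hv.const_smul s).add hb) hL (ε := s * M) (fun y => ?_)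
    zero_le_one x).trans (hηε (by simpa using hsη))
  simp only [Pi.add_apply, Pi.smul_apply, dist_add_self_left, norm_smul, Real.norm_of_nonneg hs.le]
  exact mul_le_mul_of_nonneg_left (hM y) hs.le

theorem ApproxSteers.comp {v : E d → E d} {ω : Set (E d)} {t₁ t₂ : ℝ} {R₁ R₂ : E d → E d}
    (h₁ : ApproxSteers v ω t₁ R₁) (h₂ : ApproxSteers v ω t₂ R₂) (ht₁ : 0 ≤ t₁) (ht₂ : 0 ≤ t₂)
    {K : NNReal} (hK : LipschitzWith K R₂) : ApproxSteers v ω (t₁ + t₂) (R₂ ∘ R₁) := by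
  intro ε hε
  obtain ⟨η₁, hη₁, h₁⟩ := h₁ (ε / (2 * (K + 1))) (by positivity)
  obtain ⟨η₂, hη₂, h₂⟩ := h₂ (ε / 2) (by positivity)
  set η := min η₁ η₂ / 2 with hη
  have hη0 : 0 < η := by positivity
  have hη1 : 2 * η ≤ η₁ := by rw [hη]; linarith [min_le_left η₁ η₂]
  have hη2 : 2 * η ≤ η₂ := by rw [hη]; linarith [min_le_right η₁ η₂]
  refine ⟨η, hη0, fun s hs hsη => ?_⟩
  have hden : 0 < t₁ + t₂ + 2 * η := by positivity
  have hclose : ∀ a b : ℝ, 0 ≤ a → 0 ≤ b → a + b = t₁ + t₂ →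
      |s * (a + η) / (t₁ + t₂ + 2 * η) - a| < 2 * η := by
    intro a b ha hb hab
    have hs' := abs_lt.1 hsη
    rw [← hab] at hden hs' ⊢
    have e : s * (a + η) / (a + b + 2 * η) - a =
        ((b - a) * η + (s - (a + b)) * (a + η)) / (a + b + 2 * η) := by
      field_simp; ring
    rw [e, abs_div, abs_of_pos hden, div_lt_iff₀ hden, abs_lt]
    constructor <;> nlinarith [mul_nonneg ha hη0.le, mul_nonneg hb hη0.le, mul_pos hη0 hη0]
  -- Splitting `s` in the ratio `t₁ + η : t₂ + η` keeps both durations positive even when `t₁` or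
  -- `t₂` is zero, as it is for impulses.
  set s₁ := s * (t₁ + η) / (t₁ + t₂ + 2 * η) with hs₁
  set s₂ := s * (t₂ + η) / (t₁ + t₂ + 2 * η) with hs₂
  have hs₁0 : 0 < s₁ := by positivity
  have hs₂0 : 0 < s₂ := by positivity
  have hsum : s = s₁ + s₂ := by rw [hs₁, hs₂]; field_simp; ring
  obtain ⟨R₁', hR₁', hd₁⟩ := h₁ s₁ hs₁0 ((hclose t₁ t₂ ht₁ ht₂ rfl).trans_le hη1)
  obtain ⟨R₂', hR₂', hd₂⟩ := h₂ s₂ hs₂0 ((hclose t₂ t₁ ht₂ ht₁ (add_comm _ _)).trans_le hη2)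
  refine ⟨R₂' ∘ R₁', hsum ▸ hR₁'.comp hR₂' hs₁0.le hs₂0, fun x => ?_⟩
  have h3 : dist (R₂ (R₁' x)) (R₂ (R₁ x)) ≤ ε / 2 := by
    refine (hK.dist_le_mul _ _).trans ?_
    have h4 := hd₁ x
    rw [le_div_iff₀ (by positivity)] at h4
    nlinarith [dist_nonneg (x := R₁' x) (y := R₁ x)]
  calc dist (R₂' (R₁' x)) (R₂ (R₁ x)) ≤ _ := dist_triangle _ (R₂ (R₁' x)) _
    _ ≤ ε / 2 + ε / 2 := add_le_add (hd₂ _) h3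
    _ = ε := add_halves ε

theorem Sweep.approxSteers {v : E d → E d} (hv : IsVelocity v) {ω U : Set (E d)} (hU : U ⊆ ω)
    {R : E d → E d} (hR : Sweep U R) : ApproxSteers v ω 0 R := by
  induction hR with
  | id =>
    have h := approxSteers_flow hv ω 0
    have : CrowdControl.flow v 0 = _root_.id := funext hv.flow_zero
    rwa [this] at h
  | step hb hbU _ ih =>
    obtain ⟨K, hK⟩ := hb.lipschitzWith_flow 1
    simpa using ih.comp (approxSteers_impulse hv hb fun x hx => hbU x fun h => hx (hU h))
      le_rfl le_rfl hK

/-! ### Realising a transport plan on a time grid -/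

theorem sum_filter_lt_succ {ι : Type*} (I : Finset ι) (lev : ι → ℕ) (f : ι → ℝ) (m : ℕ) :
    ∑ i ∈ I with lev i < m + 1, f i = ∑ i ∈ I with lev i < m, f i + ∑ i ∈ I with lev i = m, f i := by
  classical
  rw [← Finset.sum_union]
  · congr 1
    ext i
    simp only [Finset.mem_union, Finset.mem_filter]
    constructor
    · rintro ⟨h1, h2⟩
      rcases (Nat.lt_succ_iff.1 h2).eq_or_lt with h3 | h3
      · exact Or.inr ⟨h1, h3⟩
      · exact Or.inl ⟨h1, h3⟩
    · rintro (⟨h1, h2⟩ | ⟨h1, h2⟩)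
      · exact ⟨h1, by omega⟩
      · exact ⟨h1, by omega⟩
  · rw [Finset.disjoint_left]
    intro i h1 h2
    rw [Finset.mem_filter] at h1 h2
    omega

/-- The points that the flow of `v` brings to `U` at one of the first `k` instants of the grid of
step `h`. -/
def captured (v : E d → E d) (U : Set (E d)) (h : ℝ) (k : ℕ) : Set (E d) :=
  {x | ∃ i < k, flow v (i * h) x ∈ U}

theorem captured_mono {v : E d → E d} {U : Set (E d)} {h : ℝ} : Monotone (captured v U h) :=
  fun _ _ hij _ ⟨i, hi, hx⟩ => ⟨i, hi.trans_le hij, hx⟩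

theorem measurableSet_captured {v : E d → E d} (hv : IsVelocity v) {U : Set (E d)}
    (hU : MeasurableSet U) (h : ℝ) (k : ℕ) : MeasurableSet (captured v U h k) := by
  have : captured v U h k = ⋃ i ∈ Finset.range k, flow v (i * h) ⁻¹' U := by
    ext x; simp [captured]
  rw [this]
  refine Finset.measurableSet_biUnion _ fun i _ => ?_
  obtain ⟨K, hK⟩ := hv.lipschitzWith_flow (i * h)
  exact hK.continuous.measurable hU

/-- Data of a transport plan: grid step, control core `U`, pieces `i ∈ I` of mass `β i` to be
released from `z i` at the instant `lev i` of the grid, and a parking ball. -/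
structure Plan (d : ℕ) (ι : Type*) where
  v : E d → E d
  ω : Set (E d)
  U : Set (E d)
  h : ℝ
  n : ℕ
  μ : Measure (E d)
  I : Finset ι
  lev : ι → ℕ
  z : ι → E d
  β : ι → ℝ
  ρ : ℝ
  p : E d
  ρ' : ℝ

/-- The conditions under which a plan can be realised. -/
structure Plan.Feasible {ι : Type*} (D : Plan d ι) : Prop where
  velocity : IsVelocity D.v
  prob : IsProbabilityMeasure D.μ
  ac : D.μ ≪ volume
  subset : D.U ⊆ D.ω
  isOpen : IsOpen D.U
  preconnected : IsPreconnected D.U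
  compl_nonempty : D.Uᶜ.Nonempty
  h_pos : 0 < D.h
  ρ_pos : 0 < D.ρ
  ρ'_pos : 0 < D.ρ'
  lev_le : ∀ i ∈ D.I, D.lev i ≤ D.n
  z_mem : ∀ i ∈ D.I, D.z i ∈ D.U
  z_inj : ∀ i ∈ D.I, ∀ j ∈ D.I, D.lev i = D.lev j → D.z i = D.z j → i = j
  β_nonneg : ∀ i ∈ D.I, 0 ≤ D.β i
  avoid : ∀ i ∈ D.I, ∀ k : ℕ, 1 ≤ k → D.lev i + k ≤ D.n → ∀ y ∈ Metric.ball (D.z i) D.ρ,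
    flow D.v (k * D.h) y ∉ D.U
  park : Metric.ball D.p D.ρ' ⊆ D.U
  drift : ∀ y ∈ Metric.ball D.p D.ρ', flow D.v D.h y ∈ D.U
  enough : ∀ k ≤ D.n + 1, ∑ i ∈ D.I with D.lev i < k, D.β i ≤
    D.μ.real (captured D.v D.U D.h k)

/-- After `k` impulses, at the instant `j` of the grid: the map `Ψ` transports the released sets
`A i` along the flow, and the waiting mass `P` lies in `W`. -/
structure Plan.State {ι : Type*} (D : Plan d ι) (θ : ℝ) (j k : ℕ) (W : Set (E d))
    (Ψ : E d → E d) (A : ι → Set (E d)) (P : Set (E d)) : Prop where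
  steers : ApproxSteers D.v D.ω (j * D.h) Ψ
  lipschitz : ∃ K : NNReal, LipschitzWith K Ψ
  inverse : ∃ (Ψ' : E d → E d) (K : NNReal), LipschitzWith K Ψ' ∧ Function.LeftInverse Ψ' Ψ
  free : ∀ x ∉ captured D.v D.U D.h k, Ψ x = flow D.v (j * D.h) x
  measurable_A : ∀ i ∈ D.I, D.lev i < k → MeasurableSet (A i)
  subset_A : ∀ i ∈ D.I, D.lev i < k → A i ⊆ captured D.v D.U D.h k
  disjoint_A : ∀ i ∈ D.I, ∀ i' ∈ D.I, D.lev i < k → D.lev i' < k → i ≠ i' → Disjoint (A i) (A i')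
  maps_A : ∀ i ∈ D.I, D.lev i < k → ∀ x ∈ A i, ∃ y ∈ Metric.ball (D.z i) D.ρ,
    Ψ x = flow D.v (((j : ℝ) - D.lev i) * D.h) y
  mass_A : ∀ i ∈ D.I, D.lev i < k → θ ^ k * D.β i ≤ D.μ.real (A i)
  measurable_P : MeasurableSet P
  subset_P : P ⊆ captured D.v D.U D.h k
  disjoint_P : ∀ i ∈ D.I, D.lev i < k → Disjoint (A i) P
  maps_P : ∀ x ∈ P, Ψ x ∈ W
  mass_P : θ ^ k * (D.μ.real (captured D.v D.U D.h k) - ∑ i ∈ D.I with D.lev i < k, D.β i) ≤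
    D.μ.real P

theorem Plan.Feasible.state_zero {ι : Type*} {D : Plan d ι} (hD : D.Feasible) (θ : ℝ) :
    D.State θ 0 0 D.U id (fun _ => ∅) ∅ where
  steers := by simpa using (Sweep.id (U := D.U)).approxSteers hD.velocity hD.subset
  lipschitz := ⟨1, LipschitzWith.id⟩
  inverse := ⟨id, 1, LipschitzWith.id, fun _ => rfl⟩
  free := by simp [hD.velocity]
  measurable_A := by simp
  subset_A := by simp
  disjoint_A := by simp
  maps_A := by simp
  mass_A := by simp
  measurable_P := MeasurableSet.empty
  subset_P := empty_subset _
  disjoint_P := by simp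
  maps_P := by simp
  mass_P := by simp [captured]

/-- Released pieces only advance along the flow. The waiting mass starts in the parking ball, whose
role is that one step of drift ends in `U`, ready for the next impulse. -/
theorem Plan.Feasible.state_drift {ι : Type*} {D : Plan d ι} (hD : D.Feasible) {θ : ℝ} {j k : ℕ}
    {Ψ : E d → E d} {A : ι → Set (E d)} {P : Set (E d)}
    (h : D.State θ j k (Metric.ball D.p D.ρ') Ψ A P) :
    D.State θ (j + 1) k D.U (flow D.v D.h ∘ Ψ) A P := by
  have hv := hD.velocity
  have hj : ((j + 1 : ℕ) : ℝ) * D.h = j * D.h + D.h := by push_cast; ring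
  refine { h with steers := ?_, lipschitz := ?_, inverse := ?_, free := ?_, maps_A := ?_, maps_P := ?_ }
  · rw [hj]
    obtain ⟨K, hK⟩ := hv.lipschitzWith_flow D.h
    exact h.steers.comp (approxSteers_flow hv _ _) (mul_nonneg (Nat.cast_nonneg _) hD.h_pos.le)
      hD.h_pos.le hK
  · obtain ⟨K, hK⟩ := hv.lipschitzWith_flow D.h
    obtain ⟨K', hK'⟩ := h.lipschitz
    exact ⟨_, hK.comp hK'⟩
  · obtain ⟨K, hK⟩ := hv.lipschitzWith_flow (-D.h)
    obtain ⟨Ψ', K', hK', hl⟩ := h.inverse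
    refine ⟨_, _, hK'.comp hK, fun x => ?_⟩
    simp only [Function.comp_apply]
    rw [hv.flow_neg_flow, hl]
  · intro x hx
    rw [Function.comp_apply, h.free x hx, ← hv.flow_add, hj, add_comm]
  · intro i hi hik x hx
    obtain ⟨y, hy, hxy⟩ := h.maps_A i hi hik x hx
    refine ⟨y, hy, ?_⟩
    rw [Function.comp_apply, hxy, ← hv.flow_add]
    congr 1
    push_cast; ring
  · intro x hx
    exact hD.drift _ (h.maps_P x hx)

theorem exists_radius_disjoint_balls {ι : Type*} (s : Finset ι) (q : ι → E d) (hq : InjOn q s)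
    {r₀ : ℝ} (hr₀ : 0 < r₀) : ∃ r > 0, r ≤ r₀ ∧ ∀ i ∈ s, ∀ j ∈ s, i ≠ j →
      Disjoint (Metric.ball (q i) r) (Metric.ball (q j) r) := by
  classical
  have h1 : ∀ᶠ r in 𝓝[>] (0 : ℝ), ∀ p ∈ s.offDiag, r + r ≤ dist (q p.1) (q p.2) := by
    rw [Filter.eventually_all_finset]
    intro p hp
    rw [Finset.mem_offDiag] at hp
    have hpos : 0 < dist (q p.1) (q p.2) := dist_pos.2 fun h => hp.2.2 (hq hp.1 hp.2.1 h)
    filter_upwards [mem_nhdsWithin_of_mem_nhds (gt_mem_nhds (half_pos hpos))] with r hr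
    linarith
  obtain ⟨r, ⟨hr, hr1⟩, hr2⟩ := ((h1.and (mem_nhdsWithin_of_mem_nhds (gt_mem_nhds hr₀))).and
    self_mem_nhdsWithin).exists
  exact ⟨r, hr2, le_of_lt hr1, fun i hi j hj hij =>
    Metric.ball_disjoint_ball (hr (i, j) (Finset.mem_offDiag.2 ⟨hi, hj, hij⟩))⟩

/-- The waiting mass and the mass first captured at instant `j` all lie in `U` and form an
absolutely continuous measure. Sorting sends shares of it to the release points of level `j` and the
remainder to the parking point; pieces released earlier are outside `U` and do not feel the impulse.
Each sort costs a factor `θ`. -/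
theorem Plan.Feasible.state_impulse {ι : Type*} {D : Plan d ι} (hd : 0 < d) (hD : D.Feasible)
    {θ : ℝ} (hθ0 : 0 < θ) (hθ1 : θ < 1) {j : ℕ} (hj : j ≤ D.n)
    {Ψ : E d → E d} {A : ι → Set (E d)} {P : Set (E d)} (h : D.State θ j j D.U Ψ A P) :
    ∃ Ψ' A' P', D.State θ j (j + 1) (Metric.ball D.p D.ρ') Ψ' A' P' := by
  classical
  have hv := hD.velocity
  have hprob := hD.prob
  obtain ⟨K, hK⟩ := h.lipschitz
  have hΨm : Measurable Ψ := hK.continuous.measurable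
  set Q := P ∪ (captured D.v D.U D.h (j + 1) \ captured D.v D.U D.h j) with hQ
  have hcm := fun k => measurableSet_captured hv hD.isOpen.measurableSet D.h k
  have hQm : MeasurableSet Q := h.measurable_P.union ((hcm _).diff (hcm _))
  have hQU : ∀ x ∈ Q, Ψ x ∈ D.U := by
    rintro x (hx | ⟨hx, hx'⟩)
    · exact h.maps_P x hx
    · rw [h.free x hx']
      obtain ⟨i, hi, hiU⟩ := hx
      rcases (Nat.lt_succ_iff.1 hi).eq_or_lt with rfl | hlt
      · exact hiU
      · exact absurd ⟨i, hlt, hiU⟩ hx'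
  have hQc : Q ⊆ captured D.v D.U D.h (j + 1) :=
    union_subset (h.subset_P.trans (captured_mono j.le_succ)) sdiff_subset
  set Rel := fun k : ℕ => ∑ i ∈ D.I with D.lev i < k, D.β i with hRel
  set C := fun k : ℕ => D.μ.real (captured D.v D.U D.h k) with hC
  have hRelC : Rel (j + 1) ≤ C (j + 1) := hD.enough (j + 1) (by omega)
  set J := D.I.filter fun i => D.lev i = j with hJ
  have hRels : Rel (j + 1) = Rel j + ∑ i ∈ J, D.β i := sum_filter_lt_succ D.I D.lev D.β j
  have hβJ : ∀ i ∈ J, 0 ≤ D.β i := fun i hi => hD.β_nonneg i (Finset.mem_filter.1 hi).1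
  have hθj : 0 < θ ^ j := pow_pos hθ0 j
  have hθj1 : θ ^ j ≤ 1 := pow_le_one₀ hθ0.le hθ1.le
  have hCmono : C j ≤ C (j + 1) := measureReal_mono (captured_mono j.le_succ)
  have hQmass : θ ^ j * (C (j + 1) - Rel j) ≤ D.μ.real Q := by
    have hdisj : Disjoint P (captured D.v D.U D.h (j + 1) \ captured D.v D.U D.h j) :=
      disjoint_sdiff_right.mono_left h.subset_P
    rw [hQ, measureReal_union hdisj ((hcm _).diff (hcm _)),
      measureReal_sdiff (captured_mono j.le_succ) (hcm _)]
    have h1 := h.mass_P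
    change θ ^ j * (C j - Rel j) ≤ _ at h1
    change _ ≤ _ + (C (j + 1) - C j)
    nlinarith
  set ν := (D.μ.restrict Q).map Ψ with hν
  have hνac : ν ≪ volume := by
    obtain ⟨Ψ', K', hK', hl⟩ := h.inverse
    exact map_absolutelyContinuous hΨm hK' hl (Measure.absolutelyContinuous_of_le
      Measure.restrict_le_self |>.trans hD.ac)
  have hνS : ∀ S, MeasurableSet S → ν.real S = D.μ.real (Q ∩ Ψ ⁻¹' S) := fun S hS => by
    rw [hν, map_measureReal_apply hΨm hS, measureReal_restrict_apply (hΨm hS), inter_comm]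
  have hνU : ν.real D.U = D.μ.real Q := by
    rw [hνS _ hD.isOpen.measurableSet, (inter_eq_left.2 fun x hx => hQU x hx : Q ∩ Ψ ⁻¹' D.U = Q)]
  -- the parking point
  have hnt : Nontrivial (E d) := by
    have : Nonempty (Fin d) := ⟨⟨0, hd⟩⟩
    infer_instance
  -- Sorting needs distinct targets; since `d > 0` the half ball is infinite and has a point off the
  -- finitely many release points.
  obtain ⟨p, hp, hpJ⟩ : ∃ p ∈ Metric.ball D.p (D.ρ' / 2), p ∉ J.image D.z := by
    have hinf : (Metric.ball D.p (D.ρ' / 2)).Infinite :=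
      infinite_of_mem_nhds D.p (Metric.ball_mem_nhds _ (half_pos hD.ρ'_pos))
    exact hinf.exists_notMem_finset _
  set q : Option ι → E d := fun o => o.elim p D.z with hq
  set m : Option ι → ℝ := fun o => o.elim (θ ^ (j + 1) * (C (j + 1) - Rel (j + 1)))
    fun i => θ ^ (j + 1) * D.β i with hm
  set s := Finset.insertNone J with hs
  have hqinj : InjOn q s := by
    rintro (_ | a) ha (_ | b) hb hab
    · rfl
    · exact absurd (Finset.mem_image.2 ⟨b, by simpa [hs] using hb, hab.symm⟩) hpJ
    · exact absurd (Finset.mem_image.2 ⟨a, by simpa [hs] using ha, hab⟩) hpJ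
    · have ha' := Finset.mem_filter.1 (Finset.some_mem_insertNone.1 ha)
      have hb' := Finset.mem_filter.1 (Finset.some_mem_insertNone.1 hb)
      rw [hD.z_inj a ha'.1 b hb'.1 (ha'.2.trans hb'.2.symm) hab]
  have hqU : ∀ o ∈ s, q o ∈ D.U := by
    rintro (_ | a) ha
    · exact hD.park (Metric.ball_subset_ball (by linarith [hD.ρ'_pos]) hp)
    · exact hD.z_mem a (Finset.mem_filter.1 (Finset.some_mem_insertNone.1 ha)).1
  have hθj2 : 0 < θ ^ (j + 1) := pow_pos hθ0 _
  have hm0 : ∀ o ∈ s, 0 ≤ m o := by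
    rintro (_ | a) ha
    · exact mul_nonneg hθj2.le (sub_nonneg.2 hRelC)
    · exact mul_nonneg hθj2.le (hβJ a (Finset.some_mem_insertNone.1 ha))
  have hmsum : ∑ o ∈ s, m o = θ * (θ ^ j * (C (j + 1) - Rel j)) := by
    rw [hs, Finset.sum_insertNone]
    simp only [hm, Option.elim]
    rw [← Finset.mul_sum, hRels]
    ring
  obtain ⟨r, hr, hr0, hrd⟩ := exists_radius_disjoint_balls s q hqinj
    (lt_min hD.ρ_pos (half_pos hD.ρ'_pos))
  obtain ⟨R, hR, hRm⟩ : ∃ R, Sweep D.U R ∧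
      ∀ o ∈ s, m o ≤ ν.real (D.U ∩ R ⁻¹' Metric.ball (q o) r) := by
    have h0 : 0 ≤ ∑ o ∈ s, m o := Finset.sum_nonneg hm0
    -- Sorting needs strictly more mass than it delivers. The factor `θ < 1` provides this unless
    -- all shares vanish, and then nothing has to be moved.
    rcases h0.eq_or_lt with h1 | h1
    · refine ⟨_, Sweep.id, fun o ho => ?_⟩
      rw [(Finset.sum_eq_zero_iff_of_nonneg hm0).1 h1.symm o ho]
      exact measureReal_nonneg
    · refine Sweep.exists_sort hD.isOpen hD.preconnected hD.compl_nonempty hνac s hqU hqinj hm0 ?_ hr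
      rw [hνU]
      rw [hmsum] at h1 ⊢
      have h2 : 0 < θ ^ j * (C (j + 1) - Rel j) := pos_of_mul_pos_right h1 hθ0.le
      nlinarith
  set Ψ' := R ∘ Ψ with hΨ'
  have hΨ'm : Measurable Ψ' := hR.continuous.measurable.comp hΨm
  have hmass : ∀ o ∈ s, m o ≤ D.μ.real (Q ∩ Ψ' ⁻¹' Metric.ball (q o) r) := by
    intro o ho
    refine (hRm o ho).trans ?_
    rw [hνS _ (hD.isOpen.measurableSet.inter
      (hR.continuous.measurable Metric.isOpen_ball.measurableSet))]
    exact measureReal_mono (inter_subset_inter_right _ fun x hx => hx.2)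
  have hmeas : ∀ o, MeasurableSet (Q ∩ Ψ' ⁻¹' Metric.ball (q o) r) := fun o =>
    hQm.inter (hΨ'm Metric.isOpen_ball.measurableSet)
  have hdisjQ : ∀ o ∈ s, ∀ o' ∈ s, o ≠ o' → Disjoint (Q ∩ Ψ' ⁻¹' Metric.ball (q o) r)
      (Q ∩ Ψ' ⁻¹' Metric.ball (q o') r) := fun o ho o' ho' hne =>
    ((hrd o ho o' ho' hne).preimage Ψ').mono inter_subset_right inter_subset_right
  have hAQ : ∀ i ∈ D.I, D.lev i < j → Disjoint (A i) Q := by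
    intro i hi hij
    rw [hQ, disjoint_union_right]
    exact ⟨h.disjoint_P i hi hij, disjoint_sdiff_right.mono_left (h.subset_A i hi hij)⟩
  have hnone : none ∈ s := Finset.none_mem_insertNone
  have hsome : ∀ i ∈ D.I, D.lev i = j → some i ∈ s := fun i hi hij =>
    Finset.some_mem_insertNone.2 (Finset.mem_filter.2 ⟨hi, hij⟩)
  have hlevlt : ∀ i, D.lev i < j + 1 → D.lev i ≠ j → D.lev i < j := fun i h1 h2 => by omega
  refine ⟨Ψ', fun i => if D.lev i = j then Q ∩ Ψ' ⁻¹' Metric.ball (q (some i)) r else A i,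
    Q ∩ Ψ' ⁻¹' Metric.ball (q none) r, ?_⟩
  constructor
  · obtain ⟨K', hK'⟩ := hR.lipschitz
    simpa using h.steers.comp (hR.approxSteers hv hD.subset)
      (mul_nonneg (Nat.cast_nonneg _) hD.h_pos.le) le_rfl hK'
  · obtain ⟨K', hK'⟩ := hR.lipschitz
    exact ⟨_, hK'.comp hK⟩
  · obtain ⟨R', hR', hl, -⟩ := hR.exists_inverse
    obtain ⟨K', hK'⟩ := hR'.lipschitz
    obtain ⟨Φ, K'', hK'', hl'⟩ := h.inverse
    refine ⟨Φ ∘ R', _, hK''.comp hK', fun x => ?_⟩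
    simp only [hΨ', Function.comp_apply]
    rw [hl, hl']
  · intro x hx
    have hxj : x ∉ captured D.v D.U D.h j := fun h' => hx (captured_mono j.le_succ h')
    rw [hΨ', Function.comp_apply, h.free x hxj]
    exact hR.eq_self fun hU => hx ⟨j, j.lt_succ_self, hU⟩
  · intro i hi hij
    by_cases hc : D.lev i = j
    · simp only [hc, if_true]; exact hmeas _
    · simp only [hc, if_false]; exact h.measurable_A i hi (hlevlt i hij hc)
  · intro i hi hij
    by_cases hc : D.lev i = j
    · simp only [hc, if_true]; exact inter_subset_left.trans hQc
    · simp only [hc, if_false]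
      exact (h.subset_A i hi (hlevlt i hij hc)).trans (captured_mono j.le_succ)
  · intro i hi i' hi' hij hij' hne
    by_cases hc : D.lev i = j <;> by_cases hc' : D.lev i' = j <;> simp only [hc, hc', if_true, if_false]
    · exact hdisjQ _ (hsome i hi hc) _ (hsome i' hi' hc') (by simpa using hne)
    · exact (hAQ i' hi' (hlevlt i' hij' hc')).symm.mono_left inter_subset_left
    · exact (hAQ i hi (hlevlt i hij hc)).mono_right inter_subset_left
    · exact h.disjoint_A i hi i' hi' (hlevlt i hij hc) (hlevlt i' hij' hc') hne
  · intro i hi hij x hx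
    by_cases hc : D.lev i = j
    · simp only [hc, if_true] at hx
      refine ⟨Ψ' x, Metric.ball_subset_ball (hr0.trans (min_le_left _ _)) hx.2, ?_⟩
      simp [hc, hv]
    · simp only [hc, if_false] at hx
      have hlt := hlevlt i hij hc
      obtain ⟨y, hy, hxy⟩ := h.maps_A i hi hlt x hx
      refine ⟨y, hy, ?_⟩
      rw [← hxy]
      -- A piece released `j - lev i ≥ 1` steps ago is outside `U` by `avoid`, where the sweep is
      -- the identity.
      refine hR.eq_self ?_
      have := hD.avoid i hi (j - D.lev i) (by omega) (by omega) y hy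
      rw [Nat.cast_sub hlt.le] at this
      rwa [hxy]
  · intro i hi hij
    by_cases hc : D.lev i = j
    · simp only [hc, if_true]; exact hmass _ (hsome i hi hc)
    · simp only [hc, if_false]
      refine le_trans ?_ (h.mass_A i hi (hlevlt i hij hc))
      refine mul_le_mul_of_nonneg_right ?_ (hD.β_nonneg i hi)
      exact pow_le_pow_of_le_one hθ0.le hθ1.le j.le_succ
  · exact hmeas _
  · exact inter_subset_left.trans hQc
  · intro i hi hij
    by_cases hc : D.lev i = j
    · simp only [hc, if_true]
      exact hdisjQ _ (hsome i hi hc) _ hnone (by simp)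
    · simp only [hc, if_false]
      exact (hAQ i hi (hlevlt i hij hc)).mono_right inter_subset_left
  · intro x hx
    have h1 : dist p D.p < D.ρ' / 2 := hp
    have h2 : r ≤ D.ρ' / 2 := hr0.trans (min_le_right _ _)
    have h3 : Ψ' x ∈ Metric.ball p r := hx.2
    exact Metric.ball_subset_ball' (by linarith) h3
  · exact hmass _ hnone

theorem Plan.Feasible.exists_transport {ι : Type*} {D : Plan d ι} (hd : 0 < d) (hD : D.Feasible)
    {θ : ℝ} (hθ0 : 0 < θ) (hθ1 : θ < 1) :
    ∃ (Ψ : E d → E d) (A : ι → Set (E d)), ApproxSteers D.v D.ω (D.n * D.h) Ψ ∧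
      (∀ i ∈ D.I, MeasurableSet (A i)) ∧
      (∀ i ∈ D.I, ∀ i' ∈ D.I, i ≠ i' → Disjoint (A i) (A i')) ∧
      (∀ i ∈ D.I, ∀ x ∈ A i, ∃ y ∈ Metric.ball (D.z i) D.ρ,
        Ψ x = flow D.v (((D.n : ℝ) - D.lev i) * D.h) y) ∧
      ∀ i ∈ D.I, θ ^ (D.n + 1) * D.β i ≤ D.μ.real (A i) := by
  have key : ∀ j ≤ D.n, ∃ Ψ A P, D.State θ j j D.U Ψ A P := by
    intro j
    induction j with
    | zero => exact fun _ => ⟨_, _, _, hD.state_zero θ⟩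
    | succ j ih =>
      intro hj
      obtain ⟨Ψ, A, P, h⟩ := ih (by omega)
      obtain ⟨Ψ', A', P', h'⟩ := hD.state_impulse hd hθ0 hθ1 (by omega) h
      exact ⟨_, _, _, hD.state_drift h'⟩
  obtain ⟨Ψ, A, P, h⟩ := key D.n le_rfl
  -- A last impulse without drift places the pieces of level `n`; hence `n + 1` impulses and the
  -- exponent of `θ`.
  obtain ⟨Ψ', A', P', h'⟩ := hD.state_impulse hd hθ0 hθ1 le_rfl h
  have hlt : ∀ i ∈ D.I, D.lev i < D.n + 1 := fun i hi => Nat.lt_succ_of_le (hD.lev_le i hi)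
  exact ⟨Ψ', A', h'.steers, fun i hi => h'.measurable_A i hi (hlt i hi),
    fun i hi i' hi' => h'.disjoint_A i hi i' hi' (hlt i hi) (hlt i' hi'),
    fun i hi => h'.maps_A i hi (hlt i hi), fun i hi => h'.mass_A i hi (hlt i hi)⟩

/-! ### Mass budgets: trimming and generalised inverses -/

/-- Masses whose cumulative sums exceed a bound by at most `κ` can be lowered, by a total of at
most `κ`, so as to satisfy it. -/
theorem exists_trim {ι : Type*} (I : Finset ι) (lev : ι → ℕ) {N : ℕ} (hlev : ∀ i ∈ I, lev i < N)
    {b : ι → ℝ} (hb : ∀ i ∈ I, 0 ≤ b i) {κ : ℝ} (hκ : 0 ≤ κ) {c : ℕ → ℝ} (hc : ∀ m, 0 ≤ c m)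
    (h : ∀ m ≤ N, ∑ i ∈ I with lev i < m, b i ≤ c m + κ) :
    ∃ β : ι → ℝ, (∀ i ∈ I, 0 ≤ β i ∧ β i ≤ b i) ∧
      (∀ m ≤ N, ∑ i ∈ I with lev i < m, β i ≤ c m) ∧ ∑ i ∈ I, b i - κ ≤ ∑ i ∈ I, β i := by
  set B : ℕ → ℝ := fun m => ∑ i ∈ I with lev i < m, b i with hB
  -- The trimmed cumulative mass: the amount `κ` is removed from the earliest levels. Its increments
  -- do not exceed those of `B`, so each level can be scaled by their ratio `lam`.
  set G : ℕ → ℝ := fun m => max (B m - κ) 0 with hG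
  have hBs : ∀ m, B (m + 1) = B m + ∑ i ∈ I with lev i = m, b i := sum_filter_lt_succ I lev b
  have hnn : ∀ m, 0 ≤ ∑ i ∈ I with lev i = m, b i := fun m =>
    Finset.sum_nonneg fun i hi => hb i (Finset.mem_filter.1 hi).1
  have hG1 : ∀ m, 0 ≤ G (m + 1) - G m := fun m => by
    have := hnn m
    simp only [hG]
    rw [hBs, sub_nonneg]
    exact max_le_max (by linarith) le_rfl
  have hG2 : ∀ m, G (m + 1) - G m ≤ B (m + 1) - B m := fun m => by
    have := hnn m
    simp only [hG]
    rw [hBs]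
    have h1 : max (B m + (∑ i ∈ I with lev i = m, b i) - κ) 0 ≤
        max (B m - κ) 0 + ∑ i ∈ I with lev i = m, b i :=
      max_le (by linarith [le_max_left (B m - κ) 0]) (by linarith [le_max_right (B m - κ) 0])
    linarith
  set lam : ℕ → ℝ := fun m => (G (m + 1) - G m) / (B (m + 1) - B m) with hlam
  have hlam0 : ∀ m, 0 ≤ lam m := fun m => div_nonneg (hG1 m) ((hG1 m).trans (hG2 m))
  have hlam1 : ∀ m, lam m ≤ 1 := fun m => div_le_one_of_le₀ (hG2 m) ((hG1 m).trans (hG2 m))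
  have hsum : ∀ m, ∑ i ∈ I with lev i < m, lam (lev i) * b i = G m := by
    intro m
    induction m with
    | zero => simp [hG, hB, hκ]
    | succ m ih =>
      rw [sum_filter_lt_succ I lev (fun i => lam (lev i) * b i), ih]
      have h1 : ∑ i ∈ I with lev i = m, lam (lev i) * b i =
          lam m * ∑ i ∈ I with lev i = m, b i := by
        rw [Finset.mul_sum]
        exact Finset.sum_congr rfl fun i hi => by rw [(Finset.mem_filter.1 hi).2]
      have h2 : ∑ i ∈ I with lev i = m, b i = B (m + 1) - B m := by rw [hBs]; ring
      rw [h1, h2, hlam]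
      -- On a level without mass `lam` is `0 / 0 = 0`, consistent since `G` does not grow there
      -- either.
      by_cases h0 : B (m + 1) - B m = 0
      · have := hG1 m
        have := hG2 m
        rw [h0] at this ⊢
        simp; linarith
      · simp only
        rw [div_mul_cancel₀ _ h0]; ring
  refine ⟨fun i => lam (lev i) * b i, fun i hi => ⟨mul_nonneg (hlam0 _) (hb i hi),
    mul_le_of_le_one_left (hb i hi) (hlam1 _)⟩, fun m hm => ?_, ?_⟩
  · rw [hsum]
    exact max_le (by linarith [h m hm]) (hc m)
  · have hall : I.filter (fun i => lev i < N) = I := Finset.filter_true_of_mem hlev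
    have h1 := hsum N
    rw [hall] at h1
    rw [h1]
    have h2 : B N = ∑ i ∈ I, b i := by rw [hB]; simp only [hall]
    rw [← h2]
    exact le_max_left _ _

section GenInverse

variable {G₀ G₁ : ℝ → ℝ}

theorem genInverse_le {G : ℝ → ℝ} {m t : ℝ} (ht : 0 ≤ t) (h : m ≤ G t) : genInverse G m ≤ t :=
  csInf_le ⟨0, fun _ hs => hs.1⟩ ⟨ht, h⟩

theorem lt_of_lt_genInverse {G : ℝ → ℝ} {m t : ℝ} (ht : 0 ≤ t) (h : t < genInverse G m) :
    G t < m := by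
  by_contra hcon
  exact absurd (genInverse_le ht (not_lt.1 hcon)) (not_le.2 h)

theorem le_genInverse {G : ℝ → ℝ} (hG : Monotone G) {m s C : ℝ} (hC : 0 ≤ C) (hGC : m ≤ G C)
    (h : G s < m) : s ≤ genInverse G m := by
  refine le_csInf ⟨C, hC, hGC⟩ fun t ht => ?_
  by_contra hcon
  exact absurd (ht.2.trans (hG (not_le.1 hcon).le)) (not_le.2 h)

theorem bddAbove_genInverse_add {C₀ C₁ : ℝ} (hC₀ : 0 ≤ C₀) (hC₁ : 0 ≤ C₁) (h₀ : 1 ≤ G₀ C₀)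
    (h₁ : 1 ≤ G₁ C₁) :
    BddAbove ((fun m : ℝ => genInverse G₀ m + genInverse G₁ (1 - m)) '' Icc (0 : ℝ) 1) := by
  refine ⟨C₀ + C₁, ?_⟩
  rintro _ ⟨m, hm, rfl⟩
  exact add_le_add (genInverse_le hC₀ (hm.2.trans h₀))
    (genInverse_le hC₁ (by linarith [hm.1]))

/-- If the sum were below `1`, an `m` strictly between `G₀ s` and `1 - G₁ (T - s)` would have
generalised inverses at least `s` and `T - s`, so the supremum would be at least `T`. Negative `s`
is allowed and used later. -/
theorem one_le_add_of_sSup_lt {C₀ C₁ : ℝ} (hG₀ : Monotone G₀) (hG₁ : Monotone G₁)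
    (hn₀ : ∀ t, 0 ≤ G₀ t) (hn₁ : ∀ t, 0 ≤ G₁ t) (hC₀ : 0 ≤ C₀) (hC₁ : 0 ≤ C₁) (h₀ : 1 ≤ G₀ C₀)
    (h₁ : 1 ≤ G₁ C₁) {T : ℝ}
    (hT : sSup ((fun m : ℝ => genInverse G₀ m + genInverse G₁ (1 - m)) '' Icc (0 : ℝ) 1) < T)
    (s : ℝ) : 1 ≤ G₀ s + G₁ (T - s) := by
  by_contra hcon
  rw [not_le] at hcon
  obtain ⟨m, hm₀, hm₁⟩ := exists_between (show G₀ s < 1 - G₁ (T - s) by linarith)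
  have hm : m ∈ Icc (0 : ℝ) 1 := ⟨(hn₀ s).trans hm₀.le, by linarith [hn₁ (T - s)]⟩
  have h2 := le_csSup (bddAbove_genInverse_add hC₀ hC₁ h₀ h₁) (mem_image_of_mem _ hm)
  have h3 := le_genInverse hG₀ hC₀ (hm.2.trans h₀) hm₀
  have h4 := le_genInverse hG₁ hC₁ (by linarith [hm.1] : 1 - m ≤ G₁ C₁) (s := T - s) (by linarith)
  linarith

theorem sSup_genInverse_nonneg {C₀ C₁ : ℝ} (hC₀ : 0 ≤ C₀) (hC₁ : 0 ≤ C₁) (h₀ : 1 ≤ G₀ C₀)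
    (h₁ : 1 ≤ G₁ C₁) :
    0 ≤ sSup ((fun m : ℝ => genInverse G₀ m + genInverse G₁ (1 - m)) '' Icc (0 : ℝ) 1) := by
  have h2 := le_csSup (bddAbove_genInverse_add hC₀ hC₁ h₀ h₁)
    (mem_image_of_mem _ (left_mem_Icc.2 zero_le_one))
  have h3 : ∀ (G : ℝ → ℝ) m, 0 ≤ genInverse G m := fun G m => Real.sInf_nonneg fun t ht => ht.1
  exact (add_nonneg (h3 _ _) (h3 _ _)).trans h2

end GenInverse

/-! ### Entry times and their visibility on a grid -/

section EntryTime

variable {v : E d → E d} {ω : Set (E d)}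

/-- Time reversal: every fact about forward entry transfers to `μ1` with `-v`. -/
theorem backwardEntryTime_eq (hv : IsVelocity v) (ω : Set (E d)) :
    backwardEntryTime v ω = entryTime (-v) ω := by
  ext1 x
  simp only [backwardEntryTime, entryTime, hv.flow_neg]

theorem backwardMass_eq (hv : IsVelocity v) (ω : Set (E d)) (μ : ProbabilityMeasure (E d)) :
    backwardMass v ω μ = forwardMass (-v) ω μ := by
  ext1 t
  simp only [backwardMass, forwardMass, backwardEntryTime_eq hv]

theorem entryTime_nonneg (v : E d → E d) (ω : Set (E d)) (x : E d) : 0 ≤ entryTime v ω x :=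
  Real.sInf_nonneg fun _ ht => ht.1

theorem entryTime_le {x : E d} {t : ℝ} (ht : 0 ≤ t) (h : flow v t x ∈ ω) : entryTime v ω x ≤ t :=
  csInf_le ⟨0, fun _ hs => hs.1⟩ ⟨ht, h⟩

theorem exists_of_entryTime_lt {x : E d} (hx : ∃ t, 0 ≤ t ∧ flow v t x ∈ ω) {a : ℝ}
    (h : entryTime v ω x < a) : ∃ t, 0 ≤ t ∧ t < a ∧ flow v t x ∈ ω := by
  obtain ⟨t, ⟨h1, h2⟩, h3⟩ := exists_lt_of_csInf_lt hx h
  exact ⟨t, h1, h3, h2⟩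

theorem measurable_entryTime (hv : IsVelocity v) (hω : IsOpen ω) : Measurable (entryTime v ω) := by
  refine measurable_of_Iio fun a => ?_
  have hopen : ∀ S : Set ℝ, IsOpen {x | ∃ t ∈ S, flow v t x ∈ ω} := fun S => by
    have : {x | ∃ t ∈ S, flow v t x ∈ ω} = ⋃ t ∈ S, flow v t ⁻¹' ω := by ext; simp
    rw [this]
    refine isOpen_biUnion fun t _ => ?_
    obtain ⟨K, hK⟩ := hv.lipschitzWith_flow t
    exact hω.preimage hK.continuous
  rcases le_or_gt a 0 with ha | ha
  · have : entryTime v ω ⁻¹' Iio a = ∅ := by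
      ext x
      simpa using ha.trans (entryTime_nonneg v ω x)
    rw [this]; exact MeasurableSet.empty
  -- Points that never enter have entry time `sInf ∅ = 0`, so for `a > 0` they must be added.
  · have : entryTime v ω ⁻¹' Iio a =
        {x | ∃ t ∈ Ico 0 a, flow v t x ∈ ω} ∪ {x | ∃ t ∈ Ici (0 : ℝ), flow v t x ∈ ω}ᶜ := by
      ext x
      simp only [mem_preimage, mem_Iio, mem_union, mem_compl_iff, mem_ofPred_eq]
      constructor
      · intro h
        by_cases hx : ∃ t ∈ Ici (0 : ℝ), flow v t x ∈ ω
        · obtain ⟨t, h1, h2, h3⟩ := exists_of_entryTime_lt (by simpa using hx) h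
          exact Or.inl ⟨t, ⟨h1, h2⟩, h3⟩
        · exact Or.inr hx
      · rintro (⟨t, ht, h⟩ | hx)
        · exact (entryTime_le ht.1 h).trans_lt ht.2
        · have : {t : ℝ | 0 ≤ t ∧ flow v t x ∈ ω} = ∅ := by
            ext t
            simp only [mem_ofPred_eq, mem_empty_iff_false, iff_false]
            exact fun h => hx ⟨t, h.1, h.2⟩
          rw [entryTime, this, Real.sInf_empty]
          exact ha
    rw [this]
    exact (hopen _).measurableSet.union (hopen _).measurableSet.compl

/-- A visit at time `t` persists for nearby points because `ω` is open, so the bound is local and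
compactness makes it global. -/
theorem exists_entryTime_bound (hv : IsVelocity v) (hω : IsOpen ω) {K : Set (E d)}
    (hK : IsCompact K) (h : ∀ x ∈ K, ∃ t, 0 ≤ t ∧ flow v t x ∈ ω) :
    ∃ C, 0 ≤ C ∧ ∀ x ∈ K, entryTime v ω x ≤ C := by
  refine hK.induction_on (p := fun K => ∃ C, 0 ≤ C ∧ ∀ x ∈ K, entryTime v ω x ≤ C) ?_ ?_ ?_ ?_
  · exact ⟨0, le_rfl, by simp⟩
  · rintro s t hst ⟨C, hC, h⟩
    exact ⟨C, hC, fun x hx => h x (hst hx)⟩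
  · rintro s t ⟨C, hC, h⟩ ⟨C', hC', h'⟩
    refine ⟨max C C', le_max_of_le_left hC, ?_⟩
    rintro x (hx | hx)
    · exact (h x hx).trans (le_max_left _ _)
    · exact (h' x hx).trans (le_max_right _ _)
  · intro x hx
    obtain ⟨t, ht, hxt⟩ := h x hx
    obtain ⟨L, hL⟩ := hv.lipschitzWith_flow t
    exact ⟨flow v t ⁻¹' ω, mem_nhdsWithin_of_mem_nhds
      ((hω.preimage hL.continuous).mem_nhds hxt), t, ht, fun y hy => entryTime_le ht hy⟩

theorem forwardMass_nonneg (v : E d → E d) (ω : Set (E d)) (μ : ProbabilityMeasure (E d)) (t : ℝ) :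
    0 ≤ forwardMass v ω μ t := measureReal_nonneg

theorem monotone_forwardMass (v : E d → E d) (ω : Set (E d)) (μ : ProbabilityMeasure (E d)) :
    Monotone (forwardMass v ω μ) := fun _ _ hst =>
  measureReal_mono fun _ hx => ⟨hx.1, hx.2.trans hst⟩

theorem measureReal_support (μ : ProbabilityMeasure (E d)) :
    (μ : Measure (E d)).real (μ : Measure (E d)).support = 1 := by
  have h := prob_compl_eq_zero_iff (μ := (μ : Measure (E d)))
    (Measure.isClosed_support (μ := (μ : Measure (E d)))).measurableSet
  rw [Measure.real, h.1 Measure.measure_compl_support, ENNReal.toReal_one]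

theorem forwardMass_eq_one {μ : ProbabilityMeasure (E d)} {C : ℝ}
    (h : ∀ x ∈ (μ : Measure (E d)).support, entryTime v ω x ≤ C) : forwardMass v ω μ C = 1 := by
  rw [forwardMass, ← measureReal_support μ]
  congr 1
  ext x
  exact ⟨fun hx => hx.1, fun hx => ⟨hx, h x hx⟩⟩

theorem one_sub_forwardMass (hv : IsVelocity v) (hω : IsOpen ω) (μ : ProbabilityMeasure (E d))
    (t : ℝ) : (μ : Measure (E d)).real {x | x ∈ (μ : Measure (E d)).support ∧ t < entryTime v ω x}
      = 1 - forwardMass v ω μ t := by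
  have h1 := measureReal_inter_add_sdiff (μ := (μ : Measure (E d)))
    (s := (μ : Measure (E d)).support) (t := {x | entryTime v ω x ≤ t})
    (measurable_entryTime hv hω measurableSet_Iic)
  rw [measureReal_support] at h1
  have h2 : (μ : Measure (E d)).support \ {x | entryTime v ω x ≤ t} =
      {x | x ∈ (μ : Measure (E d)).support ∧ t < entryTime v ω x} := by
    ext x
    simp [not_le]
  rw [h2] at h1
  have h3 : forwardMass v ω μ t =
    (μ : Measure (E d)).real ((μ : Measure (E d)).support ∩ {x | entryTime v ω x ≤ t}) := rfl
  linarith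

/-- A point that enters `ω` is seen in the core of `ω` by a fine grid shortly after its entry
time. -/
theorem eventually_exists_grid (hv : IsVelocity v) (hω : IsOpen ω) (hωn : ωᶜ.Nonempty) {x : E d}
    (hx : ∃ t, 0 ≤ t ∧ flow v t x ∈ ω) {δ T : ℝ} (hδ : 0 < δ) (hT : 0 < T) {e : ℕ → ℝ}
    (he : Tendsto e atTop (𝓝 0)) :
    ∀ᶠ n : ℕ in atTop, ∃ j : ℕ, j * (T / (n + 1)) ≤ entryTime v ω x + δ ∧
      e n < Metric.infDist (flow v (j * (T / (n + 1))) x) ωᶜ := by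
  obtain ⟨τ, hτ0, hτ, hτω⟩ := exists_of_entryTime_lt hx
    (show entryTime v ω x < entryTime v ω x + δ / 2 by linarith)
  have hpos : 0 < Metric.infDist (flow v τ x) ωᶜ :=
    (hω.isClosed_compl.notMem_iff_infDist_pos hωn).1 (by simpa using hτω)
  set a := Metric.infDist (flow v τ x) ωᶜ with ha
  have hcont : Continuous fun s => Metric.infDist (flow v s x) ωᶜ :=
    (Metric.continuous_infDist_pt _).comp (hv.continuous_flow_left x)
  obtain ⟨η, hη, hηa⟩ := Metric.eventually_nhds_iff.1
    (hcont.continuousAt.eventually (lt_mem_nhds (show a / 2 < a by linarith)))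
  have hh : Tendsto (fun n : ℕ => T / ((n : ℝ) + 1)) atTop (𝓝 0) := by
    have := (tendsto_add_atTop_iff_nat 1).2 (tendsto_const_div_atTop_nhds_zero_nat T)
    simpa using this
  filter_upwards [he.eventually (gt_mem_nhds (half_pos hpos)),
    hh.eventually (gt_mem_nhds (lt_min hη (half_pos hδ)))] with n hn1 hn2
  set h := T / ((n : ℝ) + 1) with hhd
  have hh0 : 0 < h := by positivity
  have h1 := Nat.le_ceil (τ / h)
  have h2 := Nat.ceil_lt_add_one (div_nonneg hτ0 hh0.le)
  rw [div_le_iff₀ hh0] at h1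
  have h3 : (⌈τ / h⌉₊ : ℝ) * h < τ + h := by
    have := mul_lt_mul_of_pos_right h2 hh0
    rwa [add_mul, div_mul_cancel₀ _ hh0.ne', one_mul] at this
  have hn3 := hn2.trans_le (min_le_left _ _)
  have hn4 := hn2.trans_le (min_le_right _ _)
  -- The first grid instant not before the visit `τ`: the step is too short to lose half of the
  -- depth `a`, or more than the remaining `δ / 2`.
  refine ⟨⌈τ / h⌉₊, by linarith, hn1.trans (hηa ?_)⟩
  rw [Real.dist_eq, abs_lt]
  constructor <;> linarith

end EntryTime

/-! ### From transported cells to weak convergence -/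

/-- If masses carried by small sets of `μ₁` are transported into the same small balls, the open
sets have at least, up to the mass that is left over, the expected mass. -/
theorem measureReal_le_of_transport {ι : Type*} (I : Finset ι) {μ₀ μ₁ : Measure (E d)}
    [IsProbabilityMeasure μ₀] [IsProbabilityMeasure μ₁] {X : E d → E d}
    {A Y : ι → Set (E d)} {c : ι → E d} {γ : ι → ℝ} {ε κ : ℝ}
    (hA : ∀ i ∈ I, MeasurableSet (A i)) (hY : ∀ i ∈ I, MeasurableSet (Y i))
    (hAd : ∀ i ∈ I, ∀ j ∈ I, i ≠ j → Disjoint (A i) (A j))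
    (hYd : ∀ i ∈ I, ∀ j ∈ I, i ≠ j → Disjoint (Y i) (Y j))
    (hγA : ∀ i ∈ I, γ i ≤ μ₀.real (A i)) (hγY : ∀ i ∈ I, γ i ≤ μ₁.real (Y i))
    (hXA : ∀ i ∈ I, ∀ x ∈ A i, dist (X x) (c i) < ε) (hYc : ∀ i ∈ I, ∀ y ∈ Y i, dist y (c i) < ε)
    (hsum : 1 - κ ≤ ∑ i ∈ I, γ i) (O : Set (E d)) :
    μ₁.real (Metric.thickening (2 * ε) Oᶜ)ᶜ ≤ μ₀.real (X ⁻¹' O) + κ := by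
  classical
  set O' := (Metric.thickening (2 * ε) Oᶜ)ᶜ with hO'
  have hO'm : MeasurableSet O' := Metric.isOpen_thickening.measurableSet.compl
  -- Cells meeting the shrunken set `O'` have their transported mass inside `O`, thanks to the
  -- margin `2 * ε`. The other cells carry at most the mass outside `O'`.
  set J := I.filter fun i => (Y i ∩ O').Nonempty with hJ
  set J' := I.filter fun i => ¬ (Y i ∩ O').Nonempty with hJ'
  have hJJ' : ∑ i ∈ J, γ i + ∑ i ∈ J', γ i = ∑ i ∈ I, γ i := Finset.sum_filter_add_sum_filter_not _ _ _
  have hJI : ∀ i ∈ J, i ∈ I := fun i hi => (Finset.mem_filter.1 hi).1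
  have hJI' : ∀ i ∈ J', i ∈ I := fun i hi => (Finset.mem_filter.1 hi).1
  have h1 : ∑ i ∈ J, γ i ≤ μ₀.real (X ⁻¹' O) := by
    calc ∑ i ∈ J, γ i ≤ ∑ i ∈ J, μ₀.real (A i) := Finset.sum_le_sum fun i hi => hγA i (hJI i hi)
      _ = μ₀.real (⋃ i ∈ J, A i) := (measureReal_biUnion_finset
          (fun i hi j hj hij => hAd i (hJI i hi) j (hJI j hj) hij) (fun i hi => hA i (hJI i hi))).symm
      _ ≤ _ := measureReal_mono (iUnion₂_subset fun i hi x hx => ?_)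
    obtain ⟨y, hyY, hyO⟩ := (Finset.mem_filter.1 hi).2
    by_contra hcon
    refine hyO (Metric.mem_thickening_iff.2 ⟨X x, hcon, ?_⟩)
    have h2 := hXA i (hJI i hi) x hx
    have h3 := hYc i (hJI i hi) y hyY
    rw [dist_comm] at h2
    linarith [dist_triangle y (c i) (X x)]
  have h2 : ∑ i ∈ J', γ i ≤ 1 - μ₁.real O' := by
    rw [← probReal_compl_eq_one_sub hO'm]
    calc ∑ i ∈ J', γ i ≤ ∑ i ∈ J', μ₁.real (Y i) := Finset.sum_le_sum fun i hi => hγY i (hJI' i hi)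
      _ = μ₁.real (⋃ i ∈ J', Y i) := (measureReal_biUnion_finset
          (fun i hi j hj hij => hYd i (hJI' i hi) j (hJI' j hj) hij)
          (fun i hi => hY i (hJI' i hi))).symm
      _ ≤ _ := measureReal_mono (iUnion₂_subset fun i hi x hx hxO =>
          (Finset.mem_filter.1 hi).2 ⟨x, hx, hxO⟩)
  linarith

/-- Portmanteau on open sets: the shrunken sets exhaust `O` as `ε n → 0`. -/
theorem tendsto_of_measureReal_thickening_le {μ : ProbabilityMeasure (E d)}
    {ν : ℕ → ProbabilityMeasure (E d)} {ε κ : ℕ → ℝ} (hε : Tendsto ε atTop (𝓝 0))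
    (hκ : Tendsto κ atTop (𝓝 0))
    (h : ∀ n O, IsOpen O → (μ : Measure (E d)).real (Metric.thickening (ε n) Oᶜ)ᶜ ≤
      (ν n : Measure (E d)).real O + κ n) : Tendsto ν atTop (𝓝 μ) := by
  refine tendsto_of_forall_isOpen_le_liminf' fun O hO => ?_
  have hm : ∀ n, MeasurableSet (O \ (Metric.thickening (ε n) Oᶜ)ᶜ) := fun n =>
    hO.measurableSet.diff Metric.isOpen_thickening.measurableSet.compl
  have h1 := tendsto_measure_zero_of_eventually_notMem (ν := (μ : Measure (E d))) hm
    (ae_of_all _ fun x => ?_)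
  · have h2 := (ENNReal.tendsto_toReal ENNReal.zero_ne_top).comp h1
    have h3 := h2.add hκ
    rw [ENNReal.toReal_zero, add_zero] at h3
    refine le_of_forall_lt fun c hc => ?_
    obtain ⟨c', hcc', hc'⟩ := exists_between hc
    refine hcc'.trans_le (le_liminf_of_le (by isBoundedDefault) ?_)
    have hc'r : c'.toReal < (μ : Measure (E d)).real O :=
      (ENNReal.toReal_lt_toReal hc'.ne_top (measure_ne_top _ _)).2 hc'
    filter_upwards [h3.eventually (gt_mem_nhds (sub_pos.2 hc'r))] with n hn
    have h4 := h n O hO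
    have h5 := measureReal_inter_add_sdiff (μ := (μ : Measure (E d))) (s := O)
      (t := (Metric.thickening (ε n) Oᶜ)ᶜ) Metric.isOpen_thickening.measurableSet.compl
    have h6 : (μ : Measure (E d)).real (O ∩ (Metric.thickening (ε n) Oᶜ)ᶜ) ≤
        (μ : Measure (E d)).real (Metric.thickening (ε n) Oᶜ)ᶜ := measureReal_mono inter_subset_right
    have hn' : (μ : Measure (E d)).real (O \ (Metric.thickening (ε n) Oᶜ)ᶜ) + κ n <
      (μ : Measure (E d)).real O - c'.toReal := hn
    have h7 : c'.toReal ≤ (ν n : Measure (E d)).real O := by linarith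
    exact (ENNReal.toReal_le_toReal hc'.ne_top (measure_ne_top _ _)).1 h7
  · by_cases hx : x ∈ O
    · obtain ⟨r, hr, hrO⟩ := Metric.isOpen_iff.1 hO x hx
      filter_upwards [hε.eventually (gt_mem_nhds hr)] with n hn hmem
      obtain ⟨z, hz, hxz⟩ := Metric.mem_thickening_iff.1 (not_not.1 hmem.2)
      rw [dist_comm] at hxz
      exact hz (hrO (hxz.trans hn))
    · exact Eventually.of_forall fun n hmem => hx hmem.1

/-! ### Controllability in every time above `S` -/

theorem eventually_ball_subset {z : E d} {O : Set (E d)} (hO : O ∈ 𝓝 z) :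
    ∀ᶠ ρ in 𝓝[>] (0 : ℝ), Metric.ball z ρ ⊆ O := by
  obtain ⟨r, hr, hrO⟩ := Metric.mem_nhds_iff.1 hO
  filter_upwards [mem_nhdsWithin_of_mem_nhds (gt_mem_nhds hr)] with ρ hρ
  exact (Metric.ball_subset_ball (le_of_lt hρ)).trans hrO

/-- Numbering the balls lets the cover be made disjoint by keeping, for each point, the first ball
containing it. -/
theorem exists_cover_seq {K : Set (E d)} (hK : IsCompact K) {ε : ℝ} (hε : 0 < ε) :
    ∃ (q : ℕ → E d) (L : ℕ), ∀ x ∈ K, ∃ l < L, dist x (q l) < ε := by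
  obtain ⟨t, ht⟩ := hK.elim_finite_subcover (fun l : ℕ => Metric.ball (TopologicalSpace.denseSeq (E d) l) ε)
    (fun _ => Metric.isOpen_ball) fun x _ => by
      obtain ⟨_, hy, l, rfl⟩ := Metric.dense_iff.1 (TopologicalSpace.denseRange_denseSeq (E d)) x ε hε
      rw [Metric.mem_ball, dist_comm] at hy
      exact mem_iUnion.2 ⟨l, hy⟩
  refine ⟨TopologicalSpace.denseSeq (E d), t.sup id + 1, fun x hx => ?_⟩
  obtain ⟨l, hl, hxl⟩ := mem_iUnion₂.1 (ht hx)
  exact ⟨l, Nat.lt_succ_of_le (Finset.le_sup (f := id) hl), hxl⟩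

theorem exists_pow_ge {κ : ℝ} (hκ : 0 < κ) (N : ℕ) : ∃ θ : ℝ, 0 < θ ∧ θ < 1 ∧ 1 - κ ≤ θ ^ N := by
  have hc : ContinuousAt (fun θ : ℝ => θ ^ N) 1 := (continuous_pow N).continuousAt
  have h1 : ∀ᶠ θ in 𝓝 (1 : ℝ), 1 - κ ≤ θ ^ N := hc.eventually (lt_mem_nhds
    (show 1 - κ < (1 : ℝ) ^ N by simpa using hκ)) |>.mono fun _ h => h.le
  have h2 : ∀ᶠ θ in 𝓝 (1 : ℝ), 0 < θ := lt_mem_nhds one_pos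
  obtain ⟨θ, ⟨h3, h4⟩, h5⟩ := (((h2.and h1).filter_mono nhdsWithin_le_nhds).and
    (self_mem_nhdsWithin (a := (1 : ℝ)) (s := Iio 1))).exists
  exact ⟨θ, h3, h5, h4⟩

theorem isOpen_core (ω : Set (E d)) (e : ℝ) : IsOpen {x : E d | e < Metric.infDist x ωᶜ} :=
  isOpen_lt continuous_const (Metric.continuous_infDist_pt _)

theorem core_subset {ω : Set (E d)} {e : ℝ} (he : 0 < e) :
    {x : E d | e < Metric.infDist x ωᶜ} ⊆ ω := by
  intro x hx
  by_contra hxω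
  have h1 : e < Metric.infDist x ωᶜ := hx
  rw [Metric.infDist_zero_of_mem (mem_compl hxω)] at h1
  exact lt_asymm he h1

/-- The points of the support that no instant of the grid of step `h` sees in the core
`{e < d(x, ωᶜ)}` at most `δ` after their entry time. -/
def missed (v : E d → E d) (ω : Set (E d)) (μ : ProbabilityMeasure (E d)) (δ h e : ℝ) :
    Set (E d) :=
  {x | x ∈ (μ : Measure (E d)).support ∧ ¬ ∃ j : ℕ, j * h ≤ entryTime v ω x + δ ∧
    e < Metric.infDist (flow v (j * h) x) ωᶜ}

theorem measurableSet_missed {v : E d → E d} (hv : IsVelocity v) {ω : Set (E d)} (hω : IsOpen ω)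
    (μ : ProbabilityMeasure (E d)) (δ h e : ℝ) : MeasurableSet (missed v ω μ δ h e) := by
  have : missed v ω μ δ h e = (μ : Measure (E d)).support ∩ (⋃ j : ℕ,
      {x | j * h ≤ entryTime v ω x + δ} ∩
        flow v (j * h) ⁻¹' {x | e < Metric.infDist x ωᶜ})ᶜ := by
    ext x
    simp [missed]
  rw [this]
  refine Measure.isClosed_support.measurableSet.inter (MeasurableSet.iUnion fun j => ?_).compl
  obtain ⟨K, hK⟩ := hv.lipschitzWith_flow (j * h)
  exact (measurableSet_le measurable_const ((measurable_entryTime hv hω).add_const δ)).inter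
    (hK.continuous.measurable (isOpen_core ω e).measurableSet)

theorem tendsto_measureReal_missed {v : E d → E d} (hv : IsVelocity v) {ω : Set (E d)}
    (hω : IsOpen ω) (hωn : ωᶜ.Nonempty) (μ : ProbabilityMeasure (E d))
    (hgeo : ∀ x ∈ (μ : Measure (E d)).support, ∃ t, 0 ≤ t ∧ flow v t x ∈ ω) {δ T : ℝ} (hδ : 0 < δ)
    (hT : 0 < T) {e : ℕ → ℝ} (he : Tendsto e atTop (𝓝 0)) :
    Tendsto (fun n : ℕ => (μ : Measure (E d)).real (missed v ω μ δ (T / (n + 1)) (e n))) atTop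
      (𝓝 0) := by
  have h1 := tendsto_measure_zero_of_eventually_notMem (ν := (μ : Measure (E d)))
    (s := fun n : ℕ => missed v ω μ δ (T / (n + 1)) (e n))
    (fun n => measurableSet_missed hv hω μ _ _ _) (ae_of_all _ fun x => ?_)
  · exact (ENNReal.tendsto_toReal ENNReal.zero_ne_top).comp h1
  · by_cases hx : x ∈ (μ : Measure (E d)).support
    · filter_upwards [eventually_exists_grid hv hω hωn (hgeo x hx) hδ hT he] with n hn hmem
      exact hmem.2 hn
    · exact Eventually.of_forall fun n hmem => hx hmem.1

/-- For a grid that misses little mass, a control achieves the transport up to small errors. -/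
theorem exists_steers_of_grid (hd : 0 < d) {v : E d → E d} (hv : IsVelocity v) {ω : Set (E d)}
    (hω : IsOpen ω) (hωn : ωᶜ.Nonempty) {μ0 μ1 : ProbabilityMeasure (E d)}
    (hμ1 : IsCompact (μ1 : Measure (E d)).support) (hμ0 : (μ0 : Measure (E d)) ≪ volume)
    {N : ℕ} {h e δ κ ε ρ' : ℝ} (hN : 0 < N) (hh : 0 < h) (he : 0 < e) (hκ : 0 < κ) (hε : 0 < ε)
    (hρ' : 0 < ρ') {p : E d} {U : Set (E d)} (hU : U = {x : E d | e < Metric.infDist x ωᶜ})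
    (hUc : IsPreconnected U) (hpark : Metric.ball p ρ' ⊆ U)
    (hdrift : ∀ y ∈ Metric.ball p ρ', flow v h y ∈ U)
    (hmiss0 : (μ0 : Measure (E d)).real (missed v ω μ0 δ h e) ≤ κ)
    (hmiss1 : (μ1 : Measure (E d)).real (missed (-v) ω μ1 δ h e) ≤ κ)
    (hgen : ∀ k : ℕ, ∀ᵐ y ∂(μ1 : Measure (E d)),
      Metric.infDist (flow (-v) (k * h) y) ωᶜ ≠ e)
    (hent : ∀ᵐ y ∂(μ1 : Measure (E d)), entryTime (-v) ω y + δ ≤ N * h)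
    (hmass : ∀ m : ℕ, (μ1 : Measure (E d)).real {y | y ∈ (μ1 : Measure (E d)).support ∧
      N * h - m * h - δ ≤ entryTime (-v) ω y} ≤ forwardMass v ω μ0 (m * h - δ)) :
    ∃ X, Steers v ω (N * h) X ∧ ∀ O : Set (E d),
      (μ1 : Measure (E d)).real (Metric.thickening (2 * ε) Oᶜ)ᶜ ≤
        (μ0 : Measure (E d)).real (X ⁻¹' O) + 3 * κ := by
  classical
  have hUo : IsOpen U := hU ▸ isOpen_core ω e
  have hUω : U ⊆ ω := hU ▸ core_subset he
  have hUn : Uᶜ.Nonempty := hωn.mono (compl_subset_compl.2 hUω)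
  have hvn := hv.neg
  have hcW : ∀ s, Continuous (flow (-v) s) := fun s => by
    obtain ⟨K, hK⟩ := hvn.lipschitzWith_flow s
    exact hK.continuous
  have hcV : ∀ s, Continuous (flow v s) := fun s => by
    obtain ⟨K, hK⟩ := hv.lipschitzWith_flow s
    exact hK.continuous
  have hmU : ∀ x, x ∈ U ↔ e < Metric.infDist x ωᶜ := fun x => by rw [hU]; rfl
  obtain ⟨q, L, hqL⟩ := exists_cover_seq hμ1 (half_pos hε)
  -- `N - j` is the number of backward steps to the first grid sight of `U`; mass bound for such a
  -- point must be released at instant `j`.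
  set Ylev : ℕ → Set (E d) := fun j => {y | (y ∈ (μ1 : Measure (E d)).support ∧
    (∀ k ≤ N, Metric.infDist (flow (-v) (k * h) y) ωᶜ ≠ e)) ∧
    (flow (-v) ((N - j : ℕ) * h) y ∈ U ∧ ∀ k < N - j, flow (-v) (k * h) y ∉ U) ∧
    ((N - j : ℕ) : ℝ) * h ≤ entryTime (-v) ω y + δ} with hYlev
  set Bl : ℕ → Set (E d) := fun l => {y | dist y (q l) < ε / 2 ∧ ∀ l' < l, ¬ dist y (q l') < ε / 2}
    with hBl
  set Y : ℕ × ℕ → Set (E d) := fun i => Ylev i.1 ∩ Bl i.2 with hY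
  have hYm : ∀ i, MeasurableSet (Y i) := by
    intro i
    have hWm : ∀ s : ℝ, Measurable fun y => Metric.infDist (flow (-v) s y) ωᶜ := fun s =>
      ((Metric.continuous_infDist_pt _).comp (hcW s)).measurable
    have hUm : ∀ s : ℝ, MeasurableSet {y | flow (-v) s y ∈ U} := fun s =>
      (hcW s).measurable hUo.measurableSet
    have hdm : ∀ l, MeasurableSet {y : E d | dist y (q l) < ε / 2} := fun l =>
      measurableSet_lt (measurable_id.dist measurable_const) measurable_const
    refine MeasurableSet.inter (MeasurableSet.inter (MeasurableSet.inter
      Measure.isClosed_support.measurableSet ?_) (MeasurableSet.inter (MeasurableSet.inter (hUm _) ?_) ?_))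
      (MeasurableSet.inter (hdm _) ?_)
    · have : {y | ∀ k ≤ N, Metric.infDist (flow (-v) (k * h) y) ωᶜ ≠ e} =
          ⋂ k : ℕ, ⋂ _ : k ≤ N, {y | Metric.infDist (flow (-v) (k * h) y) ωᶜ ≠ e} := by
        ext; simp
      change MeasurableSet {y | ∀ k ≤ N, Metric.infDist (flow (-v) (k * h) y) ωᶜ ≠ e}
      rw [this]
      exact MeasurableSet.iInter fun k => MeasurableSet.iInter fun _ =>
        (measurableSet_eq_fun (hWm _) measurable_const).compl
    · have : {y | ∀ k < N - i.1, flow (-v) (k * h) y ∉ U} =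
          ⋂ k : ℕ, ⋂ _ : k < N - i.1, {y | flow (-v) (k * h) y ∈ U}ᶜ := by
        ext; simp
      change MeasurableSet {y | ∀ k < N - i.1, flow (-v) (k * h) y ∉ U}
      rw [this]
      exact MeasurableSet.iInter fun k => MeasurableSet.iInter fun _ => (hUm _).compl
    · exact measurableSet_le measurable_const ((measurable_entryTime hvn hω).add_const δ)
    · have : {y | ∀ l' < i.2, ¬ dist y (q l') < ε / 2} =
          ⋂ k : ℕ, ⋂ _ : k < i.2, {y : E d | dist y (q k) < ε / 2}ᶜ := by
        ext; simp
      change MeasurableSet {y | ∀ l' < i.2, ¬ dist y (q l') < ε / 2}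
      rw [this]
      exact MeasurableSet.iInter fun k => MeasurableSet.iInter fun _ => (hdm _).compl
  have hYlevd : ∀ j ≤ N, ∀ j' ≤ N, j < j' → Disjoint (Ylev j) (Ylev j') := by
    intro j _ j' hj' hjj'
    rw [Set.disjoint_left]
    intro y hy hy'
    exact hy.2.1.2 (N - j') (by omega) hy'.2.1.1
  have hBld : ∀ l l', l < l' → Disjoint (Bl l) (Bl l') := by
    intro l l' hll'
    rw [Set.disjoint_left]
    intro y hy hy'
    exact hy'.2 l hll' hy.1
  set I : Finset (ℕ × ℕ) := (Finset.range (N + 1) ×ˢ Finset.range L).filter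
    fun i => (Y i).Nonempty with hI
  have hIN : ∀ i ∈ I, i.1 ≤ N := fun i hi => by
    have := (Finset.mem_product.1 (Finset.mem_filter.1 hi).1).1
    exact Nat.lt_succ_iff.1 (Finset.mem_range.1 this)
  have hYd : ∀ i ∈ I, ∀ i' ∈ I, i ≠ i' → Disjoint (Y i) (Y i') := by
    intro i hi i' hi' hne
    rcases lt_trichotomy i.1 i'.1 with h1 | h1 | h1
    · exact (hYlevd _ (hIN i hi) _ (hIN i' hi') h1).mono inter_subset_left inter_subset_left
    · rcases lt_trichotomy i.2 i'.2 with h2 | h2 | h2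
      · exact (hBld _ _ h2).mono inter_subset_right inter_subset_right
      · exact absurd (Prod.ext h1 h2) hne
      · exact (hBld _ _ h2).symm.mono inter_subset_right inter_subset_right
    · exact (hYlevd _ (hIN i' hi') _ (hIN i hi) h1).symm.mono inter_subset_left inter_subset_left
  set y : ℕ × ℕ → E d := fun i => if hi : (Y i).Nonempty then hi.choose else 0 with hy
  have hyY : ∀ i ∈ I, y i ∈ Y i := fun i hi => by
    have hne := (Finset.mem_filter.1 hi).2
    simp only [hy, dif_pos hne]
    exact hne.choose_spec
  set z : ℕ × ℕ → E d := fun i => flow (-v) ((N - i.1 : ℕ) * h) (y i) with hz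
  have hforth : ∀ (k a : ℕ) (x : E d), k ≤ a →
      flow v (k * h) (flow (-v) (a * h) x) = flow (-v) ((a - k : ℕ) * h) x := by
    intro k a x hka
    rw [hv.flow_neg, hv.flow_neg, ← hv.flow_add, Nat.cast_sub hka]
    congr 1; ring
  -- masses
  set b : ℕ × ℕ → ℝ := fun i => (μ1 : Measure (E d)).real (Y i) with hb
  set c : ℕ → ℝ := fun m => (μ0 : Measure (E d)).real (captured v U h m) with hc
  -- Supply against demand: cells of level at most `m` enter backward no earlier than `(N - m) h -
  -- δ`, so `hmass` bounds them by the mass of `μ0` entered by `m h - δ`, all of it captured by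
  -- instant `m` except the missed part, which costs `κ`.
  have hbc : ∀ m ≤ N + 1, ∑ i ∈ I with i.1 < m, b i ≤ c m + κ := by
    intro m hm
    rcases m with _ | m
    · simp only [not_lt_zero, Finset.filter_false, Finset.sum_empty]
      have : 0 ≤ c 0 := measureReal_nonneg
      linarith
    have hsub : ∀ i ∈ I.filter (fun i => i.1 < m + 1), i ∈ I := fun i hi => (Finset.mem_filter.1 hi).1
    calc ∑ i ∈ I with i.1 < m + 1, b i
        = (μ1 : Measure (E d)).real (⋃ i ∈ I.filter (fun i => i.1 < m + 1), Y i) :=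
          (measureReal_biUnion_finset
            (fun i hi j hj hij => hYd i (hsub i hi) j (hsub j hj) hij) (fun i _ => hYm i)).symm
      _ ≤ (μ1 : Measure (E d)).real {y | y ∈ (μ1 : Measure (E d)).support ∧
            N * h - m * h - δ ≤ entryTime (-v) ω y} := by
          refine measureReal_mono (iUnion₂_subset fun i hi x hx => ⟨hx.1.1.1, ?_⟩)
          have h1 : ((N - i.1 : ℕ) : ℝ) * h ≤ entryTime (-v) ω x + δ := hx.1.2.2
          rw [Nat.cast_sub (hIN i (hsub i hi))] at h1
          have h2 : (i.1 : ℝ) ≤ m := by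
            exact_mod_cast Nat.lt_succ_iff.1 (Finset.mem_filter.1 hi).2
          have h3 := mul_le_mul_of_nonneg_right h2 hh.le
          rw [sub_mul] at h1
          linarith
      _ ≤ forwardMass v ω μ0 (m * h - δ) := hmass m
      _ ≤ (μ0 : Measure (E d)).real (captured v U h (m + 1) ∪ missed v ω μ0 δ h e) := by
          refine measureReal_mono ?_
          rintro x ⟨hxs, hxt⟩
          by_cases hx : x ∈ missed v ω μ0 δ h e
          · exact Or.inr hx
          · left
            have : ∃ j : ℕ, j * h ≤ entryTime v ω x + δ ∧
                e < Metric.infDist (flow v (j * h) x) ωᶜ := by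
              by_contra hcon
              exact hx ⟨hxs, hcon⟩
            obtain ⟨j, hj, hjU⟩ := this
            refine ⟨j, ?_, (hmU _).2 hjU⟩
            have h1 : (j : ℝ) * h ≤ m * h := by linarith
            exact Nat.lt_succ_of_le (by exact_mod_cast le_of_mul_le_mul_right h1 hh)
      _ ≤ _ := (measureReal_union_le _ _).trans (by gcongr)
  obtain ⟨β, hβ, hβc, hβsum⟩ := exists_trim I Prod.fst (N := N + 1)
    (fun i hi => Nat.lt_succ_of_le (hIN i hi)) (fun i _ => measureReal_nonneg) hκ.le
    (fun m => measureReal_nonneg) hbc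
  have hbsum : ∑ i ∈ I, b i = (μ1 : Measure (E d)).real (⋃ i ∈ I, Y i) :=
    (measureReal_biUnion_finset (fun i hi j hj hij => hYd i hi j hj hij) (fun i _ => hYm i)).symm
  -- Almost every target point that the backward grid does not miss lies in a cell: its first grid
  -- sight of `U` fixes the level and its first covering ball fixes the second index.
  have hbtot : 1 - κ ≤ ∑ i ∈ I, b i := by
    have hm : MeasurableSet (⋃ i ∈ I, Y i) := Finset.measurableSet_biUnion _ fun i _ => hYm i
    have h1 := probReal_compl_eq_one_sub (μ := (μ1 : Measure (E d))) hm
    have h2 : (μ1 : Measure (E d)).real (⋃ i ∈ I, Y i)ᶜ ≤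
        (μ1 : Measure (E d)).real (missed (-v) ω μ1 δ h e) := by
      refine ENNReal.toReal_mono (measure_ne_top _ _) (measure_mono_ae ?_)
      filter_upwards [Measure.support_mem_ae, ae_all_iff.2 hgen, hent] with x hxs hxg hxe hxY
      by_contra hxm
      have : ∃ j : ℕ, j * h ≤ entryTime (-v) ω x + δ ∧
          e < Metric.infDist (flow (-v) (j * h) x) ωᶜ := by
        by_contra hcon
        exact hxm ⟨hxs, hcon⟩
      obtain ⟨j₀, hj₀, hj₀U⟩ := this
      have hex : ∃ j : ℕ, flow (-v) (j * h) x ∈ U := ⟨j₀, (hmU _).2 hj₀U⟩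
      have hle : Nat.find hex ≤ j₀ := Nat.find_min' hex ((hmU _).2 hj₀U)
      have hle' : ((Nat.find hex : ℕ) : ℝ) * h ≤ entryTime (-v) ω x + δ := by
        refine le_trans ?_ hj₀
        gcongr
      have hkN : Nat.find hex ≤ N := by
        exact_mod_cast le_of_mul_le_mul_right (hle'.trans hxe) hh
      have hexl : ∃ l, dist x (q l) < ε / 2 := by
        obtain ⟨l, -, hl⟩ := hqL x hxs
        exact ⟨l, hl⟩
      have hlL : Nat.find hexl < L := by
        obtain ⟨l, hlL, hl⟩ := hqL x hxs
        exact (Nat.find_min' hexl hl).trans_lt hlL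
      have hNk : N - (N - Nat.find hex) = Nat.find hex := by omega
      have hmem : x ∈ Y (N - Nat.find hex, Nat.find hexl) := by
        refine ⟨⟨⟨hxs, fun k _ => hxg k⟩, ⟨?_, ?_⟩, ?_⟩, Nat.find_spec hexl,
          fun l' hl' => Nat.find_min hexl hl'⟩
        · simp only [hNk]; exact Nat.find_spec hex
        · simp only [hNk]; exact fun k hk => Nat.find_min hex hk
        · simp only [hNk]; exact hle'
      refine hxY (mem_iUnion₂.2 ⟨_, Finset.mem_filter.2 ⟨Finset.mem_product.2
        ⟨Finset.mem_range.2 ?_, Finset.mem_range.2 hlL⟩, ⟨x, hmem⟩⟩, hmem⟩)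
      change N - Nat.find hex < N + 1
      omega
    rw [hbsum]
    linarith
  -- the radius of the release balls
  obtain ⟨ρ, hρ, hρ0⟩ : ∃ ρ : ℝ, (∀ i ∈ I, (∀ k ∈ Finset.range (N + 1), 1 ≤ k → i.1 + k ≤ N →
      Metric.ball (z i) ρ ⊆ {x | Metric.infDist (flow v (k * h) x) ωᶜ < e}) ∧
      Metric.ball (z i) ρ ⊆ {x | dist (flow v ((N - i.1 : ℕ) * h) x) (y i) < ε / 2}) ∧ 0 < ρ := by
    refine Eventually.exists (f := 𝓝[>] (0 : ℝ)) (Eventually.and ?_ self_mem_nhdsWithin)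
    rw [Filter.eventually_all_finset]
    intro i hi
    refine Eventually.and ?_ ?_
    · rw [Filter.eventually_all_finset]
      intro k _
      by_cases hk : 1 ≤ k ∧ i.1 + k ≤ N
      · refine (eventually_ball_subset (IsOpen.mem_nhds (isOpen_lt
          ((Metric.continuous_infDist_pt _).comp (hcV _)) continuous_const) ?_)).mono
          fun ρ hρ _ _ => hρ
        change Metric.infDist (flow v (k * h) (z i)) ωᶜ < e
        have h1 : flow v (k * h) (z i) = flow (-v) ((N - i.1 - k : ℕ) * h) (y i) :=
          hforth _ _ _ (by omega)
        rw [h1]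
        have h2 := (hyY i hi).1
        -- That the backward sight was the first gives only `≤ e`. The level `e` is generic, so the
        -- inequality is strict, hence open, and survives on a small release ball.
        refine lt_of_le_of_ne (not_lt.1 fun hcon => ?_) (h2.1.2 (N - i.1 - k) (by omega))
        exact h2.2.1.2 (N - i.1 - k) (by omega) ((hmU _).2 hcon)
      · exact Eventually.of_forall fun ρ h1 h2 => absurd ⟨h1, h2⟩ hk
    · refine eventually_ball_subset (IsOpen.mem_nhds (isOpen_lt ((hcV _).dist continuous_const)
        continuous_const) ?_)
      change dist (flow v ((N - i.1 : ℕ) * h) (z i)) (y i) < ε / 2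
      have h1 : flow v ((N - i.1 : ℕ) * h) (z i) = y i := by
        rw [hz]; simp only
        rw [hforth _ _ _ le_rfl]
        simp [hvn]
      rw [h1, dist_self]
      exact half_pos hε
  set D : Plan d (ℕ × ℕ) := ⟨v, ω, U, h, N, μ0, I, Prod.fst, z, β, ρ, p, ρ'⟩ with hD
  have hDf : D.Feasible :=
    { velocity := hv
      prob := inferInstanceAs (IsProbabilityMeasure (μ0 : Measure (E d)))
      ac := hμ0
      subset := hUω
      isOpen := hUo
      preconnected := hUc
      compl_nonempty := hUn
      h_pos := hh
      ρ_pos := hρ0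
      ρ'_pos := hρ'
      lev_le := hIN
      z_mem := fun i hi => (hyY i hi).1.2.1.1
      -- Equal level and equal release point give, after flowing forward, the same representative,
      -- hence the same cell.
      z_inj := by
        intro i hi j hj hij hzij
        by_contra hne
        have hij' : i.1 = j.1 := hij
        have hzij' : z i = z j := hzij
        have h1 : y i = y j := by
          have h2 := congrArg (flow v ((N - i.1 : ℕ) * h)) hzij'
          simp only [hz] at h2
          rw [hforth _ _ _ le_rfl, hij', hforth _ _ _ le_rfl] at h2
          simpa [hvn] using h2
        exact Set.disjoint_left.1 (hYd i hi j hj hne) (hyY i hi) (h1 ▸ hyY j hj)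
      β_nonneg := fun i hi => (hβ i hi).1
      avoid := by
        intro i hi k hk1 hk2 x hx hxU
        have hk3 : i.1 + k ≤ N := hk2
        have h1 := (hρ i hi).1 k (Finset.mem_range.2 (by omega)) hk1 hk3 hx
        exact lt_asymm ((hmU _).1 hxU) h1
      park := hpark
      drift := hdrift
      enough := hβc }
  obtain ⟨θ, hθ0, hθ1, hθ⟩ := exists_pow_ge hκ (N + 1)
  obtain ⟨Ψ, A, hΨ, hAm, hAd, hAmaps, hAmass⟩ := hDf.exists_transport hd hθ0 hθ1
  obtain ⟨η, hη, hst⟩ := hΨ (ε / 2) (half_pos hε)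
  have hNh : 0 < (N : ℝ) * h := mul_pos (by exact_mod_cast hN) hh
  obtain ⟨X, hX, hXΨ⟩ := hst (N * h) hNh (by simpa [hD] using hη)
  have hθle : θ ^ (N + 1) ≤ 1 := pow_le_one₀ hθ0.le hθ1.le
  refine ⟨X, hX, fun O => measureReal_le_of_transport I (γ := fun i => θ ^ (N + 1) * β i)
    (c := y) hAm (fun i _ => hYm i) hAd hYd hAmass (fun i hi => ?_) ?_ ?_ ?_ O⟩
  · exact (mul_le_of_le_one_left (hβ i hi).1 hθle).trans (hβ i hi).2
  · intro i hi x hx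
    obtain ⟨x', hx', hΨx⟩ := hAmaps i hi x hx
    have h1 : dist (flow v ((N - i.1 : ℕ) * h) x') (y i) < ε / 2 := (hρ i hi).2 hx'
    have h2 : Ψ x = flow v ((N - i.1 : ℕ) * h) x' := by
      rw [hΨx, Nat.cast_sub (hIN i hi)]
    rw [← h2] at h1
    linarith [dist_triangle (X x) (Ψ x) (y i), hXΨ x]
  · intro i hi x hx
    have h1 : dist x (q i.2) < ε / 2 := hx.2.1
    have h2 : dist (y i) (q i.2) < ε / 2 := (hyY i hi).2.1
    rw [dist_comm] at h2
    linarith [dist_triangle x (q i.2) (y i)]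
  -- The three losses `κ`: target points outside the cells, the trimming, and the factor `θ ^ (N +
  -- 1)`.
  · rw [← Finset.mul_sum]
    have h1 : ∑ i ∈ I, β i ≤ 1 := by
      refine (Finset.sum_le_sum fun i hi => (hβ i hi).2).trans ?_
      change ∑ i ∈ I, b i ≤ 1
      rw [hbsum]
      exact measureReal_le_one
    have h2 : 0 ≤ ∑ i ∈ I, β i := Finset.sum_nonneg fun i hi => (hβ i hi).1
    have h3 : ∑ i ∈ I, b i - κ ≤ ∑ i ∈ I, β i := hβsum
    nlinarith [mul_le_mul_of_nonneg_right hθ h2]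

/-- For each grid instant only countably many level sets have positive measure, and countably many
instants are considered. -/
theorem exists_generic_level {v : E d → E d} (hv : IsVelocity v) (ω : Set (E d))
    (μ : Measure (E d)) [IsFiniteMeasure μ] (h : ℝ) {a : ℝ} (ha : 0 < a) :
    ∃ e, 0 < e ∧ e < a ∧ ∀ k : ℕ, ∀ᵐ y ∂μ, Metric.infDist (flow v (k * h) y) ωᶜ ≠ e := by
  have hm : ∀ k : ℕ, Measurable fun y => Metric.infDist (flow v (k * h) y) ωᶜ := fun k => by
    obtain ⟨K, hK⟩ := hv.lipschitzWith_flow (k * h)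
    exact ((Metric.continuous_infDist_pt _).comp hK.continuous).measurable
  have hc : (⋃ k : ℕ, {t : ℝ | 0 < μ {y | Metric.infDist (flow v (k * h) y) ωᶜ = t}}).Countable :=
    countable_iUnion fun k => Measure.countable_meas_level_set_pos (hm k)
  obtain ⟨e, he, he0, hea⟩ := (hc.dense_compl ℝ).exists_between ha
  refine ⟨e, he0, hea, fun k => ?_⟩
  rw [ae_iff]
  simp only [not_not]
  by_contra hcon
  exact he (mem_iUnion.2 ⟨k, pos_iff_ne_zero.2 hcon⟩)

theorem exists_steers_near (hd : 0 < d) {v : E d → E d} (hv : IsVelocity v) {ω : Set (E d)}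
    (hω : IsOpen ω) (hωne : ω.Nonempty) (hωn : ωᶜ.Nonempty) {μ0 μ1 : ProbabilityMeasure (E d)}
    (hμ0 : IsCompact (μ0 : Measure (E d)).support)
    (hμ1 : IsCompact (μ1 : Measure (E d)).support) (hac : (μ0 : Measure (E d)) ≪ volume)
    (hgeo : GeometricCondition v ω μ0 μ1) {α : ℝ} (hα : 0 < α)
    (hconn : ∀ ε ∈ Ioo 0 α, IsPreconnected {x : E d | ε < Metric.infDist x ωᶜ})
    {T : ℝ} (hT : infimumTime v ω μ0 μ1 < T) {ε : ℝ} (hε : 0 < ε) :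
    ∃ X, Steers v ω T X ∧ ∀ O : Set (E d),
      (μ1 : Measure (E d)).real (Metric.thickening (2 * ε) Oᶜ)ᶜ ≤
        (μ0 : Measure (E d)).real (X ⁻¹' O) + 3 * ε := by
  have hvn := hv.neg
  have hg0 : ∀ x ∈ (μ0 : Measure (E d)).support, ∃ t, 0 ≤ t ∧ flow v t x ∈ ω := fun x hx => by
    obtain ⟨t, ht, h⟩ := hgeo.forward x hx
    exact ⟨t, ht.le, h⟩
  have hg1 : ∀ x ∈ (μ1 : Measure (E d)).support, ∃ t, 0 ≤ t ∧ flow (-v) t x ∈ ω := fun x hx => by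
    obtain ⟨t, ht, h⟩ := hgeo.backward x hx
    exact ⟨t, ht.le, by rwa [hv.flow_neg]⟩
  obtain ⟨C₀, hC₀, hb₀⟩ := exists_entryTime_bound hv hω hμ0 hg0
  obtain ⟨C₁, hC₁, hb₁⟩ := exists_entryTime_bound hvn hω hμ1 hg1
  have hF₀ := (forwardMass_eq_one hb₀).ge
  have hF₁ := (forwardMass_eq_one hb₁).ge
  rw [infimumTime, backwardMass_eq hv] at hT
  have hS0 := sSup_genInverse_nonneg hC₀ hC₁ hF₀ hF₁
  set S := sSup ((fun m : ℝ => genInverse (forwardMass v ω μ0) m +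
    genInverse (forwardMass (-v) ω μ1) (1 - m)) '' Icc (0 : ℝ) 1) with hS
  have hkey : ∀ T' > S, ∀ s, 1 ≤ forwardMass v ω μ0 s + forwardMass (-v) ω μ1 (T' - s) :=
    fun T' hT' s => one_le_add_of_sSup_lt (monotone_forwardMass _ _ _) (monotone_forwardMass _ _ _)
      (forwardMass_nonneg _ _ _) (forwardMass_nonneg _ _ _) hC₀ hC₁ hF₀ hF₁ hT' s
  have hT0 : 0 < T := hS0.trans_lt hT
  -- The mass inequality is used with total time `S + δ`; one `δ` is the delay of the forward grid,
  -- one that of the backward grid, and the last keeps the comparison strict.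
  set δ := (T - S) / 4 with hδ
  have hδ0 : 0 < δ := by rw [hδ]; linarith
  obtain ⟨-, M, hM⟩ := id hv
  have hM0 : 0 ≤ M := (norm_nonneg _).trans (hM 0)
  obtain ⟨p, hp⟩ := hωne
  have hp0 : 0 < Metric.infDist p ωᶜ :=
    (hω.isClosed_compl.notMem_iff_infDist_pos hωn).1 (by simpa using hp)
  set a := Metric.infDist p ωᶜ with ha
  -- `α` keeps the core connected, `a / 2` leaves room for the parking ball around `p`, and `1 / (n
  -- + 1)` makes the cores exhaust `ω`.
  have hlev : ∀ n : ℕ, ∃ e, 0 < e ∧ e < min (min α (a / 2)) (1 / (n + 1)) ∧ ∀ k : ℕ,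
      ∀ᵐ y ∂(μ1 : Measure (E d)), Metric.infDist (flow (-v) (k * (T / (n + 1))) y) ωᶜ ≠ e :=
    fun n => exists_generic_level hvn ω _ _ (by positivity)
  choose e he0 he1 he2 using hlev
  have he : Tendsto e atTop (𝓝 0) :=
    squeeze_zero (fun n => (he0 n).le) (fun n => ((he1 n).trans_le (min_le_right _ _)).le)
      tendsto_one_div_add_atTop_nhds_zero_nat
  have hh : Tendsto (fun n : ℕ => M * (T / ((n : ℝ) + 1))) atTop (𝓝 0) := by
    have := (tendsto_add_atTop_iff_nat 1).2 (tendsto_const_div_atTop_nhds_zero_nat T)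
    simpa using this.const_mul M
  obtain ⟨n, ⟨hn0, hn1⟩, hn2⟩ :=
    (((tendsto_measureReal_missed hv hω hωn μ0 hg0 hδ0 hT0 he).eventually (ge_mem_nhds hε)).and
    ((tendsto_measureReal_missed hvn hω hωn μ1 hg1 hδ0 hT0 he).eventually (ge_mem_nhds hε))).and
    (hh.eventually (ge_mem_nhds (show 0 < a / 4 by linarith))) |>.exists
  have hNh : ((n + 1 : ℕ) : ℝ) * (T / (n + 1)) = T := by
    push_cast; field_simp
  have heα := ((he1 n).trans_le (min_le_left _ _)).trans_le (min_le_left _ _)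
  have hea := ((he1 n).trans_le (min_le_left _ _)).trans_le (min_le_right _ _)
  have hcore : Metric.ball p (a / 2) ⊆ {x : E d | e n < Metric.infDist x ωᶜ} := by
    intro x hx
    have h1 : dist x p < a / 2 := hx
    have h2 := Metric.infDist_le_infDist_add_dist (s := ωᶜ) (x := p) (y := x)
    rw [dist_comm] at h2
    change e n < Metric.infDist x ωᶜ
    linarith
  have key := exists_steers_of_grid hd hv hω hωn hμ1 hac (N := n + 1) (h := T / (n + 1))
    (e := e n) (δ := δ) (κ := ε) (ε := ε) (ρ' := a / 4) (p := p) (U := _) n.succ_pos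
    (by positivity) (he0 n) hε hε (by linarith) rfl (hconn _ ⟨he0 n, heα⟩)
    ((Metric.ball_subset_ball (by linarith)).trans hcore) ?_ hn0 hn1 (he2 n) ?_ ?_
  · rwa [hNh] at key
  · intro y hy
    refine hcore ?_
    have h1 : dist y p < a / 4 := hy
    have h2 := hv.dist_flow_time_le hM y (T / (n + 1)) 0
    rw [hv.flow_zero, sub_zero, abs_of_nonneg (by positivity)] at h2
    change dist _ _ < a / 2
    linarith [dist_triangle (flow v (T / (n + 1)) y) y p]
  · rw [hNh]
    -- At the negative time `-δ` no mass has entered, so the inequality bounds the backward entry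
    -- times by `S + 2 * δ` almost everywhere.
    have h1 := hkey (S + δ) (by linarith) (-δ)
    have h2 : forwardMass v ω μ0 (-δ) = 0 := by
      have : {x | x ∈ (μ0 : Measure (E d)).support ∧ entryTime v ω x ≤ -δ} = ∅ := by
        ext x
        simp only [mem_ofPred_eq, mem_empty_iff_false, iff_false]
        exact fun h => by linarith [entryTime_nonneg v ω x, h.2]
      rw [forwardMass, this, measureReal_empty]
    have h3 := one_sub_forwardMass hvn hω μ1 (S + δ - -δ)
    have h4 : (μ1 : Measure (E d)).real {x | x ∈ (μ1 : Measure (E d)).support ∧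
        S + δ - -δ < entryTime (-v) ω x} = 0 := le_antisymm (by linarith) measureReal_nonneg
    rw [measureReal_eq_zero_iff] at h4
    filter_upwards [measure_eq_zero_iff_ae_notMem.1 h4, Measure.support_mem_ae] with y hy hys
    by_contra hcon
    exact hy ⟨hys, by linarith⟩
  · intro m
    rw [hNh]
    have h1 := hkey (S + δ) (by linarith) (m * (T / (n + 1)) - δ)
    have h2 := one_sub_forwardMass hvn hω μ1 (S + δ - (m * (T / (n + 1)) - δ))
    have h3 : (μ1 : Measure (E d)).real {y | y ∈ (μ1 : Measure (E d)).support ∧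
        T - m * (T / (n + 1)) - δ ≤ entryTime (-v) ω y} ≤
        (μ1 : Measure (E d)).real {y | y ∈ (μ1 : Measure (E d)).support ∧
        S + δ - (m * (T / (n + 1)) - δ) < entryTime (-v) ω y} :=
      measureReal_mono fun y hy => ⟨hy.1, by linarith [hy.2]⟩
    linarith

theorem approxControllable_of_infimumTime_lt (hd : 0 < d) {v : E d → E d} (hv : IsVelocity v)
    {ω : Set (E d)}
    (hω : IsOpen ω) (hωne : ω.Nonempty) (hωb : Bornology.IsBounded ω)
    {μ0 μ1 : ProbabilityMeasure (E d)}
    (hμ0 : IsCompact (μ0 : Measure (E d)).support)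
    (hμ1 : IsCompact (μ1 : Measure (E d)).support) (hac : (μ0 : Measure (E d)) ≪ volume)
    (hgeo : GeometricCondition v ω μ0 μ1) {α : ℝ} (hα : 0 < α)
    (hconn : ∀ ε ∈ Ioo 0 α, IsPreconnected {x : E d | ε < Metric.infDist x ωᶜ})
    {T : ℝ} (hT : infimumTime v ω μ0 μ1 < T) : ApproxControllable v ω μ0 μ1 T := by
  have hnt : Nontrivial (E d) := by
    have : Nonempty (Fin d) := ⟨⟨0, hd⟩⟩
    infer_instance
  -- With an empty complement `infDist` would be identically `0` and every core empty.
  have hωn : ωᶜ.Nonempty := by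
    rw [nonempty_compl]
    rintro rfl
    exact NormedSpace.unbounded_univ ℝ (E d) hωb
  have h : ∀ k : ℕ, _ := fun k => exists_steers_near hd hv hω hωne hωn hμ0 hμ1 hac hgeo hα hconn hT
    (ε := 1 / ((k : ℝ) + 1)) (by positivity)
  choose R hR hO using h
  choose u X hX hXR using hR
  refine ⟨u, fun k t => μ0.map (f := X k t)
    (((hX k).continuous.comp (Continuous.prodMk_right t)).aemeasurable),
    fun k => (hX k).admissible, fun k => (hX k).isSolution hv T μ0 hμ0, ?_⟩
  have hlim := tendsto_one_div_add_atTop_nhds_zero_nat (𝕜 := ℝ)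
  refine tendsto_of_measureReal_thickening_le (ε := fun k : ℕ => 2 * (1 / ((k : ℝ) + 1)))
    (κ := fun k : ℕ => 3 * (1 / ((k : ℝ) + 1))) (by simpa using hlim.const_mul 2)
    (by simpa using hlim.const_mul 3) fun k O hOo => ?_
  have hXm : Measurable (X k T) :=
    ((hX k).continuous.comp (Continuous.prodMk_right T)).measurable
  rw [ProbabilityMeasure.toMeasure_map, map_measureReal_apply hXm hOo.measurableSet, hXR]
  exact hO k O

/-! ### Mollification and a one-step estimate for weak solutions -/

/-- The convolution of `f` with a normalized bump function. -/
noncomputable def mollify (ρ : ContDiffBump (0 : E d)) (f : E d → ℝ) : E d → ℝ :=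
  convolution (ρ.normed volume) f (ContinuousLinearMap.lsmul ℝ ℝ) volume

theorem contDiff_mollify (ρ : ContDiffBump (0 : E d)) {f : E d → ℝ} (hf : Continuous f) :
    ContDiff ℝ (⊤ : ℕ∞) (mollify ρ f) :=
  ρ.hasCompactSupport_normed.contDiff_convolution_left _ ρ.contDiff_normed
    hf.locallyIntegrable

theorem hasCompactSupport_mollify (ρ : ContDiffBump (0 : E d)) {f : E d → ℝ}
    (hf : HasCompactSupport f) : HasCompactSupport (mollify ρ f) :=
  ρ.hasCompactSupport_normed.convolution _ hf

theorem dist_mollify_le (ρ : ContDiffBump (0 : E d)) {f : E d → ℝ} {N : NNReal}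
    (hf : LipschitzWith N f) (x : E d) : dist (mollify ρ f x) (f x) ≤ N * ρ.rOut := by
  refine ρ.dist_normed_convolution_le hf.continuous.aestronglyMeasurable fun y hy => ?_
  exact (hf.dist_le_mul y x).trans (mul_le_mul_of_nonneg_left (Metric.mem_ball.1 hy).le N.2)

/-- A pointwise comparison is averaged against a nonnegative weight of mass one; only shifts within
the radius of the bump count. -/
theorem mollify_le_add (ρ : ContDiffBump (0 : E d)) {f g : E d → ℝ} (hf : Continuous f)
    (hg : Continuous g) {x y : E d} {c : ℝ}
    (h : ∀ z : E d, ‖z‖ ≤ ρ.rOut → f (x - z) ≤ g (y - z) + c) :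
    mollify ρ f x ≤ mollify ρ g y + c := by
  have hint : ∀ {k : E d → ℝ} (_ : Continuous k) (x : E d),
      Integrable (fun z => ρ.normed volume z * k (x - z)) volume := fun hk x =>
    (ρ.continuous_normed.mul (hk.comp (continuous_const.sub continuous_id)))
      |>.integrable_of_hasCompactSupport (ρ.hasCompactSupport_normed.mul_right)
  have hc : c = ∫ z, ρ.normed volume z * c := by
    rw [integral_mul_const, ρ.integral_normed, one_mul]
  have hρi : Integrable (fun z => ρ.normed volume z * c) volume :=
    (ρ.integrable_normed).mul_const c
  simp only [mollify, convolution_def, ContinuousLinearMap.lsmul_apply, smul_eq_mul]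
  conv_rhs => rw [hc]
  rw [← integral_add (hint hg y) hρi]
  refine integral_mono (hint hf x) ((hint hg y).add hρi) fun z => ?_
  rw [← mul_add]
  by_cases hz : ‖z‖ ≤ ρ.rOut
  · exact mul_le_mul_of_nonneg_left (h z hz) (ρ.nonneg_normed z)
  · have : ρ.normed volume z = 0 := by
      rw [← Function.notMem_support, ρ.support_normed_eq]
      simpa using (not_le.1 hz).le
    simp [this]

/-- The derivative falls on the bump, so `G` is the `L¹` norm of its gradient. Taking `f = g` bounds
the variation of the gradient in space, taking `x = y` its change in time. -/
theorem exists_norm_fderiv_mollify_sub_le (ρ : ContDiffBump (0 : E d)) :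
    ∃ G : ℝ, 0 ≤ G ∧ ∀ (f g : E d → ℝ), Continuous f → Continuous g → ∀ (x y : E d) (c : ℝ),
      (∀ z, |f (x - z) - g (y - z)| ≤ c) →
      ‖fderiv ℝ (mollify ρ f) x - fderiv ℝ (mollify ρ g) y‖ ≤ G * c := by
  have hρ : ContDiff ℝ 1 (ρ.normed volume) := ρ.contDiff_normed
  have hcs := ρ.hasCompactSupport_normed (μ := volume)
  have hcd : Continuous (fderiv ℝ (ρ.normed volume)) := hρ.continuous_fderiv (by simp)
  have hcs' : HasCompactSupport (fderiv ℝ (ρ.normed volume)) := hcs.fderiv (𝕜 := ℝ)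
  refine ⟨∫ z, ‖fderiv ℝ (ρ.normed volume) z‖, integral_nonneg fun _ => norm_nonneg _,
    fun f g hf hg x y c h => ?_⟩
  have key : ∀ {k : E d → ℝ} (_ : Continuous k) (x : E d),
      fderiv ℝ (mollify ρ k) x = ∫ z, k (x - z) • fderiv ℝ (ρ.normed volume) z := by
    intro k hk x
    rw [mollify, (hcs.hasFDerivAt_convolution_left _ hρ hk.locallyIntegrable x).fderiv,
      convolution_def]
    refine integral_congr_ae (ae_of_all _ fun z => ?_)
    ext u
    simp [ContinuousLinearMap.precompL_apply, mul_comm]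
  have hint : ∀ {k : E d → ℝ} (_ : Continuous k) (x : E d),
      Integrable (fun z => k (x - z) • fderiv ℝ (ρ.normed volume) z) volume := fun hk x =>
    ((hk.comp (continuous_const.sub continuous_id)).smul hcd).integrable_of_hasCompactSupport
      hcs'.smul_left
  rw [key hf, key hg, ← integral_sub (hint hf x) (hint hg y), ← integral_mul_const]
  refine norm_integral_le_of_norm_le
    ((hcd.norm.integrable_of_hasCompactSupport hcs'.norm).mul_const c) (ae_of_all _ fun z => ?_)
  rw [← sub_smul, norm_smul, mul_comm]
  exact mul_le_mul_of_nonneg_left (h z) (norm_nonneg _)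

theorem abs_sub_sub_fderiv_le {φ : E d → ℝ} (hφ : Differentiable ℝ φ) {C : ℝ} (hC0 : 0 ≤ C)
    (hC : ∀ x y, ‖fderiv ℝ φ x - fderiv ℝ φ y‖ ≤ C * ‖x - y‖) (x y : E d) :
    |φ (x + y) - φ x - fderiv ℝ φ x y| ≤ C * ‖y‖ ^ 2 := by
  have := Convex.norm_image_sub_le_of_norm_fderiv_le' (f := φ) (C := C * ‖y‖)
    (s := Metric.closedBall x ‖y‖) (x := x) (y := x + y) (φ := fderiv ℝ φ x) (𝕜 := ℝ)
    (fun z _ => hφ z) (fun z hz => (hC z x).trans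
      (mul_le_mul_of_nonneg_left (by simpa [dist_eq_norm] using hz) hC0))
    (convex_closedBall _ _) (by simp) (by simp [dist_eq_norm])
  simpa [Real.norm_eq_abs, pow_two, mul_assoc] using this

/-- `μ` solves `∂ₜμ + ∇·(w μ) = 0` weakly on `[0, b]`. -/
structure IsWeakCurve (w : ℝ → E d → E d) (b : ℝ) (μ : ℝ → ProbabilityMeasure (E d)) : Prop where
  integrable : ∀ φ : E d → ℝ, ContDiff ℝ (⊤ : ℕ∞) φ → HasCompactSupport φ →
    ∀ s t, 0 ≤ s → s ≤ t → t ≤ b →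
    IntervalIntegrable (fun s => ∫ x, fderiv ℝ φ x (w s x) ∂(μ s : Measure (E d))) volume s t
  weak : ∀ φ : E d → ℝ, ContDiff ℝ (⊤ : ℕ∞) φ → HasCompactSupport φ →
    ∀ s t, 0 ≤ s → s ≤ t → t ≤ b →
    ∫ x, φ x ∂(μ t : Measure (E d)) - ∫ x, φ x ∂(μ s : Measure (E d)) =
      ∫ r in s..t, ∫ x, fderiv ℝ φ x (w r x) ∂(μ r : Measure (E d))

theorem IsSolution.isWeakCurve {w : ℝ → E d → E d} {T : ℝ} {μ0 : ProbabilityMeasure (E d)}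
    {μ : ℝ → ProbabilityMeasure (E d)} (h : IsSolution w T μ0 μ) : IsWeakCurve w T μ := by
  have hint : ∀ φ : E d → ℝ, ContDiff ℝ (⊤ : ℕ∞) φ → HasCompactSupport φ →
      ∀ s t, 0 ≤ s → s ≤ t → t ≤ T → IntervalIntegrable
        (fun s => ∫ x, fderiv ℝ φ x (w s x) ∂(μ s : Measure (E d))) volume s t := by
    intro φ hφ hc s t hs hst ht
    refine (h.integrable φ hφ hc).mono_set ?_
    rw [uIcc_of_le hst, uIcc_of_le (hs.trans (hst.trans ht))]
    exact Icc_subset_Icc hs ht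
  refine ⟨hint, fun φ hφ hc s t hs hst ht => ?_⟩
  have h1 := h.weak φ hφ hc s ⟨hs, hst.trans ht⟩
  have h2 := h.weak φ hφ hc t ⟨hs.trans hst, ht⟩
  have h3 := intervalIntegral.integral_add_adjacent_intervals
    (hint φ hφ hc 0 s le_rfl hs (hst.trans ht)) (hint φ hφ hc s t hs hst ht)
  linarith

theorem IsWeakCurve.mono {w : ℝ → E d → E d} {b b' : ℝ} {μ : ℝ → ProbabilityMeasure (E d)}
    (h : IsWeakCurve w b μ) (hb : b' ≤ b) : IsWeakCurve w b' μ :=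
  ⟨fun φ hφ hc s t hs hst ht => h.integrable φ hφ hc s t hs hst (ht.trans hb),
    fun φ hφ hc s t hs hst ht => h.weak φ hφ hc s t hs hst (ht.trans hb)⟩

/-- It lets the forward transport estimate be applied to mass found at the final time. -/
theorem IsWeakCurve.reverse {w : ℝ → E d → E d} {b : ℝ} {μ : ℝ → ProbabilityMeasure (E d)}
    (h : IsWeakCurve w b μ) :
    IsWeakCurve (fun t x => -w (b - t) x) b fun t => μ (b - t) := by
  refine ⟨fun φ hφ hc s t hs hst ht => ?_, fun φ hφ hc s t hs hst ht => ?_⟩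
  · have := ((h.integrable φ hφ hc (b - t) (b - s) (by linarith) (by linarith)
      (by linarith)).comp_sub_left b).neg.symm
    simpa [integral_neg, Pi.neg_def] using this
  · have h1 := h.weak φ hφ hc (b - t) (b - s) (by linarith) (by linarith) (by linarith)
    have h2 := intervalIntegral.integral_comp_sub_left (a := s) (b := t)
      (fun r => ∫ x, fderiv ℝ φ x (w r x) ∂(μ r : Measure (E d))) b
    simp only [map_neg, integral_neg, intervalIntegral.integral_neg]
    linarith

/-- `f` and `g` are the test functions at the two ends of the step. At each `τ` the Euler comparison
`hc` and a Taylor expansion bound `f - g` by `(t - s) ∇g · w τ` up to a small error; integrating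
against `μ τ` bounds from below the rate at which `∫ g` grows. No regularity of `w` in time is
needed, since each `τ` is treated separately. -/
theorem IsWeakCurve.integral_step_le {w : ℝ → E d → E d} {b : ℝ}
    {μ : ℝ → ProbabilityMeasure (E d)} (hμ : IsWeakCurve w b μ) {M : ℝ}
    (hM : ∀ t x, ‖w t x‖ ≤ M) (hw : ∀ t, Continuous (w t)) {s t : ℝ} (hs : 0 ≤ s) (hst : s < t)
    (ht : t ≤ b) {f g : E d → ℝ} (hf : ContDiff ℝ (⊤ : ℕ∞) f) (hfc : HasCompactSupport f)
    (hg : ContDiff ℝ (⊤ : ℕ∞) g) (hgc : HasCompactSupport g) {C η c : ℝ} (hC0 : 0 ≤ C)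
    (hη0 : 0 ≤ η)
    (hC : ∀ x y, ‖fderiv ℝ g x - fderiv ℝ g y‖ ≤ C * ‖x - y‖)
    (hη : ∀ x, ‖fderiv ℝ g x - fderiv ℝ f x‖ ≤ η)
    (hc : ∀ τ x, f x ≤ g (x + (t - s) • w τ x) + c) :
    ∫ x, f x ∂(μ s : Measure (E d)) - (η * M * (t - s) + C * M ^ 2 * (t - s) ^ 2 + c) ≤
      ∫ x, g x ∂(μ t : Measure (E d)) := by
  have hM0 : 0 ≤ M := (norm_nonneg _).trans (hM 0 0)
  have hh : 0 < t - s := sub_pos.2 hst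
  have hq : ContDiff ℝ (⊤ : ℕ∞) (g - f) := hg.sub hf
  have hqc : HasCompactSupport (g - f) := hgc.sub hfc
  have hdq : ∀ x, fderiv ℝ (g - f) x = fderiv ℝ g x - fderiv ℝ f x := fun x =>
    fderiv_sub (hg.differentiable (by simp) x) (hf.differentiable (by simp) x)
  have hint : ∀ {k : E d → ℝ}, ContDiff ℝ (⊤ : ℕ∞) k → HasCompactSupport k → ∀ τ,
      Integrable k (μ τ : Measure (E d)) := fun hk hkc τ =>
    hk.continuous.integrable_of_hasCompactSupport hkc
  have hintd : ∀ τ, Integrable (fun x => fderiv ℝ g x (w τ x)) (μ τ : Measure (E d)) := by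
    intro τ
    refine Continuous.integrable_of_hasCompactSupport
      ((hg.continuous_fderiv (by simp)).clm_apply (hw τ)) ?_
    refine (hgc.fderiv (𝕜 := ℝ)).mono fun x hx hx' => hx ?_
    simp [hx']
  have hqs : ∀ τ ∈ Icc s t, ∫ x, (g - f) x ∂(μ τ : Measure (E d)) -
      ∫ x, (g - f) x ∂(μ s : Measure (E d)) ≤ η * M * (t - s) := by
    intro τ hτ
    rw [hμ.weak (g - f) hq hqc s τ hs hτ.1 (hτ.2.trans ht)]
    have h1 : ∀ r, ‖∫ x, fderiv ℝ (g - f) x (w r x) ∂(μ r : Measure (E d))‖ ≤ η * M := by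
      intro r
      refine (norm_integral_le_of_norm_le_const (C := η * M) (ae_of_all _ fun x => ?_)).trans
        (by simp)
      rw [hdq]
      exact (ContinuousLinearMap.le_opNorm _ _).trans
        (mul_le_mul (hη x) (hM r x) (norm_nonneg _) hη0)
    have h2 := intervalIntegral.norm_integral_le_of_norm_le_const (a := s) (b := τ)
      (fun r _ => h1 r)
    rw [abs_of_nonneg (sub_nonneg.2 hτ.1)] at h2
    exact (le_abs_self _).trans (h2.trans (mul_le_mul_of_nonneg_left
      (sub_le_sub_right hτ.2 s) (by positivity)))
  set D : ℝ := ∫ x, (g - f) x ∂(μ s : Measure (E d)) + η * M * (t - s) +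
    C * M ^ 2 * (t - s) ^ 2 + c with hD
  -- `hqs` replaces `∫ (g - f)` at time `τ` by its value at time `s`, so the lower bound no longer
  -- depends on `τ` and can be integrated.
  have hJ : ∀ τ ∈ Icc s t, -D / (t - s) ≤ ∫ x, fderiv ℝ g x (w τ x) ∂(μ τ : Measure (E d)) := by
    intro τ hτ
    rw [div_le_iff₀' hh, ← integral_const_mul]
    have h1 : ∫ _, -(C * M ^ 2 * (t - s) ^ 2 + c) ∂(μ τ : Measure (E d)) ≤
        ∫ x, ((g - f) x + (t - s) * fderiv ℝ g x (w τ x)) ∂(μ τ : Measure (E d)) := by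
      refine integral_mono (integrable_const _) ((hint hq hqc τ).add ((hintd τ).const_mul _))
        fun x => ?_
      have h2 := abs_sub_sub_fderiv_le (hg.differentiable (by simp)) hC0 hC x ((t - s) • w τ x)
      rw [map_smul, smul_eq_mul, norm_smul, Real.norm_of_nonneg hh.le] at h2
      have h3 := hc τ x
      have h4 : C * ((t - s) * ‖w τ x‖) ^ 2 ≤ C * M ^ 2 * (t - s) ^ 2 := by
        rw [mul_pow, mul_assoc, mul_comm (M ^ 2)]
        have := hM τ x
        gcongr
      have h5 := (abs_le.1 h2).2
      simp only [Pi.sub_apply]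
      linarith
    rw [integral_const, integral_add (hint hq hqc τ) ((hintd τ).const_mul _)] at h1
    simp only [probReal_univ, one_smul] at h1
    have := hqs τ hτ
    linarith
  have h1 := intervalIntegral.integral_mono_on hst.le intervalIntegrable_const
    (hμ.integrable g hg hgc s t hs hst.le ht) hJ
  rw [← hμ.weak g hg hgc s t hs hst.le ht, intervalIntegral.integral_const, smul_eq_mul,
    mul_div_cancel₀ _ hh.ne'] at h1
  have h2 : ∫ x, (g - f) x ∂(μ s : Measure (E d)) = ∫ x, g x ∂(μ s : Measure (E d)) -
      ∫ x, f x ∂(μ s : Measure (E d)) := integral_sub (hint hg hgc s) (hint hf hfc s)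
  linarith

/-! ### Free transport of mass by weak solutions -/

theorem IsVelocity.norm_flow_sub_le {v : E d → E d} (hv : IsVelocity v) {L : NNReal}
    (hL : LipschitzWith L v) {M : ℝ} (hM : ∀ x, ‖v x‖ ≤ M) {h : ℝ} (hh : 0 ≤ h) (x : E d) :
    ‖flow v h x - (x + h • v x)‖ ≤ L * M * h ^ 2 := by
  have hder : ∀ r, HasDerivAt (fun r => flow v r x - r • v x) (v (flow v r x) - v x) r :=
    fun r => by
      simpa using (hv.hasDerivAt_flow x r).fun_sub ((hasDerivAt_id r).smul_const (v x))
  have := Convex.norm_image_sub_le_of_norm_hasDerivWithin_le (C := L * M * h) (s := Icc 0 h)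
    (x := 0) (y := h) (fun r _ => (hder r).hasDerivWithinAt) (fun r hr => ?_) (convex_Icc 0 h)
    ⟨le_rfl, hh⟩ ⟨hh, le_rfl⟩
  · rw [hv.flow_zero] at this
    simp only [zero_smul, sub_zero, Real.norm_of_nonneg hh] at this
    rw [← sub_sub, sub_right_comm]
    simpa [pow_two, mul_assoc] using this
  · have h1 := hv.dist_flow_time_le hM x r 0
    rw [hv.flow_zero, sub_zero, abs_of_nonneg hr.1] at h1
    have hM0 : 0 ≤ M := (norm_nonneg _).trans (hM 0)
    rw [← dist_eq_norm, mul_assoc]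
    exact (hL.dist_le_mul _ _).trans (mul_le_mul_of_nonneg_left
      (h1.trans (mul_le_mul_of_nonneg_left hr.2 hM0)) L.2)

/-- A bump of height one around the image of `K` under the flow at time `t`, whose slope decreases
at the exponential rate `L`. -/
noncomputable def tube (v : E d → E d) (K : Set (E d)) (L N : NNReal) (t : ℝ) (x : E d) : ℝ :=
  max 0 (1 - N * Real.exp (-(L * t)) * Metric.infDist x (flow v t '' K))

section tube

variable {v : E d → E d} {K : Set (E d)} {L N : NNReal} {t : ℝ}

theorem tube_nonneg (x : E d) : 0 ≤ tube v K L N t x := le_max_left _ _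

theorem tube_eq_one {x : E d} (hx : x ∈ flow v t '' K) : tube v K L N t x = 1 := by
  simp [tube, Metric.infDist_zero_of_mem hx]

theorem tube_le_one (x : E d) : tube v K L N t x ≤ 1 :=
  max_le zero_le_one (sub_le_self _ (mul_nonneg (by positivity) Metric.infDist_nonneg))

theorem tube_eq_zero (hN : 0 < N) {x : E d} (hK : K.Nonempty)
    (hx : x ∉ Metric.cthickening (Real.exp (L * t) / N) (flow v t '' K)) :
    tube v K L N t x = 0 := by
  have hN' : (0 : ℝ) < N := hN
  have h1 : Real.exp (L * t) / N < Metric.infDist x (flow v t '' K) := by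
    by_contra h
    refine hx (Metric.mem_cthickening_iff.2 ?_)
    rw [ENNReal.le_ofReal_iff_toReal_le (Metric.infEDist_ne_top (hK.image _)) (by positivity)]
    exact not_lt.1 h
  refine max_eq_left ?_
  rw [div_lt_iff₀' hN'] at h1
  have h2 : Real.exp (-(L * t)) * Real.exp (L * t) = 1 := by rw [← Real.exp_add]; simp
  have h3 := mul_lt_mul_of_pos_left h1 (Real.exp_pos (-(L * t)))
  rw [h2] at h3
  linarith

theorem exp_neg_le_one (ht : 0 ≤ t) : Real.exp (-(L * t)) ≤ 1 :=
  Real.exp_le_one_iff.2 (neg_nonpos.2 (mul_nonneg L.2 ht))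

theorem lipschitzWith_tube (ht : 0 ≤ t) : LipschitzWith N (tube v K L N t) := by
  refine LipschitzWith.of_dist_le_mul fun x y => ?_
  rw [tube, tube, Real.dist_eq]
  refine (abs_max_sub_max_le_max _ _ _ _).trans ?_
  rw [sub_self, abs_zero, max_eq_right (abs_nonneg _), sub_sub_sub_cancel_left, ← mul_sub,
    abs_mul, abs_of_nonneg (by positivity : (0 : ℝ) ≤ N * Real.exp (-(L * t))), mul_assoc]
  have h1 := (Metric.lipschitz_infDist_pt (flow v t '' K)).dist_le_mul y x
  rw [NNReal.coe_one, one_mul, Real.dist_eq, dist_comm] at h1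
  refine mul_le_mul_of_nonneg_left ?_ N.2
  calc Real.exp (-(L * t)) * _ ≤ 1 * dist x y :=
        mul_le_mul (exp_neg_le_one ht) h1 (abs_nonneg _) zero_le_one
    _ = dist x y := one_mul _

theorem hasCompactSupport_tube (hv : IsVelocity v) (hN : 0 < N) (hK : IsCompact K)
    (hKne : K.Nonempty) : HasCompactSupport (tube v K L N t) := by
  obtain ⟨Λ, hΛ⟩ := hv.lipschitzWith_flow t
  exact HasCompactSupport.intro (hK.image hΛ.continuous).cthickening
    fun x hx => tube_eq_zero hN hKne hx

/-- Since `w` agrees with `v` on the moving set and is `L`-Lipschitz, an Euler step multiplies the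
distance to that set by at most `1 + L h`, up to the second-order error of Euler's scheme for `v`.
The decay `exp (-L h)` of the slope absorbs the factor. -/
theorem tube_le_tube_step (hv : IsVelocity v) (hL : LipschitzWith L v) {M : ℝ}
    (hM : ∀ x, ‖v x‖ ≤ M) (hK : IsCompact K) (hKne : K.Nonempty) {w : E d → E d}
    (hw : LipschitzWith L w) (hwv : ∀ a ∈ flow v t '' K, w a = v a) (ht : 0 ≤ t) {h : ℝ}
    (hh : 0 ≤ h) (x : E d) :
    tube v K L N t x ≤ tube v K L N (t + h) (x + h • w x) + N * (L * M * h ^ 2) := by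
  have hM0 : 0 ≤ M := (norm_nonneg _).trans (hM 0)
  obtain ⟨Λ, hΛ⟩ := hv.lipschitzWith_flow t
  obtain ⟨a, ha, hxa⟩ := (hK.image hΛ.continuous).exists_infDist_eq_dist (hKne.image _) x
  have hmem : flow v h a ∈ flow v (t + h) '' K := by
    obtain ⟨k, hk, rfl⟩ := ha
    exact ⟨k, hk, by rw [add_comm, hv.flow_add]⟩
  have h1 : Metric.infDist (x + h • w x) (flow v (t + h) '' K) ≤
      (1 + L * h) * Metric.infDist x (flow v t '' K) + L * M * h ^ 2 := by
    refine (Metric.infDist_le_dist_of_mem hmem).trans ?_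
    rw [hxa, dist_eq_norm, dist_eq_norm]
    have h2 : x + h • w x - flow v h a = (x - a) + h • (w x - w a) -
        (flow v h a - (a + h • v a)) := by
      rw [hwv a ha, smul_sub]
      abel
    rw [h2]
    have h3 : ‖h • (w x - w a)‖ ≤ h * (L * ‖x - a‖) := by
      rw [norm_smul, Real.norm_of_nonneg hh]
      exact mul_le_mul_of_nonneg_left (hw.norm_sub_le x a) hh
    have h4 := hv.norm_flow_sub_le hL hM hh a
    have h5 := norm_sub_le ((x - a) + h • (w x - w a)) (flow v h a - (a + h • v a))
    have h6 := norm_add_le (x - a) (h • (w x - w a))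
    linarith
  have h7 : Real.exp (-(L * (t + h))) * (1 + L * h) ≤ Real.exp (-(L * t)) := by
    have h8 : Real.exp (-(L * t)) = Real.exp (-(L * (t + h))) * Real.exp (L * h) := by
      rw [← Real.exp_add]; ring_nf
    rw [h8]
    refine mul_le_mul_of_nonneg_left ?_ (Real.exp_pos _).le
    linarith [Real.add_one_le_exp ((L : ℝ) * h)]
  have h9 : Real.exp (-(L * (t + h))) * Metric.infDist (x + h • w x) (flow v (t + h) '' K) ≤
      Real.exp (-(L * t)) * Metric.infDist x (flow v t '' K) + L * M * h ^ 2 := by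
    calc _ ≤ Real.exp (-(L * (t + h))) *
          ((1 + L * h) * Metric.infDist x (flow v t '' K) + L * M * h ^ 2) :=
          mul_le_mul_of_nonneg_left h1 (Real.exp_pos _).le
      _ = Real.exp (-(L * (t + h))) * (1 + L * h) * Metric.infDist x (flow v t '' K) +
          Real.exp (-(L * (t + h))) * (L * M * h ^ 2) := by ring
      _ ≤ Real.exp (-(L * t)) * Metric.infDist x (flow v t '' K) + 1 * (L * M * h ^ 2) :=
          add_le_add (mul_le_mul_of_nonneg_right h7 Metric.infDist_nonneg)
            (mul_le_mul_of_nonneg_right (exp_neg_le_one (by linarith)) (by positivity))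
      _ = _ := by ring
  have h10 := mul_le_mul_of_nonneg_left h9 N.2
  simp only [NNReal.val_eq_coe] at h10
  refine max_le (add_nonneg (tube_nonneg _) (by positivity)) ?_
  have h11 : 1 - N * Real.exp (-(L * (t + h))) *
      Metric.infDist (x + h • w x) (flow v (t + h) '' K) ≤
      tube v K L N (t + h) (x + h • w x) := le_max_right _ _
  rw [mul_assoc] at h11 ⊢
  linarith

theorem infDist_flow_le (hv : IsVelocity v) {M : ℝ} (hM : ∀ x, ‖v x‖ ≤ M) (hK : IsCompact K)
    (hKne : K.Nonempty) (s : ℝ) (x : E d) :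
    Metric.infDist x (flow v s '' K) ≤ Metric.infDist x (flow v t '' K) + M * |s - t| := by
  obtain ⟨Λ, hΛ⟩ := hv.lipschitzWith_flow t
  obtain ⟨a, ⟨k, hk, rfl⟩, hxa⟩ :=
    (hK.image hΛ.continuous).exists_infDist_eq_dist (hKne.image _) x
  refine (Metric.infDist_le_dist_of_mem (mem_image_of_mem _ hk)).trans ?_
  rw [hxa]
  have := hv.dist_flow_time_le hM k s t
  rw [dist_comm] at this
  exact (dist_triangle x _ _).trans (add_le_add_right this _)

/-- The first term is the motion of the set, the second the change of slope. The latter needs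
control only where the later bump is positive, that is, where the scaled distance is below one. -/
theorem abs_tube_sub_le (hv : IsVelocity v) {M : ℝ} (hM : ∀ x, ‖v x‖ ≤ M) (hK : IsCompact K)
    (hKne : K.Nonempty) (ht : 0 ≤ t) {h : ℝ} (hh : 0 ≤ h) (x : E d) :
    |tube v K L N (t + h) x - tube v K L N t x| ≤ N * M * h + (Real.exp (L * h) - 1) := by
  have hM0 : 0 ≤ M := (norm_nonneg _).trans (hM 0)
  have hL0 : (0 : ℝ) ≤ L := L.2
  have hN0 : (0 : ℝ) ≤ N := N.2
  have h1 := infDist_flow_le (t := t) hv hM hK hKne (t + h) x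
  have h2 := infDist_flow_le (t := t + h) hv hM hK hKne t x
  rw [add_sub_cancel_left, abs_of_nonneg hh] at h1
  rw [sub_add_cancel_left, abs_neg, abs_of_nonneg hh] at h2
  have hq : 0 ≤ Metric.infDist x (flow v t '' K) := Metric.infDist_nonneg
  have hq' : 0 ≤ Metric.infDist x (flow v (t + h) '' K) := Metric.infDist_nonneg
  have hp : N * Real.exp (-(L * t)) = N * Real.exp (-(L * (t + h))) * Real.exp (L * h) := by
    rw [mul_assoc, ← Real.exp_add]; ring_nf
  have he : 1 ≤ Real.exp (L * h) := Real.one_le_exp (mul_nonneg hL0 hh)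
  have hpN : N * Real.exp (-(L * t)) ≤ N :=
    mul_le_of_le_one_right hN0 (exp_neg_le_one ht)
  have hp'N : N * Real.exp (-(L * (t + h))) ≤ N :=
    mul_le_of_le_one_right hN0 (exp_neg_le_one (by linarith))
  have hp'0 : 0 ≤ N * Real.exp (-(L * (t + h))) := by positivity
  have hp0 : 0 ≤ N * Real.exp (-(L * t)) := by positivity
  simp only [tube]
  generalize Metric.infDist x (flow v t '' K) = q at *
  generalize Metric.infDist x (flow v (t + h) '' K) = q' at *
  generalize (N : ℝ) * Real.exp (-(L * t)) = p at *
  generalize (N : ℝ) * Real.exp (-(L * (t + h))) = p' at *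
  generalize Real.exp (L * h) = e at *
  have hMh : 0 ≤ M * h := mul_nonneg hM0 hh
  have hNMh : 0 ≤ N * M * h := by positivity
  have hpp : p' ≤ p := by rw [hp]; exact le_mul_of_one_le_right hp'0 he
  have hlow : p' * q' ≤ p * q + N * M * h := by
    calc p' * q' ≤ p' * (q + M * h) := mul_le_mul_of_nonneg_left h1 hp'0
      _ = p' * q + p' * (M * h) := mul_add _ _ _
      _ ≤ p * q + N * (M * h) := add_le_add (mul_le_mul_of_nonneg_right hpp hq)
          (mul_le_mul_of_nonneg_right hp'N hMh)
      _ = _ := by ring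
  have hup : p * q ≤ p * q' + N * M * h := by
    calc p * q ≤ p * (q' + M * h) := mul_le_mul_of_nonneg_left h2 hp0
      _ = p * q' + p * (M * h) := mul_add _ _ _
      _ ≤ p * q' + N * (M * h) := by gcongr
      _ = _ := by ring
  rw [abs_le]
  constructor
  · have : max 0 (1 - p * q) ≤ max 0 (1 - p' * q') + N * M * h :=
      max_le (add_nonneg (le_max_left _ _) hNMh)
        (by linarith [le_max_right 0 (1 - p' * q')])
    linarith
  · have : max 0 (1 - p' * q') ≤ max 0 (1 - p * q) + N * M * h + (e - 1) := by
      refine max_le (by linarith [le_max_left 0 (1 - p * q)]) ?_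
      rcases le_or_gt 1 (p' * q') with h3 | h3
      · linarith [le_max_left 0 (1 - p * q)]
      · have h4 : p * q' - p' * q' ≤ e - 1 := by
          calc p * q' - p' * q' = (e - 1) * (p' * q') := by rw [hp]; ring
            _ ≤ (e - 1) * 1 := mul_le_mul_of_nonneg_left h3.le (by linarith)
            _ = e - 1 := mul_one _
        linarith [le_max_right 0 (1 - p * q)]
    linarith

end tube

/-- Mollify at radius `δ` and apply the one-step estimate on a uniform subdivision. A step of length
`h` loses `h (o(1) + N L δ)`, so refining leaves `b N L δ`. Removing the mollification costs `N δ`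
at each end, and then `δ → 0`. -/
theorem IsWeakCurve.integral_tube_le {w : ℝ → E d → E d} {b : ℝ} (hb : 0 ≤ b)
    {μ : ℝ → ProbabilityMeasure (E d)} (hμ : IsWeakCurve w b μ) {M : ℝ}
    (hM : ∀ t x, ‖w t x‖ ≤ M) {L N : NNReal} (hw : ∀ t, LipschitzWith L (w t))
    {v : E d → E d} (hv : IsVelocity v) (hL : LipschitzWith L v) (hvM : ∀ x, ‖v x‖ ≤ M)
    {K : Set (E d)} (hK : IsCompact K) (hKne : K.Nonempty)
    (hwv : ∀ τ, ∀ t ∈ Icc 0 b, ∀ a ∈ flow v t '' K, w τ a = v a) (hN : 0 < N) :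
    ∫ x, tube v K L N 0 x ∂(μ 0 : Measure (E d)) ≤
      ∫ x, tube v K L N b x ∂(μ b : Measure (E d)) := by
  have hM0 : 0 ≤ M := (norm_nonneg _).trans (hvM 0)
  have hN0 : (0 : ℝ) ≤ N := N.2
  have hL0 : (0 : ℝ) ≤ L := L.2
  suffices hδ : ∀ δ : ℝ, 0 < δ → ∫ x, tube v K L N 0 x ∂(μ 0 : Measure (E d)) -
      (2 * N + b * (N * L)) * δ ≤ ∫ x, tube v K L N b x ∂(μ b : Measure (E d)) by
    have hlim : Tendsto (fun δ : ℝ => ∫ x, tube v K L N 0 x ∂(μ 0 : Measure (E d)) -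
        (2 * N + b * (N * L)) * δ) (𝓝[>] 0)
        (𝓝 (∫ x, tube v K L N 0 x ∂(μ 0 : Measure (E d)) - (2 * N + b * (N * L)) * 0)) :=
      ((continuous_const.sub (continuous_const.mul continuous_id)).tendsto 0).mono_left
        nhdsWithin_le_nhds
    rw [mul_zero, sub_zero] at hlim
    exact le_of_tendsto hlim (eventually_mem_nhdsWithin.mono hδ)
  intro δ hδ
  set ρ : ContDiffBump (0 : E d) := ⟨δ / 2, δ, by linarith, by linarith⟩
  have hρ : ρ.rOut = δ := rfl
  obtain ⟨G, hG0, hG⟩ := exists_norm_fderiv_mollify_sub_le ρ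
  have hc : ∀ t, 0 ≤ t → Continuous (tube v K L N t) := fun t ht => (lipschitzWith_tube ht).continuous
  have hstep : ∀ t h : ℝ, 0 ≤ t → 0 < h → t + h ≤ b →
      ∫ x, mollify ρ (tube v K L N t) x ∂(μ t : Measure (E d)) -
        h * (G * (N * M * h + (Real.exp (L * h) - 1)) * M + G * N * M ^ 2 * h +
          N * (L * M * h) + N * L * δ) ≤
      ∫ x, mollify ρ (tube v K L N (t + h)) x ∂(μ (t + h) : Measure (E d)) := by
    intro t h ht hh hb
    have hth : 0 ≤ t + h := by linarith
    have he : 0 ≤ Real.exp (L * h) - 1 :=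
      sub_nonneg.2 (Real.one_le_exp (mul_nonneg hL0 hh.le))
    refine le_trans (le_of_eq ?_) (hμ.integral_step_le hM (fun t => (hw t).continuous) ht
      (by linarith : t < t + h) hb (contDiff_mollify ρ (hc t ht))
      (hasCompactSupport_mollify ρ (hasCompactSupport_tube hv hN hK hKne))
      (contDiff_mollify ρ (hc (t + h) hth))
      (hasCompactSupport_mollify ρ (hasCompactSupport_tube hv hN hK hKne))
      (C := G * N) (η := G * (N * M * h + (Real.exp (L * h) - 1)))
      (c := N * (L * M * h ^ 2) + N * (h * (L * δ))) (by positivity) (by positivity)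
      (fun x y => ?_) (fun x => ?_) fun τ x => ?_)
    · ring
    · rw [mul_assoc]
      refine hG _ _ (hc _ hth) (hc _ hth) x y _ fun z => ?_
      have := (lipschitzWith_tube (v := v) (K := K) (L := L) (N := N) hth).dist_le_mul
        (x - z) (y - z)
      rwa [dist_sub_right, Real.dist_eq, dist_eq_norm] at this
    · exact hG _ _ (hc _ hth) (hc _ ht) x x _ fun z => abs_tube_sub_le hv hvM hK hKne ht hh.le _
    · refine mollify_le_add ρ (hc _ ht) (hc _ hth) fun z hz => ?_
      rw [hρ] at hz
      have h1 := tube_le_tube_step (N := N) hv hL hvM hK hKne (hw τ)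
        (hwv τ t ⟨ht, by linarith⟩) ht hh.le (x - z)
      have h2 := (lipschitzWith_tube (v := v) (K := K) (L := L) (N := N) hth).dist_le_mul
        (x - z + h • w τ (x - z)) (x + (t + h - t) • w τ x - z)
      have h3 : dist (x - z + h • w τ (x - z)) (x + (t + h - t) • w τ x - z) ≤
          h * (L * δ) := by
        rw [add_sub_cancel_left, dist_eq_norm]
        have : x - z + h • w τ (x - z) - (x + h • w τ x - z) = h • (w τ (x - z) - w τ x) := by
          rw [smul_sub]; abel
        rw [this, norm_smul, Real.norm_of_nonneg hh.le]
        refine mul_le_mul_of_nonneg_left (((hw τ).norm_sub_le _ _).trans ?_) hh.le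
        refine mul_le_mul_of_nonneg_left ?_ hL0
        simpa using hz
      have h4 := (abs_le.1 ((Real.dist_eq _ _).symm.le.trans
        (h2.trans (mul_le_mul_of_nonneg_left h3 hN0)))).2
      linarith
  have hn : ∀ n : ℕ, 0 < b → ∫ x, mollify ρ (tube v K L N 0) x ∂(μ 0 : Measure (E d)) -
      b * (G * (N * M * (b / (n + 1)) + (Real.exp (L * (b / (n + 1))) - 1)) * M +
        G * N * M ^ 2 * (b / (n + 1)) + N * (L * M * (b / (n + 1))) + N * L * δ) ≤
      ∫ x, mollify ρ (tube v K L N b) x ∂(μ b : Measure (E d)) := by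
    intro n hb'
    have hn1 : (0 : ℝ) < n + 1 := by positivity
    set h := b / ((n : ℝ) + 1) with hhdef
    have hh : 0 < h := by positivity
    have hnh : ((n : ℝ) + 1) * h = b := mul_div_cancel₀ b hn1.ne'
    set D := G * (N * M * h + (Real.exp (L * h) - 1)) * M +
        G * N * M ^ 2 * h + N * (L * M * h) + N * L * δ
    have hind : ∀ j : ℕ, j ≤ n + 1 → ∫ x, mollify ρ (tube v K L N 0) x ∂(μ 0 : Measure (E d)) -
        j * h * D ≤ ∫ x, mollify ρ (tube v K L N (j * h)) x ∂(μ (j * h) : Measure (E d)) := by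
      intro j hj
      induction j with
      | zero => simp
      | succ j ih =>
        have h1 := ih (by omega)
        have hj' : ((j : ℝ) + 1) ≤ n + 1 := by exact_mod_cast hj
        have h2 := hstep (j * h) h (by positivity) hh (by
          calc (j : ℝ) * h + h = (j + 1) * h := by ring
            _ ≤ (n + 1) * h := by gcongr
            _ = b := hnh)
        have h3 : ((j + 1 : ℕ) : ℝ) * h = j * h + h := by push_cast; ring
        rw [h3]
        refine le_trans (le_of_eq ?_) ((sub_le_sub_right h1 (h * D)).trans h2)
        ring
    have := hind (n + 1) le_rfl
    push_cast at this
    rwa [hnh] at this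
  have hmain : ∫ x, mollify ρ (tube v K L N 0) x ∂(μ 0 : Measure (E d)) - b * (N * L * δ) ≤
      ∫ x, mollify ρ (tube v K L N b) x ∂(μ b : Measure (E d)) := by
    rcases hb.eq_or_lt with rfl | hb'
    · simp
    have hh : Tendsto (fun n : ℕ => b / ((n : ℝ) + 1)) atTop (𝓝 0) := by
      simpa [div_eq_mul_inv] using (tendsto_one_div_add_atTop_nhds_zero_nat (𝕜 := ℝ)).const_mul b
    have hcont : Continuous fun h : ℝ => ∫ x, mollify ρ (tube v K L N 0) x ∂(μ 0 : Measure (E d)) -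
      b * (G * (N * M * h + (Real.exp (L * h) - 1)) * M +
        G * N * M ^ 2 * h + N * (L * M * h) + N * L * δ) := by fun_prop
    have hlim := (hcont.tendsto 0).comp hh
    simp only [mul_zero, Real.exp_zero, sub_self, add_zero, zero_mul, zero_add] at hlim
    exact le_of_tendsto hlim (Eventually.of_forall fun n => hn n hb')
  have hcmp : ∀ t, 0 ≤ t → |∫ x, mollify ρ (tube v K L N t) x ∂(μ t : Measure (E d)) -
      ∫ x, tube v K L N t x ∂(μ t : Measure (E d))| ≤ N * δ := by
    intro t ht
    rw [← integral_sub]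
    · have h := norm_integral_le_of_norm_le_const (μ := (μ t : Measure (E d)))
        (f := fun x => mollify ρ (tube v K L N t) x - tube v K L N t x) (C := N * δ)
        (ae_of_all _ fun x => dist_mollify_le ρ (lipschitzWith_tube (v := v) (K := K)
          (L := L) (N := N) ht) x)
      rwa [probReal_univ, mul_one] at h
    · exact (contDiff_mollify ρ (hc t ht)).continuous.integrable_of_hasCompactSupport
        (hasCompactSupport_mollify ρ (hasCompactSupport_tube hv hN hK hKne))
    · exact (hc t ht).integrable_of_hasCompactSupport (hasCompactSupport_tube hv hN hK hKne)
  have h0 := (abs_le.1 (hcmp 0 le_rfl)).1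
  have h1 := (abs_le.1 (hcmp b hb)).2
  linarith

/-- The bump dominates the indicator of `K` initially and is dominated at time `b` by that of a
neighbourhood of the image of radius `exp (L b) / N`; let `N → ∞`. -/
theorem IsWeakCurve.measureReal_le_flow {w : ℝ → E d → E d} {b : ℝ} (hb : 0 ≤ b)
    {μ : ℝ → ProbabilityMeasure (E d)} (hμ : IsWeakCurve w b μ) (hwM : ∃ M, ∀ t x, ‖w t x‖ ≤ M)
    (hwL : ∃ L : NNReal, ∀ t, LipschitzWith L (w t)) {v : E d → E d} (hv : IsVelocity v)
    {K : Set (E d)} (hK : IsCompact K)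
    (hwv : ∀ τ, ∀ t ∈ Icc 0 b, ∀ a ∈ flow v t '' K, w τ a = v a) :
    (μ 0 : Measure (E d)).real K ≤ (μ b : Measure (E d)).real (flow v b '' K) := by
  rcases K.eq_empty_or_nonempty with rfl | hKne
  · simp
  obtain ⟨M, hM⟩ := hwM
  obtain ⟨L, hL⟩ := hwL
  obtain ⟨⟨L', hL'⟩, M', hM'⟩ := id hv
  obtain ⟨Λ, hΛ⟩ := hv.lipschitzWith_flow b
  have hKb : IsCompact (flow v b '' K) := hK.image hΛ.continuous
  set L₀ := max L L'
  have hn : ∀ n : ℕ, (μ 0 : Measure (E d)).real K ≤ (μ b : Measure (E d)).real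
      (Metric.cthickening (Real.exp (L₀ * b) / (n + 1)) (flow v b '' K)) := by
    intro n
    set N : NNReal := n + 1
    have hN : 0 < N := by positivity
    have h1 := hμ.integral_tube_le hb (M := max M M') (L := L₀) (N := N)
      (fun t x => (hM t x).trans (le_max_left _ _)) (fun t => (hL t).weaken (le_max_left _ _))
      hv (hL'.weaken (le_max_right _ _)) (fun x => (hM' x).trans (le_max_right _ _)) hK hKne
      hwv hN
    have hint : ∀ t, 0 ≤ t → Integrable (tube v K L₀ N t) (μ t : Measure (E d)) := fun t ht =>
      (lipschitzWith_tube ht).continuous.integrable_of_hasCompactSupport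
        (hasCompactSupport_tube hv hN hK hKne)
    have hK0 : flow v 0 '' K = K := by simp [hv]
    have h2 : (μ 0 : Measure (E d)).real K ≤ ∫ x, tube v K L₀ N 0 x ∂(μ 0 : Measure (E d)) := by
      rw [← integral_indicator_one hK.measurableSet]
      refine integral_mono ((integrable_const (1 : ℝ)).indicator hK.measurableSet) (hint 0 le_rfl)
        fun x => ?_
      refine indicator_le' (fun y hy => ?_) (fun y _ => tube_nonneg y) x
      rw [tube_eq_one (by rwa [hK0])]
      rfl
    have hmeas := (hKb.cthickening (r := Real.exp (L₀ * b) / N)).measurableSet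
    have h3 : ∫ x, tube v K L₀ N b x ∂(μ b : Measure (E d)) ≤ (μ b : Measure (E d)).real
        (Metric.cthickening (Real.exp (L₀ * b) / N) (flow v b '' K)) := by
      rw [← integral_indicator_one hmeas]
      refine integral_mono (hint b hb) ((integrable_const (1 : ℝ)).indicator hmeas) fun x => ?_
      by_cases hx : x ∈ Metric.cthickening (Real.exp (L₀ * b) / N) (flow v b '' K)
      · rw [indicator_of_mem hx]
        exact tube_le_one x
      · rw [indicator_of_notMem hx, tube_eq_zero hN hKne hx]
    have := h2.trans (h1.trans h3)
    simpa [N] using this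
  have hr : Tendsto (fun n : ℕ => Real.exp (L₀ * b) / ((n : ℝ) + 1)) atTop (𝓝 0) := by
    simpa [div_eq_mul_inv] using
      (tendsto_one_div_add_atTop_nhds_zero_nat (𝕜 := ℝ)).const_mul (Real.exp (L₀ * b))
  have hlim := (ENNReal.tendsto_toReal (measure_ne_top _ _)).comp
    ((tendsto_measure_cthickening_of_isCompact (μ := (μ b : Measure (E d))) hKb).comp hr)
  exact ge_of_tendsto hlim (Eventually.of_forall hn)

/-! ### No controllability between `S*` and `S` -/

variable {v : E d → E d} {ω : Set (E d)}

/-- The evolved set uses open times only; the endpoints are recovered because `ω` is open. -/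
theorem flow_neg_notMem_of_notMem_evolvedSet (hv : IsVelocity v) (hω : IsOpen ω) {t : ℝ}
    (ht : 0 < t) {y : E d} (hy : y ∉ evolvedSet v ω t) {τ : ℝ} (hτ : τ ∈ Icc 0 t) :
    flow v (-τ) y ∉ ω := by
  intro h
  have hc : Continuous fun τ => flow v (-τ) y := (hv.continuous_flow_left y).comp continuous_neg
  rw [← closure_Ioo ht.ne] at hτ
  obtain ⟨σ, hσω, hσ⟩ := mem_closure_iff.1 hτ _ (hω.preimage hc) h
  exact hy (mem_iUnion₂.2 ⟨σ, hσ, _, hσω, hv.flow_flow_neg σ y⟩)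

theorem measureReal_evolvedSet_le (hv : IsVelocity v) (μ : ProbabilityMeasure (E d)) (t : ℝ) :
    (μ : Measure (E d)).real (evolvedSet v ω t) ≤ backwardMass v ω μ t := by
  have h1 : (μ : Measure (E d)).real (evolvedSet v ω t) ≤
      (μ : Measure (E d)).real (evolvedSet v ω t ∩ (μ : Measure (E d)).support) +
      (μ : Measure (E d)).real ((μ : Measure (E d)).supportᶜ) := by
    refine (measureReal_mono fun x hx => ?_).trans (measureReal_union_le _ _)
    by_cases hxs : x ∈ (μ : Measure (E d)).support
    · exact Or.inl ⟨hx, hxs⟩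
    · exact Or.inr hxs
  have h2 : (μ : Measure (E d)).real (μ : Measure (E d)).supportᶜ = 0 := by
    rw [Measure.real, Measure.measure_compl_support, ENNReal.toReal_zero]
  rw [h2, add_zero] at h1
  refine h1.trans (measureReal_mono ?_)
  rintro y ⟨hy, hys⟩
  refine ⟨hys, ?_⟩
  obtain ⟨τ, hτ, z, hz, rfl⟩ := mem_iUnion₂.1 hy
  rw [backwardEntryTime_eq hv]
  refine (entryTime_le hτ.1.le ?_).trans hτ.2.le
  rwa [hv.flow_neg, hv.flow_neg_flow]

/-- A point of the evolved set has been in `ω` less than `t` ago. The null frontier allows passing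
to the closure, whose complement is open as weak convergence requires. -/
theorem one_sub_backwardMass_le (hv : IsVelocity v) {μ : ProbabilityMeasure (E d)}
    (hac : (μ : Measure (E d)) ≪ volume) {t : ℝ}
    (hfr : volume (frontier (evolvedSet v ω t)) = 0) :
    1 - backwardMass v ω μ t ≤ (μ : Measure (E d)).real (closure (evolvedSet v ω t))ᶜ := by
  rw [probReal_compl_eq_one_sub isClosed_closure.measurableSet, closure_eq_self_union_frontier]
  have h1 := measureReal_union_le (μ := (μ : Measure (E d))) (evolvedSet v ω t)
    (frontier (evolvedSet v ω t))
  rw [Measure.real, Measure.real, Measure.real, hac hfr, ENNReal.toReal_zero, add_zero] at h1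
  have h2 := measureReal_evolvedSet_le (ω := ω) hv μ t
  rw [Measure.real] at h2 ⊢
  linarith

theorem IsSolution.measureReal_le_forwardMass (hv : IsVelocity v) (hω : IsOpen ω)
    {u : ℝ → E d → E d} (hu : IsAdmissibleControl ω u) {s t : ℝ} (hs : 0 ≤ s) (ht : 0 < t)
    {μ0 : ProbabilityMeasure (E d)} (hμ0 : IsCompact (μ0 : Measure (E d)).support)
    {μ : ℝ → ProbabilityMeasure (E d)}
    (hμ : IsSolution (fun t x => v x + localized ω u t x) (s + t) μ0 μ)
    (hent : ∀ x ∈ (μ0 : Measure (E d)).support, ∃ r, 0 ≤ r ∧ r < s + t ∧ flow v r x ∈ ω) :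
    (μ (s + t) : Measure (E d)).real (closure (evolvedSet v ω t))ᶜ ≤ forwardMass v ω μ0 s := by
  have hw := hu.isCaratheodory hv
  set w : ℝ → E d → E d := fun t x => v x + localized ω u t x with hwdef
  have hwv : ∀ τ x, x ∉ ω → w τ x = v x := fun τ x hx => by simp [hwdef, localized, hx]
  have hcurve := hμ.isWeakCurve
  set A : Set (E d) := {x | x ∈ (μ0 : Measure (E d)).support ∧ ∀ τ ∈ Icc 0 s, flow v τ x ∉ ω}
  have hA : IsCompact A := by
    refine hμ0.inter_right (t := {x | ∀ τ ∈ Icc 0 s, flow v τ x ∉ ω}) ?_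
    have : {x | ∀ τ ∈ Icc 0 s, flow v τ x ∉ ω} = ⋂ τ ∈ Icc 0 s, flow v τ ⁻¹' ωᶜ := by
      ext; simp
    rw [this]
    refine isClosed_biInter fun τ _ => ?_
    obtain ⟨Λ, hΛ⟩ := hv.lipschitzWith_flow τ
    exact hω.isClosed_compl.preimage hΛ.continuous
  have hA0 : 1 - forwardMass v ω μ0 s ≤ (μ0 : Measure (E d)).real A := by
    rw [← one_sub_forwardMass hv hω]
    refine measureReal_mono fun x hx => ⟨hx.1, fun τ hτ h => ?_⟩
    exact absurd ((entryTime_le hτ.1 h).trans hτ.2) (not_le.2 hx.2)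
  have hAs : (μ0 : Measure (E d)).real A ≤ (μ s : Measure (E d)).real (flow v s '' A) := by
    have h := (hcurve.mono (by linarith : s ≤ s + t)).measureReal_le_flow hs hw.bounded
      hw.lipschitz hv hA fun τ r hr a ha => ?_
    · rwa [hμ.initial] at h
    · obtain ⟨x, hx, rfl⟩ := ha
      exact hwv _ _ (hx.2 r hr)
  have hK : ∀ K ⊆ (closure (evolvedSet v ω t))ᶜ, IsCompact K →
      (μ (s + t) : Measure (E d)).real K ≤ forwardMass v ω μ0 s := by
    intro K hKO hKc
    have hKω : ∀ y ∈ K, ∀ τ ∈ Icc 0 t, flow v (-τ) y ∉ ω := fun y hy τ hτ =>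
      flow_neg_notMem_of_notMem_evolvedSet hv hω ht (fun h => hKO hy (subset_closure h)) hτ
    have h1 := (hcurve.reverse.mono (by linarith : t ≤ s + t)).measureReal_le_flow ht.le
      (v := -v) (K := K) ?_ ?_ hv.neg hKc ?_
    · rw [sub_zero, add_sub_cancel_right] at h1
      obtain ⟨Λ, hΛ⟩ := hv.lipschitzWith_flow s
      -- A common point would come from some `x` entering `ω` at a time `r < s + t`. If `r ≤ s`,
      -- then `x` is not in `A`; if `r > s`, its free endpoint `k` was in `ω` at most `t` ago, hence
      -- is not in `K`.
      have hdisj : Disjoint (flow (-v) t '' K) (flow v s '' A) := by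
        rw [disjoint_left]
        rintro _ ⟨k, hk, rfl⟩ ⟨x, hx, hxk⟩
        obtain ⟨r, hr0, hrT, hrω⟩ := hent x hx.1
        rcases le_or_gt r s with hrs | hrs
        · exact hx.2 r ⟨hr0, hrs⟩ hrω
        · refine hKω k hk (s + t - r) ⟨by linarith, by linarith⟩ ?_
          rw [hv.flow_neg] at hxk
          have : flow v r x = flow v (-(s + t - r)) k := by
            rw [show r = (r - s) + s by ring, hv.flow_add, hxk, ← hv.flow_add]
            congr 1
            ring
          rwa [← this]
      have h2 := measureReal_union (μ := (μ s : Measure (E d))) hdisj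
        (hA.image hΛ.continuous).measurableSet
      have h3 := measureReal_le_one (μ := (μ s : Measure (E d)))
        (s := flow (-v) t '' K ∪ flow v s '' A)
      linarith
    · obtain ⟨M, hM⟩ := hw.bounded
      exact ⟨M, fun r x => by simpa using hM _ _⟩
    · obtain ⟨L, hL⟩ := hw.lipschitz
      exact ⟨L, fun r => (hL _).neg⟩
    · rintro τ r hr _ ⟨y, hy, rfl⟩
      have h := hKω y hy r hr
      rw [hv.flow_neg, hwv _ _ h, Pi.neg_apply]
  -- Inner regularity of the open complement extends the bound from compact `K`.
  refine ENNReal.toReal_le_of_le_ofReal measureReal_nonneg (le_of_forall_lt fun r hr => ?_)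
  obtain ⟨K, hKO, hKc, hKr⟩ := isClosed_closure.isOpen_compl.exists_lt_isCompact hr
  refine hKr.trans_le ((ENNReal.le_ofReal_iff_toReal_le (measure_ne_top _ _) ?_).2 (hK K hKO hKc))
  exact measureReal_nonneg

theorem bddAbove_entryTime_union (hv : IsVelocity v) (hω : IsOpen ω)
    {μ0 μ1 : ProbabilityMeasure (E d)}
    (hμ0 : IsCompact (μ0 : Measure (E d)).support)
    (hμ1 : IsCompact (μ1 : Measure (E d)).support) (hgeo : GeometricCondition v ω μ0 μ1) :
    BddAbove (entryTime v ω '' (μ0 : Measure (E d)).support ∪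
      backwardEntryTime v ω '' (μ1 : Measure (E d)).support) := by
  obtain ⟨C, -, hC⟩ := exists_entryTime_bound hv hω hμ0 fun x hx =>
    let ⟨t, ht, h⟩ := hgeo.forward x hx
    ⟨t, ht.le, h⟩
  obtain ⟨C', -, hC'⟩ := exists_entryTime_bound hv.neg hω hμ1 fun x hx =>
    let ⟨t, ht, h⟩ := hgeo.backward x hx
    ⟨t, ht.le, by rwa [hv.flow_neg]⟩
  refine ⟨max C C', ?_⟩
  rintro _ (⟨x, hx, rfl⟩ | ⟨x, hx, rfl⟩)
  · exact le_max_of_le_left (hC x hx)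
  · rw [backwardEntryTime_eq hv]
    exact le_max_of_le_right (hC' x hx)

theorem not_approxControllable_of_lt_infimumTime (hv : IsVelocity v) (hω : IsOpen ω)
    {μ0 μ1 : ProbabilityMeasure (E d)}
    (hμ0 : IsCompact (μ0 : Measure (E d)).support)
    (hμ1 : IsCompact (μ1 : Measure (E d)).support) (hac : (μ1 : Measure (E d)) ≪ volume)
    (hgeo : GeometricCondition v ω μ0 μ1)
    (hfr : ∀ t : ℝ, 0 < t → volume (frontier (evolvedSet v ω t)) = 0) {T : ℝ}
    (hT : infimumTimeStar v ω μ0 μ1 < T) (hTS : T < infimumTime v ω μ0 μ1) :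
    ¬ ApproxControllable v ω μ0 μ1 T := by
  rintro ⟨u, μ, hu, hμ, hlim⟩
  have hbdd := bddAbove_entryTime_union hv hω hμ0 hμ1 hgeo
  set S := infimumTimeStar v ω μ0 μ1 with hS
  have hS0 : ∀ x ∈ (μ0 : Measure (E d)).support, entryTime v ω x ≤ S := fun x hx =>
    le_csSup hbdd (Or.inl (mem_image_of_mem _ hx))
  have hS1 : ∀ x ∈ (μ1 : Measure (E d)).support, entryTime (-v) ω x ≤ S := fun x hx => by
    rw [← backwardEntryTime_eq hv]
    exact le_csSup hbdd (Or.inr (mem_image_of_mem _ hx))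
  have hSnn : 0 ≤ S := by
    refine Real.sSup_nonneg ?_
    rintro _ (⟨x, -, rfl⟩ | ⟨x, -, rfl⟩)
    · exact entryTime_nonneg _ _ _
    · rw [backwardEntryTime_eq hv]
      exact entryTime_nonneg _ _ _
  obtain ⟨_, ⟨m, hm, rfl⟩, hm'⟩ := exists_lt_of_lt_csSup
    ((nonempty_Icc.2 zero_le_one).image _) hTS
  simp only at hm'
  have hF : genInverse (forwardMass v ω μ0) m ≤ S :=
    genInverse_le hSnn (by rw [forwardMass_eq_one hS0]; exact hm.2)
  have hB : genInverse (backwardMass v ω μ1) (1 - m) ≤ S :=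
    genInverse_le hSnn (by rw [backwardMass_eq hv, forwardMass_eq_one hS1]; linarith [hm.1])
  -- Both generalised inverses are at most `S* < T`, so `0 ≤ s < T`, and at this `s` the forward
  -- mass is below `m` while the backward mass at `T - s` is below `1 - m`.
  obtain ⟨s, hs1, hs2⟩ := exists_between
    (show T - genInverse (backwardMass v ω μ1) (1 - m) < genInverse (forwardMass v ω μ0) m by
      linarith)
  have hs0 : 0 ≤ s := by linarith
  have ht : 0 < T - s := by linarith
  have hFs := lt_of_lt_genInverse hs0 hs2
  have hBt := lt_of_lt_genInverse ht.le (show T - s < genInverse (backwardMass v ω μ1) (1 - m) by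
    linarith)
  have hle : ∀ k, (μ k T : Measure (E d)).real (closure (evolvedSet v ω (T - s)))ᶜ ≤
      forwardMass v ω μ0 s := by
    intro k
    have hk := hμ k
    rw [show T = s + (T - s) by ring] at hk
    have := hk.measureReal_le_forwardMass hv hω (hu k) hs0 ht hμ0 fun x hx => by
      obtain ⟨t, ht0, hgt⟩ := hgeo.forward x hx
      obtain ⟨r, h0, h1, h2⟩ := exists_of_entryTime_lt ⟨t, ht0.le, hgt⟩ ((hS0 x hx).trans_lt hT)
      exact ⟨r, h0, by linarith, h2⟩
    rwa [add_sub_cancel] at this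
  have hopen := ProbabilityMeasure.le_liminf_measure_open_of_tendsto hlim
    (isClosed_closure (s := evolvedSet v ω (T - s))).isOpen_compl
  have hlimsup : liminf (fun k => (μ k T : Measure (E d)) (closure (evolvedSet v ω (T - s)))ᶜ)
      atTop ≤ ENNReal.ofReal (forwardMass v ω μ0 s) := by
    refine liminf_le_of_le (by isBoundedDefault) fun b hb => ?_
    obtain ⟨k, hk⟩ := hb.exists
    exact hk.trans ((ENNReal.le_ofReal_iff_toReal_le (measure_ne_top _ _)
      measureReal_nonneg).2 (hle k))
  have h1 : _ ≤ forwardMass v ω μ0 s :=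
    (ENNReal.le_ofReal_iff_toReal_le (measure_ne_top _ _) measureReal_nonneg).1
      (hopen.trans hlimsup)
  have h2 := one_sub_backwardMass_le hv hac (hfr (T - s) ht)
  rw [Measure.real] at h2
  linarith

end CrowdControl

theorem theorem3 {d : ℕ} (hd : 0 < d)
    (v : CrowdControl.E d → CrowdControl.E d) (hv : CrowdControl.IsVelocity v)
    (ω : Set (CrowdControl.E d)) (hω_open : IsOpen ω) (hω_conn : IsConnected ω)
    (hω_bdd : Bornology.IsBounded ω)
    (μ0 μ1 : ProbabilityMeasure (CrowdControl.E d))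
    (hμ0_supp : IsCompact (μ0 : Measure (CrowdControl.E d)).support)
    (hμ1_supp : IsCompact (μ1 : Measure (CrowdControl.E d)).support)
    (hμ0_ac : (μ0 : Measure (CrowdControl.E d)) ≪ volume)
    (hμ1_ac : (μ1 : Measure (CrowdControl.E d)) ≪ volume)
    (hgeo : CrowdControl.GeometricCondition v ω μ0 μ1) :
    ((∃ α : ℝ, 0 < α ∧ ∀ ε ∈ Ioo 0 α,
        IsPreconnected {x : CrowdControl.E d | ε < Metric.infDist x ωᶜ}) →
      ∀ T : ℝ, CrowdControl.infimumTime v ω μ0 μ1 < T →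
        CrowdControl.ApproxControllable v ω μ0 μ1 T) ∧
    ((∀ t : ℝ, 0 < t → volume (frontier (CrowdControl.evolvedSet v ω t)) = 0) →
      ∀ T : ℝ, CrowdControl.infimumTimeStar v ω μ0 μ1 < T →
        T < CrowdControl.infimumTime v ω μ0 μ1 →
        ¬ CrowdControl.ApproxControllable v ω μ0 μ1 T) := by
  refine ⟨fun ⟨α, hα, hconn⟩ T hT => ?_, fun hfr T hT hTS => ?_⟩
  · exact CrowdControl.approxControllable_of_infimumTime_lt hd hv hω_open hω_conn.nonempty hω_bdd
      hμ0_supp hμ1_supp hμ0_ac hgeo hα hconn hT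
  · exact CrowdControl.not_approxControllable_of_lt_infimumTime hv hω_open hμ0_supp hμ1_supp
      hμ1_ac hgeo hfr hT hTS
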